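/- **Setting.** Let $\mathcal B$ be a quaternion division algebra over $\mathbb Q$, generated by $i,j$ with $i^2=a$, $j^2=b$, $ij=-ji$ ($a,b\in\mathbb Q$), which is indefinite, and fix an isomorphism $\mathcal B\otimes_{\mathbb Q}\mathbb R\simeq M_2(\mathbb R)$, so that $\mathcal B\subset M_2(\mathbb R)$. Let $\Lambda\simeq\mathbb Z^4$ be a lattice in $\mathcal B$ and let $\alpha\neq 0$ be a real number such that $N=\begin{pmatrix}0&\alpha\\-\alpha&0\end{pmatrix}\in\mathcal B$ and $\mathrm{tr}(\Lambda N\Lambda^t)\subset\mathbb Z$. Put $\Lambda'=\Lambda\cdot\mathrm{diag}(1,\alpha)\subset M_2(\mathbb R)$, and let $\Gamma$ be a torsion-free subgroup of finite index in the stabilizer $\{\gamma\in \mathrm{SL}(2,\mathbb R)\mid \Lambda'\gamma=\Lambda'\}$. The semi-direct product $\Gamma\ltimes\Lambda'$ acts freely and properly discontinuously on $\mathcal H\times\mathbb C^2$ ($\mathcal H$ the upper half plane) by $$(\gamma,\lambda)\cdot(\tau,z_1,z_2)=\Big(\tfrac{a\tau+b}{c\tau+d},\ \tfrac{z_1+m\tau+n}{c\tau+d},\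 \tfrac{z_2+k\tau+l}{c\tau+d}\Big),\qquad \gamma=\begin{pmatrix}a&b\\c&d\end{pmatrix},\ \lambda=\begin{pmatrix}m&n\\k&l\end{pmatrix}.$$ The quotient $M$, with the map $M\to\Sigma=\mathcal H/\Gamma$ induced by $(\tau,z_1,z_2)\mapsto\tau$, is called a Kuga–Shimura projective threefold over the Shimura curve $\Sigma$. Let $K_\Sigma^{1/2}$ be the square root of the canonical bundle $K_\Sigma$ given by the factor of automorphy $c\tau+d$; thus $H^0(\Sigma,K_\Sigma^{3/2})$ is the space of holomorphic functions $f$ on $\mathcal H$ with $f(\gamma\tau)=(c\tau+d)^3f(\tau)$ for $\gamma\in\Gamma$ (that is, $f\,d\tau^{3/2}$ descends to $\Sigma$). A holomorphic projective connection on $M$ is a collection $(U_i,\nabla_i)_{i\in I}$, where the $U_i$ are open subsets that cover $M$ and $\nabla_i$ is a torsion-free holomorphic affine connection on $U_i$, such that on each $U_i\cap U_j$ the connections $\nabla_i$ and $\nabla_j$ are projectively equivalent, i.e. $\nabla_{i,X}Y=\nabla_{j,X}Y+\theta(X)Y+\theta(Y)X$ for a holomorphic one-form $\theta$ on $U_i\cap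 U_j$. Two holomorphic projective connections are projectively equivalent if their union is a holomorphic projective connection. A holomorphic projective connection is flat if it is projectively equivalent to some $(U_i,\nabla_i)_{i\in I}$ such that each $\nabla_i$ is taken to the standard connection of $\mathbb C^3$ by a holomorphic coordinate function on $U_i$. A fiber $F$ is totally geodesic if, for each local representative $\nabla_i$, $\nabla_{i,v}Y$ is tangent to $F$ whenever $v$ is a vector tangent to $F$ and $Y$ is a vector field that is tangent to $F$ along $F$. **Theorem.** Let $M\to\Sigma$ be a Kuga–Shimura projective threefold. (i) The set of projective equivalence classes of holomorphic projective connections on $M$ is a (nonempty) affine space for the complex vector space $H^0(\Sigma,K_\Sigma^{3/2})^2$. Here $(A,B)$ acts by adding to the local representatives the tensor $\Theta_{A,B}$ on $M$ induced by the invariant tensor $d\tau\otimes d\tau\otimes\big(A(\tau)\frac{\partial}{\partial z_1}+B(\tau)\frac{\partial}{\partial z_2}\big)$ on $\mathcal H\times\mathbb C^2$. (ii) Every holomorphic projective connection on $M$ is flat, and the fibers of $M\to\Sigma$ are totally geodesic for every holomorphic projective connection on $M$. -/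

import Mathlib

open scoped Manifold ContDiff MatrixGroups Topology UpperHalfPlane TensorProduct

/-! ### Quotients of complex manifolds -/

section OrbitQuotient
variable {E H M G : Type*} [NormedAddCommGroup E] [NormedSpace ℂ E] [TopologicalSpace H]
  (I : ModelWithCorners ℂ E H) [TopologicalSpace M] [ChartedSpace H M]
  [Group G] [MulAction G M]
  [ProperlyDiscontinuousSMul G M] [ContinuousConstSMul G M] [IsCancelSMul G M]
  [T2Space M] [LocallyCompactSpace M]

/-- The quotient of a complex manifold by a free and properly discontinuous action by holomorphic maps
is a complex manifold, for the charted space structure for which the projection is a local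
isomorphism. -/
theorem isManifold_orbitQuotient [IsManifold I ω M]
    (h : ∀ g : G, ContMDiff I I ω (fun x : M => g • x)) :
    IsManifold I ω (MulAction.orbitRel.Quotient G M) := by
  have hq := isQuotientCoveringMap_quotientMk_of_properlyDiscontinuousSMul (G := G) (E := M)
  have hl : IsLocalHomeomorph (Quotient.mk (MulAction.orbitRel G M)) :=
    hq.isCoveringMap.isLocalHomeomorph
  apply isManifold_of_contDiffOn
  have key : ∀ a b : M, ContDiffOn ℂ ω
      (I ∘ ((hl.localInverseAt a).trans (chartAt H a)).symm.trans
        ((hl.localInverseAt b).trans (chartAt H b)) ∘ I.symm)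
      (I.symm ⁻¹' (((hl.localInverseAt a).trans (chartAt H a)).symm.trans
        ((hl.localInverseAt b).trans (chartAt H b))).source ∩ Set.range I) := by
    rintro a b _ ⟨hu, y, rfl⟩
    simp only [Set.mem_preimage, I.left_inv, OpenPartialHomeomorph.trans_source,
      OpenPartialHomeomorph.trans_symm_eq_symm_trans_symm, OpenPartialHomeomorph.symm_source,
      OpenPartialHomeomorph.coe_trans, Set.mem_inter_iff,
      Function.comp_apply, IsLocalHomeomorph.localInverseAt_symm] at hu
    obtain ⟨⟨hy, hx⟩, hs, ht⟩ := hu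
    set x := (chartAt H a).symm y with hxdef
    set p : MulAction.orbitRel.Quotient G M := Quotient.mk _ x with hp
    have h2 : (Quotient.mk (MulAction.orbitRel G M) (hl.localInverseAt b p)) = p :=
      hl.apply_localInverseAt_of_mem hs
    obtain ⟨g, hg⟩ : hl.localInverseAt b p ∈ MulAction.orbit G x := Quotient.exact h2
    have hg' : g • x = hl.localInverseAt b p := hg
    have hcont : ContinuousAt (fun z : M => g • z) x := (continuous_const_smul g).continuousAt
    have hev : ∀ᶠ z in 𝓝 x, hl.localInverseAt b (Quotient.mk _ z) = g • z := by
      have e1 : ∀ᶠ z in 𝓝 x, g • z ∈ (hl.localInverseAt b).target := by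
        apply hcont
        change _ ∈ 𝓝 (g • x)
        rw [hg']
        exact (hl.localInverseAt b).open_target.mem_nhds ((hl.localInverseAt b).map_source hs)
      filter_upwards [e1] with z hz
      have h3 : (Quotient.mk (MulAction.orbitRel G M) (g • z)) = Quotient.mk _ z :=
        Quotient.sound ⟨g, rfl⟩
      rw [← h3]
      have := (hl.localInverseAt b).right_inv hz
      rwa [hl.localInverseAt_symm] at this
    have hF : ContMDiffAt I I ω ((chartAt H b) ∘ (fun z : M => g • z) ∘ (chartAt H a).symm) y := by
      have c1 : ContMDiffAt I I ω (chartAt H a).symm y :=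
        (contMDiffOn_chart_symm (n := ω)).contMDiffAt ((chartAt H a).open_target.mem_nhds hy)
      have c3 : ContMDiffAt I I ω (chartAt H b) (g • x) := by
        rw [hg']
        exact (contMDiffOn_chart (n := ω)).contMDiffAt ((chartAt H b).open_source.mem_nhds ht)
      exact c3.comp y ((h g).contMDiffAt.comp y c1)
    have hF' := (contMDiffAt_iff.1 hF).2
    simp only [chartAt_self_eq, mfld_simps] at hF'
    refine (hF'.mono Set.inter_subset_right).congr_of_eventuallyEq ?_ ?_
    · have hc : Filter.Tendsto (fun u => (chartAt H a).symm (I.symm u)) (𝓝 (I y)) (𝓝 x) := by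
        have : ContinuousAt (chartAt H a).symm (I.symm (I y)) := by
          rw [I.left_inv]; exact (chartAt H a).continuousAt_symm hy
        have := this.comp I.continuous_symm.continuousAt
        simpa [ContinuousAt, Function.comp_def] using this
      filter_upwards [nhdsWithin_le_nhds (hc.eventually hev)] with u hu
      simp [Function.comp_def, hu]
    · simp [Function.comp_def, ← hxdef, hg', hp]
  rintro _ _ ⟨p, rfl⟩ ⟨p', rfl⟩
  exact key _ _

end OrbitQuotient

/-! ### The quaternionic lattice and its stabilizer -/

/-- An indefinite quaternion division algebra `B = (a, b)` over `ℚ`, with `i² = a`, `j² = b`,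
`ij = -ji`, an identification of `B ⊗ ℝ` with the real `2 × 2` matrices, a lattice `Λ ≅ ℤ⁴` in `B`
(the `ℤ`-span of a `ℚ`-basis), and a nonzero antisymmetric matrix `M = (0, α; -α, 0)` in `B` with
`tr (Λ M Λᵗ) ⊆ ℤ`. -/
structure QuaternionicLattice where
  a : ℚ
  b : ℚ
  isUnit_of_ne_zero : ∀ x : QuaternionAlgebra ℚ a 0 b, x ≠ 0 → IsUnit x
  split : (ℝ ⊗[ℚ] QuaternionAlgebra ℚ a 0 b) ≃ₐ[ℝ] Matrix (Fin 2) (Fin 2) ℝ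
  basis : Module.Basis (Fin 4) ℚ (QuaternionAlgebra ℚ a 0 b)
  α : ℝ
  α_ne_zero : α ≠ 0
  antisymm_mem : ∃ μ : QuaternionAlgebra ℚ a 0 b, split (1 ⊗ₜ μ) = !![0, α; -α, 0]
  trace_integral : ∀ x ∈ Submodule.span ℤ (Set.range basis),
    ∀ y ∈ Submodule.span ℤ (Set.range basis), ∃ n : ℤ,
      (split (1 ⊗ₜ x) * !![0, α; -α, 0] * (split (1 ⊗ₜ y)).transpose).trace = n

namespace QuaternionicLattice
variable (D : QuaternionicLattice)

/-- `x ↦ x · diag(1, α)`, as a map from `B` to real matrices. -/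
noncomputable def period : (QuaternionAlgebra ℚ D.a 0 D.b) →+ Matrix (Fin 2) (Fin 2) ℝ where
  toFun x := D.split (1 ⊗ₜ x) * !![1, 0; 0, D.α]
  map_zero' := by simp
  map_add' x y := by simp [TensorProduct.tmul_add, add_mul]

/-- The lattice `Λ · diag(1, α)` of real matrices. The period of a matrix `X` of this lattice at `τ`
is the vector `X · (τ, 1)ᵗ` of `ℂ²`; for `X = λ · diag(1, α)` it is `λ · (τ, α)ᵗ`. -/
noncomputable def periodLattice : AddSubgroup (Matrix (Fin 2) (Fin 2) ℝ) :=
  (Submodule.span ℤ (Set.range D.basis)).toAddSubgroup.map D.period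

/-- The stabilizer of the lattice `Λ · diag(1, α)` in `SL(2, ℝ)` (acting by right multiplication). -/
def stab : Subgroup SL(2, ℝ) where
  carrier := {γ | ∀ X : Matrix (Fin 2) (Fin 2) ℝ, X * γ.1 ∈ D.periodLattice ↔ X ∈ D.periodLattice}
  one_mem' := by intro X; simp
  mul_mem' := by
    intro g h hg hh X
    rw [Matrix.SpecialLinearGroup.coe_mul, ← mul_assoc, hh, hg]
  inv_mem' := by
    intro g hg X
    rw [← hg, mul_assoc, ← Matrix.SpecialLinearGroup.coe_mul, inv_mul_cancel]
    simp

theorem exists_basis : ∃ b : Module.Basis (Fin 4) ℝ (Matrix (Fin 2) (Fin 2) ℝ),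
    (D.periodLattice : Set (Matrix (Fin 2) (Fin 2) ℝ)) = Submodule.span ℤ (Set.range b) := by
  let u : (Matrix (Fin 2) (Fin 2) ℝ)ˣ :=
    ⟨!![1, 0; 0, D.α], !![1, 0; 0, D.α⁻¹],
      by simp [Matrix.one_fin_two, D.α_ne_zero], by simp [Matrix.one_fin_two, D.α_ne_zero]⟩
  let e : Matrix (Fin 2) (Fin 2) ℝ ≃ₗ[ℝ] Matrix (Fin 2) (Fin 2) ℝ :=
    LinearEquiv.ofBijective (LinearMap.mulRight ℝ (u : Matrix (Fin 2) (Fin 2) ℝ))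
      ⟨fun x y h => by simpa using h, fun y => ⟨y * ((u⁻¹ : (Matrix (Fin 2) (Fin 2) ℝ)ˣ) : Matrix (Fin 2) (Fin 2) ℝ), by
        rw [LinearMap.mulRight_apply, mul_assoc, Units.inv_mul, mul_one]⟩⟩
  refine ⟨((D.basis.baseChange ℝ).map D.split.toLinearEquiv).map e, ?_⟩
  have h1 : D.periodLattice = (Submodule.span ℤ (Set.range
    (((D.basis.baseChange ℝ).map D.split.toLinearEquiv).map e))).toAddSubgroup := by
    have h2 : (Set.range (((D.basis.baseChange ℝ).map D.split.toLinearEquiv).map e))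
      = D.period.toIntLinearMap '' Set.range D.basis := by
      rw [← Set.range_comp]
      congr 1
      funext i
      simp only [Module.Basis.map_apply, Module.Basis.baseChange_apply]
      rfl
    rw [h2, Submodule.span_image]
    rfl
  rw [h1]; rfl

theorem finite_inter {s : Set (Matrix (Fin 2) (Fin 2) ℝ)} (hs : IsCompact s) :
    (s ∩ (D.periodLattice : Set (Matrix (Fin 2) (Fin 2) ℝ))).Finite := by
  obtain ⟨b, hb⟩ := D.exists_basis
  rw [hb]
  let : NormedAddCommGroup (Matrix (Fin 2) (Fin 2) ℝ) := Matrix.normedAddCommGroup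
  let : NormedSpace ℝ (Matrix (Fin 2) (Fin 2) ℝ) := Matrix.normedSpace
  have : ProperSpace (Matrix (Fin 2) (Fin 2) ℝ) := pi_properSpace
  exact ZSpan.setFinite_inter b hs.isBounded

instance : DiscreteTopology D.stab := by
  obtain ⟨b, hb⟩ := D.exists_basis
  have hbm : ∀ i, b i ∈ D.periodLattice := fun i => by
    rw [← SetLike.mem_coe, hb]; exact Submodule.subset_span ⟨i, rfl⟩
  -- a compact neighbourhood of `1` meets the group in finitely many elements
  have : LocallyCompactSpace (Matrix (Fin 2) (Fin 2) ℝ) :=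
    inferInstanceAs (LocallyCompactSpace (Fin 2 → Fin 2 → ℝ))
  have : LocallyCompactSpace SL(2, ℝ) :=
    Matrix.SpecialLinearGroup.isClosedEmbedding_val.locallyCompactSpace
  obtain ⟨K, hK, h1K⟩ := exists_compact_mem_nhds (1 : SL(2, ℝ))
  have hfin : (K ∩ (D.stab : Set SL(2, ℝ))).Finite := by
    have hf : ∀ i, ((fun γ : SL(2, ℝ) => b i * γ.1) '' K ∩ D.periodLattice).Finite :=
      fun i => D.finite_inter (hK.image (by fun_prop))
    refine Set.Finite.of_finite_image (f := fun γ : SL(2, ℝ) => fun i => b i * γ.1)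
      ((Set.Finite.pi' hf).subset ?_) ?_
    · rintro _ ⟨γ, ⟨hγ, hs⟩, rfl⟩ i
      exact ⟨⟨γ, hγ, rfl⟩, (hs _).2 (hbm i)⟩
    · intro γ _ γ' _ h
      have h' : LinearMap.mulRight ℝ γ.1 = LinearMap.mulRight ℝ γ'.1 :=
        b.ext fun i => congrFun h i
      have := LinearMap.congr_fun h' 1
      exact Subtype.ext (by simpa using this)
  have hfin' : (((↑) : D.stab → SL(2, ℝ)) ⁻¹' K).Finite :=
    Set.Finite.of_finite_image (hfin.subset (by rintro _ ⟨γ, hγ, rfl⟩; exact ⟨hγ, γ.2⟩))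
      Subtype.val_injective.injOn
  rw [discreteTopology_iff_isOpen_singleton_one]
  have hn : (((↑) : D.stab → SL(2, ℝ)) ⁻¹' K) ∈ 𝓝 (1 : D.stab) :=
    continuous_subtype_val.continuousAt (by simpa using h1K)
  exact isOpen_singleton_of_finite_mem_nhds _ hn hfin'
end QuaternionicLattice

/-! ### The Kuga-Shimura threefold -/

/-- The data that define a Kuga-Shimura projective threefold: a quaternionic lattice and a torsion-free
subgroup `Γ` of finite index in the stabilizer of `Λ · diag(1, α)` in `SL(2, ℝ)`. -/
structure KugaShimuraDatum extends QuaternionicLattice where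
  Γ : Subgroup SL(2, ℝ)
  Γ_le : Γ ≤ toQuaternionicLattice.stab
  finiteIndex : (Γ.subgroupOf toQuaternionicLattice.stab).FiniteIndex
  torsionFree : ∀ γ ∈ Γ, IsOfFinOrder γ → γ = 1

/-- The factor of automorphy `cτ + d`. -/
noncomputable def autFactor (γ : SL(2, ℝ)) (τ : ℍ) : ℂ := (γ.1 1 0 : ℂ) * τ + (γ.1 1 1 : ℂ)

theorem autFactor_eq (γ : SL(2, ℝ)) (τ : ℍ) :
    autFactor γ τ = UpperHalfPlane.denom (γ : GL (Fin 2) ℝ) τ := rfl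

theorem autFactor_ne_zero (γ : SL(2, ℝ)) (τ : ℍ) : autFactor γ τ ≠ 0 :=
  UpperHalfPlane.denom_ne_zero (γ : GL (Fin 2) ℝ) τ

theorem autFactor_mul (γ γ' : SL(2, ℝ)) (τ : ℍ) :
    autFactor (γ * γ') τ = autFactor γ (γ' • τ) * autFactor γ' τ := by
  have := UpperHalfPlane.coe_specialLinearGroup_apply γ' τ
  have h0 := autFactor_ne_zero γ' τ
  simp only [autFactor] at *
  rw [this]
  simp [Matrix.mul_apply, Fin.sum_univ_two] at *
  field_simp
  ring

namespace KugaShimuraDatum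
variable (D : KugaShimuraDatum)

/-- The universal cover `ℍ × ℂ²`, with coordinates `(τ, z₁, z₂)`. -/
abbrev Cover : Type := ℍ × ℂ × ℂ

/-- The semi-direct product of `Γ` and the lattice. -/
@[ext]
structure Grp where
  γ : D.Γ
  lam : D.periodLattice

variable {D} in
/-- Right multiplication of the lattice by an element of `Γ`. -/
def latticeMul (X : D.periodLattice) (γ : D.Γ) : D.periodLattice :=
  ⟨X.1 * γ.1.1, (D.Γ_le γ.2 X.1).2 X.2⟩

/-- The group law for which the formula below is an action. -/
noncomputable instance : Group D.Grp where
  mul g h := ⟨g.γ * h.γ, h.lam + latticeMul g.lam h.γ⟩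
  one := ⟨1, 0⟩
  inv g := ⟨g.γ⁻¹, -latticeMul g.lam g.γ⁻¹⟩
  mul_assoc g h k := by
    refine Grp.ext (mul_assoc _ _ _) (Subtype.ext ?_)
    change k.lam.1 + (h.lam.1 + g.lam.1 * h.γ.1.1) * k.γ.1.1 =
      (k.lam.1 + h.lam.1 * k.γ.1.1) + g.lam.1 * (h.γ.1 * k.γ.1).1
    rw [Matrix.SpecialLinearGroup.coe_mul, add_mul, mul_assoc, add_assoc]
  one_mul g := by
    refine Grp.ext (one_mul _) (Subtype.ext ?_)
    change g.lam.1 + 0 * g.γ.1.1 = _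
    simp
  mul_one g := by
    refine Grp.ext (mul_one _) (Subtype.ext ?_)
    change 0 + g.lam.1 * (1 : SL(2, ℝ)).1 = _
    simp
  inv_mul_cancel g := by
    refine Grp.ext (inv_mul_cancel _) (Subtype.ext ?_)
    change g.lam.1 + -(g.lam.1 * (g.γ.1⁻¹).1) * g.γ.1.1 = 0
    rw [neg_mul, mul_assoc, ← Matrix.SpecialLinearGroup.coe_mul, inv_mul_cancel]
    simp

/-- `(γ, λ) · (τ, z₁, z₂) = (γτ, (z₁ + mτ + n) / (cτ + d), (z₂ + kτ + l) / (cτ + d))` for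
`γ = (a, b; c, d)` and `λ = (m, n; k, l)`. -/
noncomputable instance : SMul D.Grp Cover where
  smul g x := (g.γ • x.1,
    (x.2.1 + ((g.lam.1 0 0 : ℂ) * x.1 + (g.lam.1 0 1 : ℂ))) / autFactor g.γ.1 x.1,
    (x.2.2 + ((g.lam.1 1 0 : ℂ) * x.1 + (g.lam.1 1 1 : ℂ))) / autFactor g.γ.1 x.1)

theorem smul_def (g : D.Grp) (x : Cover) : g • x = (g.γ • x.1,
    (x.2.1 + ((g.lam.1 0 0 : ℂ) * x.1 + (g.lam.1 0 1 : ℂ))) / autFactor g.γ.1 x.1,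
    (x.2.2 + ((g.lam.1 1 0 : ℂ) * x.1 + (g.lam.1 1 1 : ℂ))) / autFactor g.γ.1 x.1) := rfl

noncomputable instance : MulAction D.Grp Cover where
  one_smul x := by
    rw [smul_def]
    change ((1 : D.Γ) • x.1, (x.2.1 + (((0 : ℝ) : ℂ) * x.1 + ((0 : ℝ) : ℂ))) / autFactor 1 x.1,
      (x.2.2 + (((0 : ℝ) : ℂ) * x.1 + ((0 : ℝ) : ℂ))) / autFactor 1 x.1) = x
    simp [autFactor]
  mul_smul g h x := by
    have hd := autFactor_ne_zero h.γ.1 x.1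
    have hd' := autFactor_ne_zero g.γ.1 (h.γ.1 • x.1)
    have hh : ((h.γ.1 • x.1 : ℍ) : ℂ) =
        ((h.γ.1.1 0 0 : ℂ) * x.1 + (h.γ.1.1 0 1 : ℂ)) / autFactor h.γ.1 x.1 :=
      UpperHalfPlane.coe_specialLinearGroup_apply h.γ.1 x.1
    have key : ∀ (i : Fin 2) (z : ℂ),
        (z + ((((h.lam.1 + g.lam.1 * h.γ.1.1) i 0 : ℝ) : ℂ) * x.1 +
          (((h.lam.1 + g.lam.1 * h.γ.1.1) i 1 : ℝ) : ℂ))) / autFactor (g.γ.1 * h.γ.1) x.1 =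
        ((z + ((h.lam.1 i 0 : ℂ) * x.1 + (h.lam.1 i 1 : ℂ))) / autFactor h.γ.1 x.1 +
          ((g.lam.1 i 0 : ℂ) * (h.γ.1 • x.1 : ℍ) + (g.lam.1 i 1 : ℂ))) /
          autFactor g.γ.1 (h.γ.1 • x.1) := by
      intro i z
      rw [autFactor_mul, hh, div_eq_div_iff (mul_ne_zero hd' hd) hd']
      have h3 : (h.γ.1.1 1 0 : ℂ) * x.1 + (h.γ.1.1 1 1 : ℂ) = autFactor h.γ.1 x.1 := rfl
      simp only [Matrix.add_apply, Matrix.mul_apply, Fin.sum_univ_two]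
      push_cast
      field_simp
      rw [← h3]
      ring
    exact Prod.ext (mul_smul g.γ h.γ x.1) (Prod.ext (key 0 x.2.1) (key 1 x.2.2))

instance : DiscreteTopology D.Γ :=
  have : DiscreteTopology ((D.stab : Set SL(2, ℝ)) : Set SL(2, ℝ)) :=
    inferInstanceAs (DiscreteTopology D.stab)
  (Topology.IsEmbedding.inclusion D.Γ_le).discreteTopology

theorem contMDiff_autFactor (γ : SL(2, ℝ)) : ContMDiff 𝓘(ℂ) 𝓘(ℂ) ω (autFactor γ) :=
  UpperHalfPlane.contMDiff_denom (γ : GL (Fin 2) ℝ)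

theorem contMDiff_moebius (γ : D.Γ) : ContMDiff 𝓘(ℂ) 𝓘(ℂ) ω (fun τ : ℍ => γ • τ) :=
  UpperHalfPlane.contMDiff_smul (g := (γ.1 : GL (Fin 2) ℝ)) (by simp)

theorem contMDiff_smul (g : D.Grp) :
    ContMDiff (𝓘(ℂ).prod 𝓘(ℂ, ℂ × ℂ)) (𝓘(ℂ).prod 𝓘(ℂ, ℂ × ℂ)) ω (fun x : Cover => g • x) := by
  have h0 : ContMDiff (𝓘(ℂ).prod 𝓘(ℂ, ℂ × ℂ)) 𝓘(ℂ) ω (fun x : Cover => (x.1 : ℂ)) :=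
    UpperHalfPlane.contMDiff_coe.comp contMDiff_fst
  have hi : ContMDiff (𝓘(ℂ).prod 𝓘(ℂ, ℂ × ℂ)) 𝓘(ℂ) ω
      (fun x : Cover => (autFactor g.γ.1 x.1)⁻¹) :=
    (UpperHalfPlane.contMDiff_inv_denom (g.γ.1 : GL (Fin 2) ℝ)).comp contMDiff_fst
  have hz : ContMDiff (𝓘(ℂ).prod 𝓘(ℂ, ℂ × ℂ)) 𝓘(ℂ, ℂ × ℂ) ω (fun x : Cover => x.2) :=
    contMDiff_snd
  have h1 : ContMDiff (𝓘(ℂ).prod 𝓘(ℂ, ℂ × ℂ)) 𝓘(ℂ) ω (fun x : Cover => x.2.1) :=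
    (contDiff_fst.contMDiff).comp hz
  have h2 : ContMDiff (𝓘(ℂ).prod 𝓘(ℂ, ℂ × ℂ)) 𝓘(ℂ) ω (fun x : Cover => x.2.2) :=
    (contDiff_snd.contMDiff).comp hz
  refine ContMDiff.prodMk ((D.contMDiff_moebius g.γ).comp contMDiff_fst) ?_
  refine ContMDiff.prodMk_space ?_ ?_
  · simp only [div_eq_mul_inv]
    exact (h1.add ((contMDiff_const.mul h0).add contMDiff_const)).mul hi
  · simp only [div_eq_mul_inv]
    exact (h2.add ((contMDiff_const.mul h0).add contMDiff_const)).mul hi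

instance : ContinuousConstSMul D.Grp Cover where
  continuous_const_smul g := (D.contMDiff_smul g).continuous

theorem eq_one_of_smul_eq (γ : D.Γ) (τ : ℍ) (h : γ • τ = τ) : γ = 1 := by
  have hf := ProperlyDiscontinuousSMul.finite_disjoint_inter_image (Γ := D.Γ) (T := ℍ)
    (isCompact_singleton (x := τ)) (isCompact_singleton (x := τ))
  have hfin : IsOfFinOrder γ := by
    rw [← finite_powers]
    refine hf.subset ?_
    rintro _ ⟨n, rfl⟩
    have : γ ^ n • τ = τ := by
      induction n with
      | zero => simp
      | succ n ih => rw [pow_succ, mul_smul, h, ih]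
    simp [this]
  exact Subtype.ext (D.torsionFree _ γ.2 (by simpa using! (D.Γ.subtype.isOfFinOrder hfin)))

theorem period_eq (X Y : Matrix (Fin 2) (Fin 2) ℝ) (τ : ℍ)
    (h : ∀ i, (X i 0 : ℂ) * τ + (X i 1 : ℂ) = (Y i 0 : ℂ) * τ + (Y i 1 : ℂ)) : X = Y := by
  have him := τ.im_ne_zero
  have h0 : ∀ i, X i 0 = Y i 0 := fun i => by
    have := congrArg Complex.im (h i)
    simpa [him] using this
  have h1 : ∀ i, X i 1 = Y i 1 := fun i => by
    have := h i
    rw [h0] at this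
    exact_mod_cast add_left_cancel this
  ext i j
  fin_cases j
  exacts [h0 i, h1 i]

instance : IsCancelSMul D.Γ ℍ where
  left_cancel' g x y h := smul_left_cancel g h
  right_cancel' g h x e := by
    have : (h⁻¹ * g) • x = x := by rw [mul_smul, e, inv_smul_smul]
    exact (inv_mul_eq_one.1 (D.eq_one_of_smul_eq _ _ this)).symm

instance : IsCancelSMul D.Grp Cover where
  left_cancel' g x y h := smul_left_cancel g h
  right_cancel' g h x e := by
    have hγ : g.γ = h.γ := IsCancelSMul.right_cancel _ _ x.1 (congrArg Prod.fst e)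
    refine Grp.ext hγ (Subtype.ext (period_eq _ _ x.1 fun i => ?_))
    have h1 := congrArg (fun y : Cover => y.2.1) e
    have h2 := congrArg (fun y : Cover => y.2.2) e
    simp only [smul_def, hγ] at h1 h2
    rw [div_left_inj' (autFactor_ne_zero _ _)] at h1 h2
    fin_cases i
    exacts [add_left_cancel h1, add_left_cancel h2]

instance : ProperlyDiscontinuousSMul D.Grp Cover where
  finite_disjoint_inter_image {K L} hK hL := by
    have hΓ := ProperlyDiscontinuousSMul.finite_disjoint_inter_image (Γ := D.Γ) (T := ℍ)
      (hK.image continuous_fst) (hL.image continuous_fst)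
    -- the lattice part is a continuous function of the source point and of the target point
    let F : D.Γ → Cover × Cover → Matrix (Fin 2) (Fin 2) ℝ := fun γ p =>
      let w : ℂ × ℂ := autFactor γ.1 p.1.1 • p.2.2 - p.1.2
      !![w.1.im / p.1.1.im, w.1.re - w.1.im / p.1.1.im * p.1.1.re;
         w.2.im / p.1.1.im, w.2.re - w.2.im / p.1.1.im * p.1.1.re]
    have hF : ∀ γ, Continuous (F γ) := by
      intro γ
      have hj : Continuous (autFactor γ.1) := (contMDiff_autFactor γ.1).continuous
      have hi : Continuous fun p : Cover × Cover => p.1.1.im :=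
        UpperHalfPlane.continuous_im.comp (continuous_fst.comp continuous_fst)
      have hr : Continuous fun p : Cover × Cover => p.1.1.re :=
        UpperHalfPlane.continuous_re.comp (continuous_fst.comp continuous_fst)
      have hi0 : ∀ p : Cover × Cover, p.1.1.im ≠ 0 := fun p => p.1.1.im_ne_zero
      have hw : Continuous fun p : Cover × Cover => autFactor γ.1 p.1.1 • p.2.2 - p.1.2 := by
        fun_prop
      refine continuous_matrix fun i j => ?_
      fin_cases i <;> fin_cases j <;> simp only [F] <;> fun_prop (disch := assumption)
    have hfin : ∀ γ, (F γ '' (K ×ˢ L) ∩ D.periodLattice).Finite := fun γ =>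
      D.finite_inter ((hK.prod hL).image (hF γ))
    refine Set.Finite.of_finite_image (f := fun g : D.Grp => (g.γ, g.lam.1))
      ((hΓ.biUnion fun γ _ => (Set.finite_singleton γ).prod (hfin γ)).subset ?_) ?_
    · rintro _ ⟨g, hg, rfl⟩
      obtain ⟨_, ⟨x, hx, rfl⟩, hy⟩ := hg
      have hne : ((fun τ : ℍ => g.γ • τ) '' (Prod.fst '' K) ∩ Prod.fst '' L).Nonempty :=
        ⟨g.γ • x.1, ⟨x.1, ⟨x, hx, rfl⟩, rfl⟩, ⟨g • x, hy, rfl⟩⟩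
      refine Set.mem_biUnion (x := g.γ) hne ⟨rfl, ⟨(x, g • x), ⟨hx, hy⟩, ?_⟩, g.lam.2⟩
      have h0 := autFactor_ne_zero g.γ.1 x.1
      have him := x.1.im_ne_zero
      have hw : autFactor g.γ.1 x.1 • (g • x).2 - x.2 =
          ((g.lam.1 0 0 : ℂ) * x.1 + (g.lam.1 0 1 : ℂ),
            (g.lam.1 1 0 : ℂ) * x.1 + (g.lam.1 1 1 : ℂ)) := by
        simp only [smul_def]
        ext1 <;> simp [mul_div_cancel₀ _ h0]
      simp only [F, hw]
      ext i j
      fin_cases i <;> fin_cases j <;> simp [him]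
    · intro g _ h _ e
      simp only [Prod.mk.injEq] at e
      exact Grp.ext e.1 (Subtype.ext e.2)

/-- The model of `ℍ × ℂ²` as a complex manifold of dimension three. -/
noncomputable abbrev model : ModelWithCorners ℂ (ℂ × ℂ × ℂ) (ModelProd ℂ (ℂ × ℂ)) :=
  𝓘(ℂ).prod 𝓘(ℂ, ℂ × ℂ)

/-- The Shimura curve `Σ = ℍ / Γ`. -/
abbrev Curve : Type := MulAction.orbitRel.Quotient D.Γ ℍ

/-- The Kuga-Shimura threefold, the quotient of `ℍ × ℂ²` by the semi-direct product of `Γ` and the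
lattice. -/
abbrev Threefold : Type := MulAction.orbitRel.Quotient D.Grp Cover

instance : IsManifold 𝓘(ℂ) ω D.Curve := isManifold_orbitQuotient _ D.contMDiff_moebius

instance : IsManifold model ω D.Threefold := isManifold_orbitQuotient _ D.contMDiff_smul

/-- The universal covering `ℍ → Σ`. -/
noncomputable def curveProj (τ : ℍ) : D.Curve := Quotient.mk _ τ

/-- The universal covering `ℍ × ℂ² → M`. -/
noncomputable def proj (x : Cover) : D.Threefold := Quotient.mk _ x

/-- The Kuga-Shimura fibration `M → Σ`, induced by `(τ, z₁, z₂) ↦ τ`. -/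
noncomputable def fibration : D.Threefold → D.Curve :=
  Quotient.map Prod.fst (by rintro _ y ⟨g, rfl⟩; exact ⟨g.γ, rfl⟩)

/-- The fibre over a point `p` of `Σ` of the line bundle `K_Σ^{k/2}`, the `k`-th power of the square
root of `K_Σ` given by the factor of automorphy `cτ + d`: a vector of the fibre is a function `v` on
the points `τ` of `ℍ` above `p` such that `v(τ) (dτ)^{k/2}` is invariant under `Γ`, where `dτ` is
transformed to `(cτ + d)⁻² dτ`. -/
def halfCanonicalFiber (k : ℕ) (p : D.Curve) : Submodule ℂ ({τ : ℍ // D.curveProj τ = p} → ℂ) where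
  carrier := {v | ∀ (γ : D.Γ) (τ τ' : {τ : ℍ // D.curveProj τ = p}), τ'.1 = γ • τ.1 →
    v τ' = autFactor γ.1 τ.1 ^ k * v τ}
  add_mem' hv hw γ τ τ' h := by simp [hv γ τ τ' h, hw γ τ τ' h, mul_add]
  zero_mem' γ τ τ' h := by simp
  smul_mem' c v hv γ τ τ' h := by simp [hv γ τ τ' h]; ring

variable {D} in
/-- The function on `ℍ` that represents a section of `K_Σ^{k/2}`. -/
noncomputable def sectionLift {k : ℕ} (s : Π p, D.halfCanonicalFiber k p) (τ : ℍ) : ℂ :=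
  (s (D.curveProj τ)).1 ⟨τ, rfl⟩

/-- The space `H⁰(Σ, K_Σ^{k/2})` of global holomorphic sections. -/
def H0 (k : ℕ) : Submodule ℂ (Π p, D.halfCanonicalFiber k p) where
  carrier := {s | ContMDiff 𝓘(ℂ) 𝓘(ℂ) ω (sectionLift s)}
  add_mem' hs ht := ContMDiff.add hs ht
  zero_mem' := contMDiff_const
  smul_mem' _ _ hs := contMDiff_const.mul hs

/-- The complex vector space `H⁰(Σ, K_Σ^{3/2})²`. -/
def SectionPairs : Type := D.H0 3 × D.H0 3

noncomputable instance : AddCommGroup D.SectionPairs :=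
  inferInstanceAs (AddCommGroup (D.H0 3 × D.H0 3))

noncomputable instance : Module ℂ D.SectionPairs :=
  inferInstanceAs (Module ℂ (D.H0 3 × D.H0 3))

end KugaShimuraDatum

/-! ### Holomorphic projective connections -/

section Projective
open Bundle TopologicalSpace

variable {E : Type*} [NormedAddCommGroup E] [NormedSpace ℂ E]
  {H : Type*} [TopologicalSpace H] (I : ModelWithCorners ℂ E H)
  (M : Type*) [TopologicalSpace M] [ChartedSpace H M] [IsManifold I ω M]

variable {M} in
/-- `θ` is a holomorphic one-form on `W`. -/
def IsHolomorphicOneFormOn (θ : Π x : M, TangentSpace I x →L[ℂ] ℂ) (W : Set M) : Prop :=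
  ContMDiffOn I (I.prod 𝓘(ℂ, E →L[ℂ] ℂ)) ω
    (fun x => (⟨x, θ x⟩ :
      TotalSpace (E →L[ℂ] ℂ) (fun x : M => TangentSpace I x →L[ℂ] Trivial M ℂ x))) W

/-- A torsion-free holomorphic affine connection on an open subset of `M`, where `cov Y x v` is
`∇_v Y` at `x`. Holomorphic means that `∇Y` is holomorphic on `V` for every holomorphic vector field
`Y` on an open subset `V`; since there may be few holomorphic vector fields on the whole domain, all
smaller `V` have to be considered. -/
structure LocalAffineConnection where
  domain : Opens M
  cov : (Π x : M, TangentSpace I x) → (Π x : M, TangentSpace I x →L[ℂ] TangentSpace I x)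
  isCovariantDerivative : IsCovariantDerivativeOn E cov (domain : Set M)
  holomorphic : ∀ V : Opens M, V ≤ domain →
    ContMDiffCovariantDerivativeOn E ω cov (V : Set M)
  torsionFree : ∀ x ∈ domain, ∀ X Y : Π x : M, TangentSpace I x,
    MDiffAt (T% X) x → MDiffAt (T% Y) x →
      cov Y x (X x) - cov X x (Y x) = VectorField.mlieBracket I X Y x

variable {I M} in
/-- Two torsion-free connections are projectively equivalent on the intersection of their domains if
`∇¹_X Y = ∇²_X Y + θ(X) Y + θ(Y) X` there for a holomorphic one-form `θ`. -/
def LocalAffineConnection.ProjEquiv (r s : LocalAffineConnection I M) : Prop :=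
  ∃ θ : Π x : M, TangentSpace I x →L[ℂ] ℂ,
    IsHolomorphicOneFormOn I θ (r.domain ⊓ s.domain : Opens M) ∧
    ∀ x ∈ r.domain ⊓ s.domain, ∀ Y : Π x : M, TangentSpace I x, MDiffAt (T% Y) x →
      ∀ v : TangentSpace I x,
        r.cov Y x v = s.cov Y x v + (θ x v • Y x + θ x (Y x) • v)

/-- A holomorphic projective connection on `M`: a collection of torsion-free holomorphic affine
connections, on open subsets that cover `M`, which are projectively equivalent on the overlaps. -/
structure HolProjConnection where
  reps : Set (LocalAffineConnection I M)
  cover : ∀ x : M, ∃ r ∈ reps, x ∈ r.domain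
  compatible : ∀ r ∈ reps, ∀ s ∈ reps, r.ProjEquiv s

variable {I M}

/-- Two holomorphic projective connections are projectively equivalent if their union is again a
holomorphic projective connection. -/
def HolProjConnection.Equivalent (φ ψ : HolProjConnection I M) : Prop :=
  ∃ χ : HolProjConnection I M, χ.reps = φ.reps ∪ ψ.reps

/-- An affine connection is flat if a holomorphic coordinate function on its domain takes it to the
standard connection of the model vector space. -/
def LocalAffineConnection.IsFlat (r : LocalAffineConnection I M) : Prop :=
  ∃ e ∈ IsManifold.maximalAtlas I ω M, e.source = (r.domain : Set M) ∧
    ∀ x ∈ r.domain, ∀ Y : Π x : M, TangentSpace I x, MDiffAt (T% Y) x →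
      ∀ v : TangentSpace I x,
        (mfderiv I 𝓘(ℂ, E) (e.extend I) x (r.cov Y x v) : E) =
          mfderiv I 𝓘(ℂ, E) (fun y => (mfderiv I 𝓘(ℂ, E) (e.extend I) y (Y y) : E)) x v

/-- A holomorphic projective connection is flat if it is projectively equivalent to one whose local
representatives are all flat. -/
def HolProjConnection.IsFlat (φ : HolProjConnection I M) : Prop :=
  ∃ ψ : HolProjConnection I M, φ.Equivalent ψ ∧ ∀ r ∈ ψ.reps, r.IsFlat

/-- The fibres of a holomorphic submersion `f` are totally geodesic: for every local representative `∇`,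
every vector field `Y` that is tangent to the fibre through `x` at the points of this fibre, and every
tangent vector `v` of the fibre at `x`, the vector `∇_v Y` is tangent to the fibre. The tangent spaces
of the fibres are the kernels of `df`. -/
def HolProjConnection.FibersTotallyGeodesic (φ : HolProjConnection I M)
    {E' : Type*} [NormedAddCommGroup E'] [NormedSpace ℂ E'] {H' : Type*} [TopologicalSpace H']
    (J : ModelWithCorners ℂ E' H') {N : Type*} [TopologicalSpace N] [ChartedSpace H' N]
    (f : M → N) : Prop :=
  ∀ r ∈ φ.reps, ∀ x ∈ r.domain, ∀ Y : Π x : M, TangentSpace I x, MDiffAt (T% Y) x →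
    (∀ᶠ y in 𝓝 x, f y = f x → mfderiv I J f y (Y y) = 0) →
    ∀ v : TangentSpace I x, mfderiv I J f x v = 0 → mfderiv I J f x (r.cov Y x v) = 0

theorem oneForm_unique {x : M} {θ θ' : TangentSpace I x →L[ℂ] ℂ}
    (h : ∀ Y : Π x : M, TangentSpace I x, MDiffAt (T% Y) x → ∀ v : TangentSpace I x,
      θ v • Y x + θ (Y x) • v = θ' v • Y x + θ' (Y x) • v) : θ = θ' := by
  ext v
  have h1 := h (FiberBundle.extend E v) (FiberBundle.mdifferentiableAt_extend ..) v
  rw [FiberBundle.extend_apply_self, ← add_smul, ← add_smul] at h1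
  by_cases hv : v = 0
  · subst hv; simp
  · have := smul_left_injective ℂ hv h1
    linear_combination this / 2

theorem LocalAffineConnection.ProjEquiv.symm {r s : LocalAffineConnection I M}
    (h : r.ProjEquiv s) : s.ProjEquiv r := by
  obtain ⟨θ, hθ, h⟩ := h
  refine ⟨-θ, ?_, fun x hx Y hY v => ?_⟩
  · rw [inf_comm]
    exact hθ.neg_section
  · rw [h x (by rwa [inf_comm]) Y hY v]
    simp only [Pi.neg_apply, neg_apply, neg_smul]
    abel

theorem HolProjConnection.equivalent_iff {φ ψ : HolProjConnection I M} :
    φ.Equivalent ψ ↔ ∀ r ∈ φ.reps, ∀ s ∈ ψ.reps, r.ProjEquiv s := by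
  constructor
  · rintro ⟨χ, hχ⟩ r hr s hs
    exact χ.compatible r (hχ ▸ Or.inl hr) s (hχ ▸ Or.inr hs)
  · intro h
    refine ⟨⟨φ.reps ∪ ψ.reps, fun x => ?_, ?_⟩, rfl⟩
    · obtain ⟨r, hr, hx⟩ := φ.cover x
      exact ⟨r, Or.inl hr, hx⟩
    · rintro r (hr | hr) s (hs | hs)
      exacts [φ.compatible r hr s hs, h r hr s hs, (h s hs r hr).symm, ψ.compatible r hr s hs]

/-- Projective equivalence of holomorphic projective connections. -/
instance projSetoid : Setoid (HolProjConnection I M) where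
  r := HolProjConnection.Equivalent
  iseqv := by
    refine ⟨fun φ => ⟨φ, by simp⟩, fun ⟨χ, h⟩ => ⟨χ, by rw [h, Set.union_comm]⟩, ?_⟩
    intro φ ψ χ h1 h2
    rw [HolProjConnection.equivalent_iff] at *
    intro r hr t ht
    choose s hs hxs using ψ.cover
    choose θ₁ hol₁ eq₁ using fun x => h1 r hr (s x) (hs x)
    choose θ₂ hol₂ eq₂ using fun x => h2 (s x) (hs x) t ht
    have hx1 : ∀ {x y}, x ∈ r.domain ⊓ t.domain → x ∈ (s y).domain →
        x ∈ r.domain ⊓ (s y).domain := fun h h' => ⟨h.1, h'⟩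
    have hx2 : ∀ {x y}, x ∈ r.domain ⊓ t.domain → x ∈ (s y).domain →
        x ∈ (s y).domain ⊓ t.domain := fun h h' => ⟨h', h.2⟩
    have key : ∀ y x, x ∈ r.domain ⊓ t.domain → x ∈ (s y).domain →
        ∀ Y : Π x : M, TangentSpace I x, MDiffAt (T% Y) x → ∀ v : TangentSpace I x,
        r.cov Y x v = t.cov Y x v +
          ((θ₁ y x + θ₂ y x) v • Y x + (θ₁ y x + θ₂ y x) (Y x) • v) := by
      intro y x hx hy Y hY v
      rw [eq₁ y x (hx1 hx hy) Y hY v, eq₂ y x (hx2 hx hy) Y hY v]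
      simp only [add_apply, add_smul]
      abel
    refine ⟨fun x => θ₁ x x + θ₂ x x, ?_, fun x hx Y hY v => key x x hx (hxs x) Y hY v⟩
    intro x hx
    have hev : ∀ᶠ y in 𝓝 x, θ₁ y y + θ₂ y y = θ₁ x y + θ₂ x y := by
      filter_upwards [(r.domain ⊓ t.domain).isOpen.mem_nhds hx,
        (s x).domain.isOpen.mem_nhds (hxs x)] with y hy hy'
      refine oneForm_unique fun Y hY v => ?_
      have := key y y hy (hxs y) Y hY v
      rw [key x y hy hy' Y hY v] at this
      exact (add_left_cancel this).symm
    have a1 := (hol₁ x).contMDiffAt ((r.domain ⊓ (s x).domain).isOpen.mem_nhds (hx1 hx (hxs x)))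
    have a2 := (hol₂ x).contMDiffAt (((s x).domain ⊓ t.domain).isOpen.mem_nhds (hx2 hx (hxs x)))
    have a3 := a1.add_section a2
    refine (a3.congr_of_eventuallyEq ?_).contMDiffWithinAt
    filter_upwards [hev] with y hy
    rw [hy]
    rfl

variable (I M) in
/-- The set of projective equivalence classes of holomorphic projective connections on `M`. -/
def ProjClass : Type _ := Quotient (projSetoid (I := I) (M := M))

/-- The projective equivalence class of a holomorphic projective connection. -/
def HolProjConnection.toClass (φ : HolProjConnection I M) : ProjClass I M := Quotient.mk _ φ

end Projective

/-! ### Translation of projective connections by sections of `K_Σ^{3/2}` -/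

namespace KugaShimuraDatum
variable (D : KugaShimuraDatum)

variable {D} in
/-- The quadratic tensor `dτ ⊗ dτ ⊗ (A(τ) ∂/∂z₁ + B(τ) ∂/∂z₂)` on `ℍ × ℂ²`. -/
noncomputable def tensor (A B : D.H0 3) (x : Cover) (v w : TangentSpace model x) : TangentSpace model x :=
  let v' : ℂ × ℂ × ℂ := v
  let w' : ℂ × ℂ × ℂ := w
  ((0, v'.1 * w'.1 * sectionLift A.1 x.1, v'.1 * w'.1 * sectionLift B.1 x.1) : ℂ × ℂ × ℂ)

variable {D} in
/-- The projective connection `ψ` is obtained from `φ` by adding the tensor on `M` that is induced by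
`dτ ⊗ dτ ⊗ (A ∂/∂z₁ + B ∂/∂z₂)`, where `c = (A, B)`: local representatives satisfy
`∇'_X Y = ∇_X Y + Θ(X, Y) + θ(X) Y + θ(Y) X` for a holomorphic one-form `θ`. The values `X = dϖ(v)` and
`Y = dϖ(w)` at a point are written by means of tangent vectors `v`, `w` of `ℍ × ℂ²`. -/
def IsTranslate (c : D.SectionPairs) (φ ψ : HolProjConnection model D.Threefold) : Prop :=
  ∀ r ∈ φ.reps, ∀ s ∈ ψ.reps, ∃ θ : Π p : D.Threefold, TangentSpace model p →L[ℂ] ℂ,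
    IsHolomorphicOneFormOn model θ
      (r.domain ⊓ s.domain : TopologicalSpace.Opens D.Threefold) ∧
    ∀ x : Cover, D.proj x ∈ r.domain ⊓ s.domain →
      ∀ Y : Π p : D.Threefold, TangentSpace model p,
      MDifferentiableAt model model.tangent
        (fun p => (⟨p, Y p⟩ : TangentBundle model D.Threefold)) (D.proj x) →
      ∀ v w : TangentSpace model x, mfderiv model model D.proj x w = Y (D.proj x) →
        s.cov Y (D.proj x) (mfderiv model model D.proj x v) =
          r.cov Y (D.proj x) (mfderiv model model D.proj x v) +
          mfderiv model model D.proj x (tensor c.1 c.2 x v w) +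
          (θ (D.proj x) (mfderiv model model D.proj x v) • Y (D.proj x) +
            θ (D.proj x) (Y (D.proj x)) • mfderiv model model D.proj x v)

end KugaShimuraDatum

set_option linter.unusedSectionVars false

/-! ### Vector fields and connections in a coordinate chart -/


section Coordinates
open Bundle TopologicalSpace

variable {E : Type*} [NormedAddCommGroup E] [NormedSpace ℂ E]
  {H : Type*} [TopologicalSpace H] {I : ModelWithCorners ℂ E H}
  {M : Type*} [TopologicalSpace M] [ChartedSpace H M] [IsManifold I ω M]
  {F : Type*} [NormedAddCommGroup F] [NormedSpace ℂ F]

/-! In the coordinates `(τ, z₁, z₂)` every element of the group acts by a fractional linear map of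
`ℂ³`. Such a map `F` satisfies `F''(v, w) = F'(η(v) w + η(w) v)` for a linear form `η`
(`fderiv_fderiv_projMap`), so it changes the standard connection only by a pure tensor
(`flatConnection_diff`). Hence the standard connections of the sheets of the covering form a
projective connection on `M`, `standardConnection`.

Any other projective connection differs from it by a symmetric tensor that is defined up to pure
tensors. Removing traces kills exactly this ambiguity and gives a holomorphic invariant tensor on `ℍ
× ℂ²`, `coverTensor`. A lattice element translates a fibre and acts on tangent vectors by a
unipotent shear, so each component of the tensor is periodic up to terms in components already
treated. Liouville's theorem makes the components constant one after another
(`eq_zero_of_quasiPeriodic`), and the vanishing trace removes the last unwanted one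
(`tensor_eq_of_invariant`). What remains is `dτ ⊗ dτ ⊗ u(τ)` with `u` vertical, and invariance under
`Γ` says that `u` has weight three. Conversely, every pair of sections gives an invariant symmetric
tensor that can be added to all local representatives, and such a tensor is pure only if it
vanishes. This is the affine structure in (i).

For flatness, let `a` be a local second primitive of `(A, B)`. The shear `(τ, z) ↦ (τ, z + a(τ))`
has second derivative `dτ² ⊗ a''`, so the chart obtained by composing with it has a flat connection
that is the standard one plus the tensor of `(A, B)`. The fibres `τ = const` are totally geodesic
because they are so for the standard connection, the added tensor vanishes on vertical vectors, and
a pure tensor maps two vertical vectors to a vertical one. -/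

theorem ContMDiffAt.mfderiv_vectorField {f : M → F} {W : Π x : M, TangentSpace I x} {x : M}
    (hf : ContMDiffAt I 𝓘(ℂ, F) ω f x) (hW : ContMDiffAt I I.tangent ω (T% W) x) :
    ContMDiffAt I 𝓘(ℂ, F) ω (fun y => (mfderiv I 𝓘(ℂ, F) f y (W y) : F)) x := by
  have h1 : ContMDiffAt I 𝓘(ℂ, E →L[ℂ] F) ω
      (inTangentCoordinates I 𝓘(ℂ, F) id f (mfderiv I 𝓘(ℂ, F) f) x) x :=
    hf.mfderiv_const (m := ω) le_rfl
  have h2 := h1.clm_apply_of_inCoordinates hW hf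
  exact (contMDiff_snd_tangentBundle_modelSpace F 𝓘(ℂ, F)).contMDiffAt.comp x h2

theorem MDifferentiableAt.mfderiv_vectorField {f : M → F} {W : Π x : M, TangentSpace I x} {x : M}
    (hf : ContMDiffAt I 𝓘(ℂ, F) ω f x) (hW : MDifferentiableAt I I.tangent (T% W) x) :
    MDifferentiableAt I 𝓘(ℂ, F) (fun y => (mfderiv I 𝓘(ℂ, F) f y (W y) : F)) x := by
  have h1 : ContMDiffAt I 𝓘(ℂ, E →L[ℂ] F) ω
      (inTangentCoordinates I 𝓘(ℂ, F) id f (mfderiv I 𝓘(ℂ, F) f) x) x :=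
    hf.mfderiv_const (m := ω) le_rfl
  have h2 := (h1.mdifferentiableAt (by simp)).clm_apply_of_inCoordinates hW
    (hf.mdifferentiableAt (by simp))
  exact ((contMDiff_snd_tangentBundle_modelSpace F 𝓘(ℂ, F)).contMDiffAt
    (n := ω)).mdifferentiableAt (by simp) |>.comp x h2

variable (I) in
/-- The differential at `y` of the coordinate function of `e`. -/
noncomputable def coordDeriv (e : OpenPartialHomeomorph M H) (y : M) : TangentSpace I y →L[ℂ] E :=
  mfderiv I 𝓘(ℂ, E) (e.extend I) y

variable (I) in
/-- The inverse of the differential at `y` of the coordinate function of `e`. -/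
noncomputable def coordInv (e : OpenPartialHomeomorph M H) (y : M) : E →L[ℂ] TangentSpace I y :=
  (coordDeriv I e y).inverse

variable {e : OpenPartialHomeomorph M H} {x : M}

/-- The coordinate function is the chart, a local isomorphism, followed by the model map, whose
manifold derivative is the identity. -/
theorem isInvertible_coordDeriv (he : e ∈ IsManifold.maximalAtlas I ω M) (hx : x ∈ e.source) :
    (coordDeriv I e x).IsInvertible := by
  have hd : e.MDifferentiable I I :=
    ⟨(contMDiffOn_of_mem_maximalAtlas he).mdifferentiableOn (by simp),
      (contMDiffOn_symm_of_mem_maximalAtlas he).mdifferentiableOn (by simp)⟩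
  refine ⟨hd.mfderiv hx, ?_⟩
  have h := (I.hasMFDerivAt (x := e x)).comp x (hd.mdifferentiableAt hx).hasMFDerivAt
  exact h.mfderiv.symm

/-- `ContinuousLinearMap.inverse` is zero for a map that is not invertible, so `coordInv` has a
meaning only on the source of the chart. -/
theorem coordDeriv_coordInv (he : e ∈ IsManifold.maximalAtlas I ω M) (hx : x ∈ e.source) (v : E) :
    coordDeriv I e x (coordInv I e x v) = v := by
  obtain ⟨L, hL⟩ := isInvertible_coordDeriv he hx
  rw [coordInv, ← hL, ContinuousLinearMap.inverse_equiv]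
  simp

theorem coordInv_coordDeriv (he : e ∈ IsManifold.maximalAtlas I ω M) (hx : x ∈ e.source)
    (v : TangentSpace I x) : coordInv I e x (coordDeriv I e x v) = v := by
  obtain ⟨L, hL⟩ := isInvertible_coordDeriv he hx
  rw [coordInv, ← hL, ContinuousLinearMap.inverse_equiv]
  simp

theorem contMDiffAt_coordDeriv (he : e ∈ IsManifold.maximalAtlas I ω M) (hx : x ∈ e.source)
    {W : Π x : M, TangentSpace I x} (hW : ContMDiffAt I I.tangent ω (T% W) x) :
    ContMDiffAt I 𝓘(ℂ, E) ω (fun y => coordDeriv I e y (W y)) x :=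
  (e.contMDiffAt_extend he hx).mfderiv_vectorField hW

theorem mdifferentiableAt_coordDeriv (he : e ∈ IsManifold.maximalAtlas I ω M) (hx : x ∈ e.source)
    {W : Π x : M, TangentSpace I x} (hW : MDifferentiableAt I I.tangent (T% W) x) :
    MDifferentiableAt I 𝓘(ℂ, E) (fun y => coordDeriv I e y (W y)) x :=
  MDifferentiableAt.mfderiv_vectorField (e.contMDiffAt_extend he hx) hW

/-- The field is the pull-back of a constant vector field of `E` under the chart. -/
theorem contMDiffAt_coordInv_const [CompleteSpace E]
    (he : e ∈ IsManifold.maximalAtlas I ω M) (hx : x ∈ e.source) (v : E) :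
    ContMDiffAt I I.tangent ω (T% (fun y => coordInv I e y v)) x := by
  let V : Π y : E, TangentSpace 𝓘(ℂ, E) y := fun _ => v
  have hV : ContMDiffAt 𝓘(ℂ, E) 𝓘(ℂ, E).tangent ω (T% V) (e.extend I x) := by
    rw [contMDiffAt_vectorSpace_iff_contDiffAt]
    exact (contDiffAt_const : ContDiffAt ℂ ω (fun _ : E => v) _)
  have hi := isInvertible_coordDeriv he hx
  exact ContMDiffAt.mpullback_vectorField_preimage (I := I) (I' := 𝓘(ℂ, E)) (f := e.extend I)
    (V := V) (m := ω) (n := ω) hV (e.contMDiffAt_extend he hx) hi le_rfl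

theorem contMDiffAt_coordInv [FiniteDimensional ℂ E] {h : M → E}
    (he : e ∈ IsManifold.maximalAtlas I ω M) (hx : x ∈ e.source)
    (hh : ContMDiffAt I 𝓘(ℂ, E) ω h x) :
    ContMDiffAt I I.tangent ω (T% (fun y => coordInv I e y (h y))) x := by
  have := FiniteDimensional.complete ℂ E
  let b := Module.finBasis ℂ E
  have h1 : ∀ y, coordInv I e y (h y) =
      ∑ i, LinearMap.toContinuousLinearMap (b.coord i) (h y) • coordInv I e y (b i) := by
    intro y
    conv_lhs => rw [← b.sum_repr (h y), map_sum]
    simp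
  simp_rw [h1]
  refine ContMDiffAt.sum_section fun i _ => ?_
  exact (((LinearMap.toContinuousLinearMap (b.coord i)).contMDiff.contMDiffAt).comp x hh).smul_section
    (contMDiffAt_coordInv_const he hx (b i))

/-- A family of linear maps on the tangent spaces is holomorphic if it takes holomorphic vector
fields to holomorphic sections. -/
theorem contMDiffAt_hom_of_apply [FiniteDimensional ℂ E]
    {V : M → Type*} [TopologicalSpace (TotalSpace F V)]
    [∀ x, AddCommGroup (V x)] [∀ x, Module ℂ (V x)] [∀ x : M, TopologicalSpace (V x)]
    [∀ x, IsTopologicalAddGroup (V x)] [∀ x, ContinuousSMul ℂ (V x)]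
    [FiberBundle F V] [VectorBundle ℂ F V]
    {L : Π x : M, TangentSpace I x →L[ℂ] V x}
    (h : ∀ W : Π x : M, TangentSpace I x, ContMDiffAt I I.tangent ω (T% W) x →
      ContMDiffAt I (I.prod 𝓘(ℂ, F)) ω (fun y => TotalSpace.mk' F y (L y (W y))) x) :
    ContMDiffAt I (I.prod 𝓘(ℂ, E →L[ℂ] F)) ω
      (fun y => TotalSpace.mk' (E →L[ℂ] F) (E := fun x => TangentSpace I x →L[ℂ] V x) y (L y)) x := by
  have := FiniteDimensional.complete ℂ E
  rw [contMDiffAt_hom_bundle]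
  refine ⟨contMDiffAt_id, ?_⟩
  let b := Module.finBasis ℂ E
  -- The columns of `L` in the preferred trivializations are its values on the pulled-back constant
  -- fields, because the trivialization of the tangent bundle at `x` is the differential of the
  -- chart at `x`.
  have key : ∀ v : E, ContMDiffAt I 𝓘(ℂ, F) ω (fun y =>
      ContinuousLinearMap.inCoordinates E (TangentSpace I) F V x y x y (L y) v) x := by
    intro v
    have h1 := h _ (contMDiffAt_coordInv_const (IsManifold.chart_mem_maximalAtlas x)
      (mem_chart_source H x) v)
    rw [contMDiffAt_section] at h1
    refine h1.congr_of_eventuallyEq ?_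
    filter_upwards [(chartAt H x).open_source.mem_nhds (mem_chart_source H x),
      (trivializationAt F V x).open_baseSet.mem_nhds (mem_baseSet_trivializationAt F V x)]
      with y hy hy'
    have hl : ∀ w : TangentSpace I y,
        (trivializationAt E (TangentSpace I) x).continuousLinearMapAt ℂ y w =
          coordDeriv I (chartAt H x) y w := fun w => by
      rw [TangentBundle.continuousLinearMapAt_trivializationAt hy]; rfl
    have hv : (trivializationAt E (TangentSpace I) x).symmL ℂ y v =
        coordInv I (chartAt H x) y v := by
      have h2 := hl ((trivializationAt E (TangentSpace I) x).symmL ℂ y v)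
      rw [Trivialization.continuousLinearMapAt_symmL _ (by simpa using hy)] at h2
      conv_rhs => rw [h2]
      rw [coordInv_coordDeriv (IsManifold.chart_mem_maximalAtlas x) hy]
    rw [ContinuousLinearMap.inCoordinates, ContinuousLinearMap.comp_apply,
      ContinuousLinearMap.comp_apply, hv, Trivialization.continuousLinearMapAt_apply,
      Trivialization.coe_linearMapAt_of_mem _ hy']
  -- Reassemble the map from its finitely many columns.
  have hs : ∀ y, ContinuousLinearMap.inCoordinates E (TangentSpace I) F V x y x y (L y) =
      ∑ i, ContinuousLinearMap.smulRightL ℂ E F (LinearMap.toContinuousLinearMap (b.coord i))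
        (ContinuousLinearMap.inCoordinates E (TangentSpace I) F V x y x y (L y) (b i)) := by
    intro y
    ext v
    conv_lhs => rw [← b.sum_repr v, map_sum]
    simp
  refine ContMDiffAt.congr_of_eventuallyEq ?_ (Filter.Eventually.of_forall hs)
  refine contMDiffAt_finsetSum fun i _ => ?_
  exact (ContinuousLinearMap.contMDiff _).contMDiffAt.comp x (key (b i))

/-- A family of linear forms on the tangent spaces is a holomorphic one-form if its values on
holomorphic vector fields are holomorphic. -/
theorem isHolomorphicOneFormOn_of_apply [FiniteDimensional ℂ E]
    {θ : Π x : M, TangentSpace I x →L[ℂ] ℂ} {U : Set M}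
    (h : ∀ x ∈ U, ∀ W : Π x : M, TangentSpace I x, ContMDiffAt I I.tangent ω (T% W) x →
      ContMDiffAt I 𝓘(ℂ) ω (fun y => θ y (W y)) x) :
    IsHolomorphicOneFormOn I θ U := by
  intro x hx
  refine ContMDiffAt.contMDiffWithinAt ?_
  refine contMDiffAt_hom_of_apply (V := Trivial M ℂ) fun W hW => ?_
  rw [contMDiffAt_section]
  exact h x hx W hW

end Coordinates

/-! ### Flat connections of charts, and differences of connections -/

section Connections
open Bundle TopologicalSpace

variable {E : Type*} [NormedAddCommGroup E] [NormedSpace ℂ E] [FiniteDimensional ℂ E]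
  {H : Type*} [TopologicalSpace H] {I : ModelWithCorners ℂ E H}
  {M : Type*} [TopologicalSpace M] [ChartedSpace H M] [IsManifold I ω M]

/-- The Lie bracket of two vector fields in a chart. -/
theorem coordDeriv_mlieBracket [I.Boundaryless] {e : OpenPartialHomeomorph M H} {x : M}
    (he : e ∈ IsManifold.maximalAtlas I ω M) (hx : x ∈ e.source) {X Y : Π x : M, TangentSpace I x}
    (hX : MDifferentiableAt I I.tangent (T% X) x) (hY : MDifferentiableAt I I.tangent (T% Y) x) :
    coordDeriv I e x (VectorField.mlieBracket I X Y x) =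
      mvfderiv I (fun y => coordDeriv I e y (Y y)) x (X x) -
        mvfderiv I (fun y => coordDeriv I e y (X y)) x (Y x) := by
  have := FiniteDimensional.complete ℂ E
  let φ := e.extend I
  have hφ : ContMDiffAt I 𝓘(ℂ, E) ω φ x := e.contMDiffAt_extend he hx
  have hsx : φ.symm (φ x) = x := e.extend_left_inv hx
  have hφs : ContMDiffAt 𝓘(ℂ, E) I ω φ.symm (φ x) := by
    refine (contMDiffOn_extend_symm he).contMDiffAt ?_
    rw [← e.extend_target']
    exact (e.isOpen_extend_target).mem_nhds ((e.extend I).map_source (by simpa using hx))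
  -- The field on `E` that corresponds to `Z`. Its pull-back is `Z` again near `x`, so naturality of
  -- the Lie bracket moves the computation to `E`.
  let V : (Π x : M, TangentSpace I x) → Π u : E, TangentSpace 𝓘(ℂ, E) u :=
    fun Z u => coordDeriv I e (φ.symm u) (Z (φ.symm u))
  have hd : ∀ {Z : Π x : M, TangentSpace I x}, MDifferentiableAt I I.tangent (T% Z) x →
      MDifferentiableAt 𝓘(ℂ, E) 𝓘(ℂ, E)
        (fun u : E => coordDeriv I e (φ.symm u) (Z (φ.symm u))) (φ x) := by
    intro Z hZ
    refine MDifferentiableAt.comp (φ x) (g := fun y => coordDeriv I e y (Z y)) (f := φ.symm) ?_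
      (hφs.mdifferentiableAt (by simp))
    rw [hsx]
    exact mdifferentiableAt_coordDeriv he hx hZ
  have hpull : ∀ Z : Π x : M, TangentSpace I x,
      ∀ᶠ y in 𝓝 x, VectorField.mpullback I 𝓘(ℂ, E) φ (V Z) y = Z y := by
    intro Z
    filter_upwards [e.open_source.mem_nhds hx] with y hy
    have h1 : φ.symm (φ y) = y := e.extend_left_inv hy
    change coordInv I e y (coordDeriv I e (φ.symm (φ y)) (Z (φ.symm (φ y)))) = Z y
    rw [h1, coordInv_coordDeriv he hy]
  have hVd : ∀ {Z : Π x : M, TangentSpace I x}, MDifferentiableAt I I.tangent (T% Z) x →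
      MDifferentiableAt 𝓘(ℂ, E) 𝓘(ℂ, E).tangent (T% (V Z)) (φ x) := by
    intro Z hZ
    rw [mdifferentiableAt_section]
    refine (hd hZ).congr_of_eventuallyEq (Filter.Eventually.of_forall fun u => ?_)
    simp [V]
  have h1 := VectorField.mpullback_mlieBracket (n := ω) (hVd hX) (hVd hY) hφ (by simp)
  rw [Filter.EventuallyEq.mlieBracket_vectorField_eq (hpull X) (hpull Y)] at h1
  rw [← h1]
  refine (coordDeriv_coordInv he hx _).trans ?_
  -- The chain rule identifies derivatives of the field on `E` with derivatives of its coordinates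
  -- on `M`.
  have h2 : ∀ {Z : Π x : M, TangentSpace I x} (W : Π x : M, TangentSpace I x),
      MDifferentiableAt I I.tangent (T% Z) x →
      fderiv ℂ (fun u : E => coordDeriv I e (φ.symm u) (Z (φ.symm u))) (φ x) (V W (φ x)) =
      mvfderiv I (fun y => coordDeriv I e y (Z y)) x (W x) := by
    intro Z W hZ
    have h3 : mfderiv I 𝓘(ℂ, E) (fun y => coordDeriv I e y (Z y)) x =
        (mfderiv 𝓘(ℂ, E) 𝓘(ℂ, E) (fun u : E => coordDeriv I e (φ.symm u) (Z (φ.symm u))) (φ x)).comp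
          (mfderiv I 𝓘(ℂ, E) φ x) := by
      rw [← mfderiv_comp x (hd hZ) (hφ.mdifferentiableAt (by simp))]
      refine Filter.EventuallyEq.mfderiv_eq ?_
      filter_upwards [e.open_source.mem_nhds hx] with y hy
      have h1 : φ.symm (φ y) = y := e.extend_left_inv hy
      rw [Function.comp_apply, h1]
    rw [mvfderiv, h3, mfderiv_eq_fderiv]
    change _ = fderiv ℂ _ (φ x) (coordDeriv I e x (W x))
    congr 1
    rw [hsx]
  rw [← h2 X hY, ← h2 Y hX]
  have h4 := congrFun (VectorField.mlieBracketWithin_eq_lieBracketWithin (V := V X) (W := V Y)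
    (s := Set.univ)) (φ x)
  rw [VectorField.mlieBracketWithin_univ, VectorField.lieBracketWithin_univ] at h4
  exact h4

/-- The connection on the domain of a chart that the chart takes to the standard connection. -/
noncomputable def flatConnection [I.Boundaryless] (e : OpenPartialHomeomorph M H)
    (he : e ∈ IsManifold.maximalAtlas I ω M) : LocalAffineConnection I M where
  domain := ⟨e.source, e.open_source⟩
  cov Y x := (coordInv I e x).comp (mvfderiv I (fun y => coordDeriv I e y (Y y)) x)
  isCovariantDerivative := by
    constructor
    · intro σ σ' x hσ hσ' hx
      have h := mvfderiv_add (mdifferentiableAt_coordDeriv he hx hσ)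
        (mdifferentiableAt_coordDeriv he hx hσ')
      have h3 : (fun y => coordDeriv I e y ((σ + σ') y)) =
        (fun y => coordDeriv I e y (σ y)) + fun y => coordDeriv I e y (σ' y) := by
        ext y; simp
      rw [h3, h]
      ext v
      exact map_add (coordInv I e x) _ _
    · intro σ g x hσ hg hx
      have h := mvfderiv_smul hg (mdifferentiableAt_coordDeriv he hx hσ)
      have h3 : (fun y => coordDeriv I e y ((g • σ) y)) =
        g • fun y => coordDeriv I e y (σ y) := by
        ext y; simp
      rw [h3]
      ext v
      have h4 := congrArg (fun L => coordInv I e x (L v)) h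
      refine h4.trans ?_
      simp [coordInv_coordDeriv he hx]
  holomorphic := by
    intro V hV
    constructor
    intro σ hσ x hx
    refine ContMDiffAt.contMDiffWithinAt ?_
    have hxe : x ∈ e.source := hV hx
    refine contMDiffAt_hom_of_apply fun W hW => ?_
    have h1 : ContMDiffAt I I.tangent ω (T% σ) x := (hσ.contMDiffAt (V.isOpen.mem_nhds hx))
    exact contMDiffAt_coordInv he hxe
      ((contMDiffAt_coordDeriv he hxe h1).mfderiv_vectorField hW)
  torsionFree := by
    intro x hx X Y hX hY
    -- In the chart the bracket is the difference of the directional derivatives, which is the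
    -- antisymmetrization of the connection.
    rw [← coordInv_coordDeriv he hx (VectorField.mlieBracket I X Y x),
      coordDeriv_mlieBracket he hx hX hY]
    exact (map_sub (coordInv I e x) _ _).symm

theorem flatConnection_isFlat [I.Boundaryless] (e : OpenPartialHomeomorph M H)
    (he : e ∈ IsManifold.maximalAtlas I ω M) : (flatConnection e he).IsFlat :=
  ⟨e, he, rfl, fun _ hx _ _ _ => coordDeriv_coordInv he hx _⟩

/-- A field of bilinear maps on the tangent spaces is holomorphic at `x` if it takes holomorphic
vector fields to holomorphic vector fields. -/
def IsHolomorphicTensorAt (Θ : Π x : M, TangentSpace I x → TangentSpace I x → TangentSpace I x)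
    (x : M) : Prop :=
  ∀ V W : Π x : M, TangentSpace I x, ContMDiffAt I I.tangent ω (T% V) x →
    ContMDiffAt I I.tangent ω (T% W) x →
    ContMDiffAt I I.tangent ω (T% (fun y => Θ y (V y) (W y))) x

namespace LocalAffineConnection

/-- An analytic germ at `x` is analytic on a whole neighbourhood, and the condition `holomorphic`
applies there. -/
theorem contMDiffAt_cov (r : LocalAffineConnection I M) {x : M} (hx : x ∈ r.domain)
    {V W : Π x : M, TangentSpace I x} (hV : ContMDiffAt I I.tangent ω (T% V) x)
    (hW : ContMDiffAt I I.tangent ω (T% W) x) :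
    ContMDiffAt I I.tangent ω (T% (fun y => r.cov V y (W y))) x := by
  have hev := (contMDiffAt_iff_contMDiffAt_nhds (by simp)).1 hV
  obtain ⟨U, hU, hUo, hxU⟩ := eventually_nhds_iff.1 hev
  let U' : Opens M := ⟨U, hUo⟩ ⊓ r.domain
  have h1 : ContMDiffOn I I.tangent (ω + 1) (T% V) (U' : Set M) :=
    fun y hy => (hU y hy.1).contMDiffWithinAt
  have h2 := ((r.holomorphic U' inf_le_right).contMDiff h1).contMDiffAt
    (U'.isOpen.mem_nhds ⟨hxU, hx⟩)
  exact h2.clm_bundle_apply hW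

/-- The connection `∇ + Θ`. -/
noncomputable def addTensor (r : LocalAffineConnection I M)
    (Θ : Π x : M, TangentSpace I x →L[ℂ] TangentSpace I x →L[ℂ] TangentSpace I x)
    (hs : ∀ x ∈ r.domain, ∀ v w, Θ x v w = Θ x w v)
    (hh : ∀ x ∈ r.domain, IsHolomorphicTensorAt (fun y v w => Θ y v w) x) : LocalAffineConnection I M where
  domain := r.domain
  cov Y x := r.cov Y x + Θ x (Y x)
  isCovariantDerivative := r.isCovariantDerivative.add_one_form Θ
  holomorphic V hV := by
    constructor
    intro σ hσ x hx
    refine ContMDiffAt.contMDiffWithinAt ?_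
    have h1 : ContMDiffAt I I.tangent ω (T% σ) x := hσ.contMDiffAt (V.isOpen.mem_nhds hx)
    refine contMDiffAt_hom_of_apply fun W hW => ?_
    exact (r.contMDiffAt_cov (hV hx) h1 hW).add_section (hh x (hV hx) σ W h1 hW)
  torsionFree x hx X Y hX hY := by
    rw [← r.torsionFree x hx X Y hX hY]
    simp only [add_apply, hs x hx (Y x) (X x)]
    abel

/-- The difference of two connections, as a tensor: `∇_v Y - ∇'_v Y` is its value on `Y x` and `v`. -/
noncomputable def diff (r s : LocalAffineConnection I M) (x : M) :
    TangentSpace I x →L[ℂ] TangentSpace I x →L[ℂ] TangentSpace I x :=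
  (r.isCovariantDerivative.mono (s := (r.domain ⊓ s.domain : Opens M)) fun _ h => h.1).difference
    (s.isCovariantDerivative.mono fun _ h => h.2) x

theorem diff_apply {r s : LocalAffineConnection I M} {x : M} (hr : x ∈ r.domain) (hs : x ∈ s.domain)
    {Y : Π x : M, TangentSpace I x} (hY : MDifferentiableAt I I.tangent (T% Y) x) :
    r.diff s x (Y x) = r.cov Y x - s.cov Y x :=
  IsCovariantDerivativeOn.difference_apply _ _ (show x ∈ r.domain ⊓ s.domain from ⟨hr, hs⟩) hY

/-- Both connections antisymmetrize to the same Lie bracket, so their difference has no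
antisymmetric part. The tensor is evaluated on local extensions of `v` and `w`. -/
theorem diff_symm {r s : LocalAffineConnection I M} {x : M} (hr : x ∈ r.domain) (hs : x ∈ s.domain)
    (v w : TangentSpace I x) : r.diff s x v w = r.diff s x w v := by
  have hv := FiberBundle.mdifferentiableAt_extend I E v
  have hw := FiberBundle.mdifferentiableAt_extend I E w
  have h1 := diff_apply hr hs hv
  have h2 := diff_apply hr hs hw
  have h3 := r.torsionFree x hr _ _ hv hw
  have h4 := s.torsionFree x hs _ _ hv hw
  rw [FiberBundle.extend_apply_self] at h1 h2
  rw [← h4] at h3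
  simp only [FiberBundle.extend_apply_self] at h3
  rw [h1, h2, sub_apply, sub_apply]
  rw [sub_eq_sub_iff_add_eq_add] at h3 ⊢
  rw [add_comm _ (s.cov _ x v), ← h3, add_comm]

theorem isHolomorphicTensorAt_diff {r s : LocalAffineConnection I M} {x : M} (hr : x ∈ r.domain)
    (hs : x ∈ s.domain) : IsHolomorphicTensorAt (fun y v w => r.diff s y v w) x := by
  intro V W hV hW
  refine ((r.contMDiffAt_cov hr hV hW).sub_section (s.contMDiffAt_cov hs hV hW)).congr_of_eventuallyEq ?_
  filter_upwards [r.domain.isOpen.mem_nhds hr, s.domain.isOpen.mem_nhds hs,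
    (contMDiffAt_iff_contMDiffAt_nhds (by simp)).1 hV] with y hy hy' hVy
  rw [diff_apply hy hy' (hVy.mdifferentiableAt (by simp))]
  rfl

end LocalAffineConnection

end Connections

/-! ### Trace-free tensors and projective equivalence -/

section Pure
variable {V : Type*} [AddCommGroup V] [Module ℂ V] [TopologicalSpace V]

/-- The bilinear maps of the form `θ(v) w + θ(w) v`, by which projectively equivalent connections
differ. -/
def IsPureTensor (B : V → V → V) : Prop :=
  ∃ θ : V →L[ℂ] ℂ, ∀ v w, B v w = θ v • w + θ w • v

/-- With the cocycle rule for differences of connections, sums and negatives of pure tensors turn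
arguments about projective equivalence into linear algebra at a point. -/
theorem IsPureTensor.add {B C : V → V → V} (hB : IsPureTensor B) (hC : IsPureTensor C) :
    IsPureTensor (fun v w => B v w + C v w) := by
  obtain ⟨θ, hθ⟩ := hB
  obtain ⟨η, hη⟩ := hC
  exact ⟨θ + η, fun v w => by simp only [hθ, hη, add_apply, add_smul]; abel⟩

theorem IsPureTensor.neg {B : V → V → V} (hB : IsPureTensor B) :
    IsPureTensor (fun v w => -B v w) := by
  obtain ⟨θ, hθ⟩ := hB
  exact ⟨-θ, fun v w => by simp only [hθ, neg_apply, neg_smul]; abel⟩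

theorem IsPureTensor.congr {B C : V → V → V} (hB : IsPureTensor B) (h : ∀ v w, C v w = B v w) :
    IsPureTensor C := by
  obtain ⟨θ, hθ⟩ := hB
  exact ⟨θ, fun v w => by rw [h, hθ]⟩

/-- Pure tensors are pure in any linear coordinates. -/
theorem IsPureTensor.conj {W : Type*} [AddCommGroup W] [Module ℂ W] [TopologicalSpace W]
    {B : V → V → V} (hB : IsPureTensor B) {L : V →L[ℂ] W} {K : W →L[ℂ] V} (h : ∀ w, L (K w) = w) :
    IsPureTensor (fun v w => L (B (K v) (K w))) := by
  obtain ⟨θ, hθ⟩ := hB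
  exact ⟨θ.comp K, fun v w => by simp [hθ, h]⟩

end Pure

section TraceFree
variable {V W : Type*} [AddCommGroup V] [Module ℂ V] [AddCommGroup W] [Module ℂ W]

/-- The trace-free part of a symmetric bilinear map. -/
noncomputable def traceFree (B : V →ₗ[ℂ] V →ₗ[ℂ] V) (v w : V) : V :=
  B v w - ((Module.finrank ℂ V + 1 : ℂ)⁻¹ * LinearMap.trace ℂ V (B v)) • w -
    ((Module.finrank ℂ V + 1 : ℂ)⁻¹ * LinearMap.trace ℂ V (B w)) • v

theorem traceFree_sub (B C : V →ₗ[ℂ] V →ₗ[ℂ] V) (v w : V) :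
    traceFree (B - C) v w = traceFree B v w - traceFree C v w := by
  simp only [traceFree, LinearMap.sub_apply, map_sub]
  module

/-- The endomorphism `C (L v)` is the conjugate of `B v` by `L`, so it has the same trace. -/
theorem traceFree_equivariant (L : V ≃ₗ[ℂ] W) {B : V →ₗ[ℂ] V →ₗ[ℂ] V} {C : W →ₗ[ℂ] W →ₗ[ℂ] W}
    (h : ∀ v w, C (L v) (L w) = L (B v w)) (v w : V) :
    traceFree C (L v) (L w) = L (traceFree B v w) := by
  have h1 : ∀ v, LinearMap.trace ℂ W (C (L v)) = LinearMap.trace ℂ V (B v) := by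
    intro v
    rw [← LinearMap.trace_conj' (B v) L]
    congr 1
    ext w
    rw [LinearEquiv.conj_apply_apply, ← h, LinearEquiv.apply_symm_apply]
  simp only [traceFree, h, h1, map_sub, map_smul, L.finrank_eq]

variable [FiniteDimensional ℂ V]

/-- The endomorphism `B v` is `θ v` times the identity plus a rank-one map of trace `θ v`, so its
trace is `(dim V + 1) θ v`. This explains the factor in `traceFree`. -/
theorem traceFree_of_pure {B : V →ₗ[ℂ] V →ₗ[ℂ] V} {θ : V →ₗ[ℂ] ℂ}
    (h : ∀ v w, B v w = θ v • w + θ w • v) (v w : V) : traceFree B v w = 0 := by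
  have ht : ∀ v, LinearMap.trace ℂ V (B v) = (Module.finrank ℂ V + 1 : ℂ) * θ v := by
    intro v
    have h1 : B v = θ v • LinearMap.id + θ.smulRight v := by
      ext w; simp [h]
    rw [h1, map_add, map_smul, LinearMap.trace_id, LinearMap.trace_smulRight]
    simp
    ring
  have h0 : (Module.finrank ℂ V + 1 : ℂ) ≠ 0 := by
    exact_mod_cast Nat.succ_ne_zero (Module.finrank ℂ V)
  rw [traceFree, ht, ht, h, inv_mul_cancel_left₀ h0, inv_mul_cancel_left₀ h0]
  abel

/-- The trace of the trace-free part vanishes. -/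
theorem trace_traceFree {B : V →ₗ[ℂ] V →ₗ[ℂ] V} {T : V →ₗ[ℂ] V}
    {v : V} (hT : ∀ w, T w = traceFree B v w) : LinearMap.trace ℂ V T = 0 := by
  let n : ℂ := (Module.finrank ℂ V + 1 : ℂ)⁻¹
  have h0 : (Module.finrank ℂ V + 1 : ℂ) ≠ 0 := by
    exact_mod_cast Nat.succ_ne_zero (Module.finrank ℂ V)
  let t : V →ₗ[ℂ] ℂ := LinearMap.trace ℂ V ∘ₗ B
  -- The scalar term has trace `dim V · n · t v` and the rank-one term `n · t v`. Together they
  -- cancel `t v`, the trace of `B v`.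
  have h1 : T = B v - (n * t v) • LinearMap.id - (n • t).smulRight v := by
    ext w
    simp [hT, traceFree, n, t]
  rw [h1, map_sub, map_sub, map_smul, LinearMap.trace_id, LinearMap.trace_smulRight]
  simp only [n, t, LinearMap.comp_apply, LinearMap.smul_apply, smul_eq_mul]
  field_simp
  ring

end TraceFree

/-! ### Projective equivalence as a pointwise condition -/

section ProjEquivPointwise
open Bundle TopologicalSpace

variable {E : Type*} [NormedAddCommGroup E] [NormedSpace ℂ E] [FiniteDimensional ℂ E]
  {H : Type*} [TopologicalSpace H] {I : ModelWithCorners ℂ E H}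
  {M : Type*} [TopologicalSpace M] [ChartedSpace H M] [IsManifold I ω M]

/-- The one-form of a holomorphic tensor whose values are pure is holomorphic. -/
theorem isHolomorphicOneFormOn_of_pure {B : Π x : M, TangentSpace I x → TangentSpace I x → TangentSpace I x}
    {θ : Π x : M, TangentSpace I x →L[ℂ] ℂ} {U : Set M} (hU : IsOpen U)
    (hB : ∀ x ∈ U, IsHolomorphicTensorAt B x)
    (h : ∀ x ∈ U, ∀ v w, B x v w = θ x v • w + θ x w • v) : IsHolomorphicOneFormOn I θ U := by
  have := FiniteDimensional.complete ℂ E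
  refine isHolomorphicOneFormOn_of_apply fun x hx W hW => ?_
  let e := chartAt H x
  have he : e ∈ IsManifold.maximalAtlas I ω M := IsManifold.chart_mem_maximalAtlas x
  have hxe : x ∈ e.source := mem_chart_source H x
  let b := Module.finBasis ℂ E
  -- On a frame field `f` the tensor is `B(f, f) = 2 θ(f) f`, so `θ(f)` is half of one of its
  -- coordinates.
  have key : ∀ i, ContMDiffAt I 𝓘(ℂ) ω (fun y => θ y (coordInv I e y (b i))) x := by
    intro i
    have hf := contMDiffAt_coordInv_const he hxe (b i)
    have h1 := contMDiffAt_coordDeriv he hxe (hB x hx _ _ hf hf)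
    have h2 : ContMDiffAt I 𝓘(ℂ) ω (fun y => (1 / 2 : ℂ) * LinearMap.toContinuousLinearMap (b.coord i)
        (coordDeriv I e y (B y (coordInv I e y (b i)) (coordInv I e y (b i))))) x :=
      contMDiffAt_const.mul ((ContinuousLinearMap.contMDiff _).contMDiffAt.comp x h1)
    refine h2.congr_of_eventuallyEq ?_
    filter_upwards [hU.mem_nhds hx, e.open_source.mem_nhds hxe] with y hy hye
    rw [h y hy, ← add_smul, map_smul, coordDeriv_coordInv he hye]
    simp
    ring
  have hc := contMDiffAt_coordDeriv he hxe hW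
  have h3 : ContMDiffAt I 𝓘(ℂ) ω (fun y => ∑ i, LinearMap.toContinuousLinearMap (b.coord i)
      (coordDeriv I e y (W y)) * θ y (coordInv I e y (b i))) x :=
    contMDiffAt_finsetSum fun i _ =>
      ((ContinuousLinearMap.contMDiff _).contMDiffAt.comp x hc).mul (key i)
  refine h3.congr_of_eventuallyEq ?_
  filter_upwards [e.open_source.mem_nhds hxe] with y hye
  conv_lhs => rw [← coordInv_coordDeriv he hye (W y), ← b.sum_repr (coordDeriv I e y (W y))]
  simp only [map_sum, map_smul, smul_eq_mul]
  rfl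

namespace LocalAffineConnection

theorem diff_add {r s t : LocalAffineConnection I M} {x : M} (hr : x ∈ r.domain) (hs : x ∈ s.domain)
    (ht : x ∈ t.domain) (v w : TangentSpace I x) :
    r.diff t x v w = r.diff s x v w + s.diff t x v w := by
  have hv := FiberBundle.mdifferentiableAt_extend I E v
  have h1 := diff_apply hr hs hv
  have h2 := diff_apply hs ht hv
  have h3 := diff_apply hr ht hv
  rw [FiberBundle.extend_apply_self] at h1 h2 h3
  rw [h1, h2, h3]
  simp

theorem diff_swap {r s : LocalAffineConnection I M} {x : M} (hr : x ∈ r.domain) (hs : x ∈ s.domain)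
    (v w : TangentSpace I x) : s.diff r x v w = -r.diff s x v w := by
  have hv := FiberBundle.mdifferentiableAt_extend I E v
  have h1 := diff_apply hr hs hv
  have h2 := diff_apply hs hr hv
  rw [FiberBundle.extend_apply_self] at h1 h2
  rw [h1, h2]
  simp

/-- Two connections that differ by `Θ` up to pure tensors at every point differ by `Θ` up to a
holomorphic one-form. -/
theorem exists_oneForm_iff {r s : LocalAffineConnection I M}
    {Θ : Π x : M, TangentSpace I x → TangentSpace I x → TangentSpace I x}
    (hΘ : ∀ x, IsHolomorphicTensorAt Θ x) :
    (∃ θ : Π x : M, TangentSpace I x →L[ℂ] ℂ,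
      IsHolomorphicOneFormOn I θ (r.domain ⊓ s.domain : Opens M) ∧
      ∀ x ∈ r.domain ⊓ s.domain, ∀ Y : Π x : M, TangentSpace I x,
        MDifferentiableAt I I.tangent (T% Y) x → ∀ v : TangentSpace I x,
        r.cov Y x v = s.cov Y x v + Θ x (Y x) v + (θ x v • Y x + θ x (Y x) • v)) ↔
    ∀ x ∈ r.domain ⊓ s.domain, IsPureTensor (fun v w => r.diff s x v w - Θ x v w) := by
  constructor
  · rintro ⟨θ, -, h⟩ x hx
    refine ⟨θ x, fun v w => ?_⟩
    have hv := FiberBundle.mdifferentiableAt_extend I E v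
    have h1 := diff_apply hx.1 hx.2 hv
    have h2 := h x hx _ hv w
    rw [FiberBundle.extend_apply_self] at h1 h2
    simp only [h1, sub_apply, h2]
    abel
  · intro h
    have h' : ∀ x, ∃ θ : TangentSpace I x →L[ℂ] ℂ, x ∈ r.domain ⊓ s.domain →
        ∀ v w, r.diff s x v w - Θ x v w = θ v • w + θ w • v := by
      intro x
      by_cases hx : x ∈ r.domain ⊓ s.domain
      · obtain ⟨θ, hθ⟩ := h x hx
        exact ⟨θ, fun _ => hθ⟩
      -- The value of the form outside the common domain is arbitrary.
      · exact ⟨0, fun h => absurd h hx⟩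
    choose θ hθ using h'
    refine ⟨θ, isHolomorphicOneFormOn_of_pure (r.domain ⊓ s.domain).isOpen
      (B := fun x v w => r.diff s x v w - Θ x v w) (fun x hx V W hV hW => ?_)
      fun x hx => hθ x hx, fun x hx Y hY v => ?_⟩
    · exact (isHolomorphicTensorAt_diff hx.1 hx.2 V W hV hW).sub_section (hΘ x V W hV hW)
    · have h1 := hθ x hx (Y x) v
      rw [diff_apply hx.1 hx.2 hY, sub_apply, sub_eq_iff_eq_add, sub_eq_iff_eq_add] at h1
      rw [h1]
      abel

theorem isHolomorphicTensorAt_zero (x : M) :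
    IsHolomorphicTensorAt (fun (x : M) (_ _ : TangentSpace I x) => (0 : TangentSpace I x)) x :=
  fun _ _ _ _ => contMDiff_zeroSection ℂ (TangentSpace I : M → Type _) x

/-- This is the case of the zero tensor in `exists_oneForm_iff`: the one-forms found at single
points automatically fit together to a holomorphic one. -/
theorem projEquiv_iff {r s : LocalAffineConnection I M} :
    r.ProjEquiv s ↔ ∀ x ∈ r.domain ⊓ s.domain, IsPureTensor (fun v w => r.diff s x v w) := by
  have h := exists_oneForm_iff (r := r) (s := s) (isHolomorphicTensorAt_zero (I := I) (M := M))
  simp only [sub_zero, add_zero] at h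
  exact h

end LocalAffineConnection

end ProjEquivPointwise

/-! ### The covering of an orbit quotient -/

section OrbitCovering
variable {E H M G : Type*} [NormedAddCommGroup E] [NormedSpace ℂ E] [TopologicalSpace H]
  {I : ModelWithCorners ℂ E H} [TopologicalSpace M] [ChartedSpace H M]
  [Group G] [MulAction G M]
  [ProperlyDiscontinuousSMul G M] [ContinuousConstSMul G M] [IsCancelSMul G M]
  [T2Space M] [LocallyCompactSpace M]

variable (M G) in
theorem isLocalHomeomorph_orbitQuotient :
    IsLocalHomeomorph (Quotient.mk (MulAction.orbitRel G M)) :=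
  (isQuotientCoveringMap_quotientMk_of_properlyDiscontinuousSMul (G := G)
    (E := M)).isCoveringMap.isLocalHomeomorph

variable (G) in
/-- The local inverse at `b` of the projection to the orbit quotient. -/
noncomputable def orbitLift (b : M) : OpenPartialHomeomorph (MulAction.orbitRel.Quotient G M) M :=
  (isLocalHomeomorph_orbitQuotient M G).localInverseAt b

/-- By construction the chart of the quotient at `p` comes from the local inverse of the projection
at a chosen point above `p`. -/
theorem exists_chartAt_orbitQuotient (p : MulAction.orbitRel.Quotient G M) :
    ∃ b : M, chartAt H p = (orbitLift G b).trans (chartAt H b) ∧ p = Quotient.mk _ b := by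
  have h : Function.HasRightInverse (Quotient.mk (MulAction.orbitRel G M)) :=
    Function.Surjective.hasRightInverse Quotient.mk_surjective
  exact ⟨h.choose p, rfl, (h.choose_spec p).symm⟩

theorem orbitLift_mk_self (b : M) : orbitLift G b (Quotient.mk _ b) = b :=
  (isLocalHomeomorph_orbitQuotient M G).localInverseAt_apply_self

theorem mk_mem_orbitLift_source (b : M) : Quotient.mk _ b ∈ (orbitLift G b).source :=
  (isLocalHomeomorph_orbitQuotient M G).apply_self_mem_localInverseAt_source

theorem mk_orbitLift {b : M} {p : MulAction.orbitRel.Quotient G M} (hp : p ∈ (orbitLift G b).source) :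
    Quotient.mk _ (orbitLift G b p) = p :=
  (isLocalHomeomorph_orbitQuotient M G).apply_localInverseAt_of_mem hp

theorem orbitLift_symm (b : M) :
    (orbitLift G b).symm = Quotient.mk (MulAction.orbitRel G M) :=
  (isLocalHomeomorph_orbitQuotient M G).localInverseAt_symm b

theorem exists_smul_eq_orbitLift {b x : M} (hx : Quotient.mk _ x ∈ (orbitLift G b).source) :
    ∃ g : G, g • x = orbitLift G b (Quotient.mk _ x) := by
  obtain ⟨g, hg⟩ : orbitLift G b (Quotient.mk _ x) ∈ MulAction.orbit G x :=
    Quotient.exact (mk_orbitLift hx)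
  exact ⟨g, hg⟩

/-- For `z` near `x` the point `g • z` stays in the target of the local section and has the same
image as `z`. The group element that connects a point to its lift is thus locally constant. -/
theorem eventually_orbitLift_mk {b x : M} {g : G} (hx : Quotient.mk _ x ∈ (orbitLift G b).source)
    (hg : g • x = orbitLift G b (Quotient.mk _ x)) :
    ∀ᶠ z in 𝓝 x, orbitLift G b (Quotient.mk _ z) = g • z := by
  have hcont : ContinuousAt (fun z : M => g • z) x := (continuous_const_smul g).continuousAt
  have e1 : ∀ᶠ z in 𝓝 x, g • z ∈ (orbitLift G b).target := by
    apply hcont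
    change _ ∈ 𝓝 (g • x)
    rw [hg]
    exact (orbitLift G b).open_target.mem_nhds ((orbitLift G b).map_source hx)
  filter_upwards [e1] with z hz
  have h3 : (Quotient.mk (MulAction.orbitRel G M) (g • z)) = Quotient.mk _ z :=
    Quotient.sound ⟨g, rfl⟩
  rw [← h3]
  have := (orbitLift G b).right_inv hz
  rwa [orbitLift_symm] at this

theorem eventually_mk_of_eventually {x : M} {p : MulAction.orbitRel.Quotient G M → Prop}
    (h : ∀ᶠ z in 𝓝 x, p (Quotient.mk _ z)) : ∀ᶠ q in 𝓝 (Quotient.mk _ x), p q := by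
  rw [← (isLocalHomeomorph_orbitQuotient M G).map_nhds_eq x]
  exact h

variable [IsManifold I ω M] (hG : ∀ g : G, ContMDiff I I ω (fun x : M => g • x))
include hG

/-- In the chart of the quotient the projection is the action of one group element, read in a chart
of `M`. -/
theorem contMDiff_orbitQuotient_mk :
    ContMDiff I I ω (Quotient.mk (MulAction.orbitRel G M)) := by
  intro x
  rw [contMDiffAt_iff_target]
  refine ⟨(isLocalHomeomorph_orbitQuotient M G).continuous.continuousAt, ?_⟩
  obtain ⟨b, hb, hbx⟩ := exists_chartAt_orbitQuotient (H := H) (Quotient.mk (MulAction.orbitRel G M) x)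
  have hs : Quotient.mk _ x ∈ (orbitLift G b).source := hbx ▸ mk_mem_orbitLift_source b
  obtain ⟨g, hg⟩ := exists_smul_eq_orbitLift hs
  have hgb : g • x = b := by rw [hg, hbx, orbitLift_mk_self]
  have h1 : ContMDiffAt I 𝓘(ℂ, E) ω (fun z => extChartAt I b (g • z)) x := by
    have : ContMDiffAt I 𝓘(ℂ, E) ω (extChartAt I b) (g • x) := by
      rw [hgb]; exact contMDiffAt_extChartAt
    exact this.comp x (hG g).contMDiffAt
  refine h1.congr_of_eventuallyEq ?_
  filter_upwards [eventually_orbitLift_mk hs hg] with z hz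
  rw [Function.comp_apply, extChartAt, hb]
  simp [hz]

/-- Near `p` the lift is the lift defining the chart at `p`, followed by a group element. The former
is the chart of the quotient followed by an inverse chart of `M`. -/
theorem contMDiffAt_orbitLift {b : M} {p : MulAction.orbitRel.Quotient G M}
    (hp : p ∈ (orbitLift G b).source) : ContMDiffAt I I ω (orbitLift G b) p := by
  have : IsManifold I ω (MulAction.orbitRel.Quotient G M) := isManifold_orbitQuotient I hG
  obtain ⟨a, ha, hap⟩ := exists_chartAt_orbitQuotient (H := H) p
  subst hap
  obtain ⟨g, hg⟩ := exists_smul_eq_orbitLift hp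
  have hc : ContMDiffAt I I ω (chartAt H (Quotient.mk (MulAction.orbitRel G M) a)) (Quotient.mk _ a) :=
    contMDiffAt_of_mem_maximalAtlas (IsManifold.chart_mem_maximalAtlas _) (mem_chart_source H _)
  have hcs : ContMDiffAt I I ω (chartAt H a).symm (chartAt H (Quotient.mk (MulAction.orbitRel G M) a)
      (Quotient.mk _ a)) := by
    rw [ha, OpenPartialHomeomorph.coe_trans, Function.comp_apply, orbitLift_mk_self]
    exact contMDiffAt_symm_of_mem_maximalAtlas (IsManifold.chart_mem_maximalAtlas a)
      (mem_chart_target H a)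
  have h1 := (hG g).contMDiffAt.comp _ (hcs.comp _ hc)
  refine h1.congr_of_eventuallyEq (eventually_mk_of_eventually ?_)
  filter_upwards [eventually_orbitLift_mk hp hg,
    eventually_orbitLift_mk (g := (1 : G)) (mk_mem_orbitLift_source a)
      (by rw [one_smul, orbitLift_mk_self]),
    (chartAt H a).open_source.mem_nhds (mem_chart_source H a)] with z hz hz' hza
  simp only [Function.comp_apply, ha, OpenPartialHomeomorph.coe_trans]
  rw [hz, hz', one_smul, (chartAt H a).left_inv hza]

theorem orbitLift_trans_chartAt_mem_maximalAtlas (b : M) :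
    (orbitLift G b).trans (chartAt H b) ∈
      IsManifold.maximalAtlas I ω (MulAction.orbitRel.Quotient G M) := by
  have : IsManifold I ω (MulAction.orbitRel.Quotient G M) := isManifold_orbitQuotient I hG
  refine OpenPartialHomeomorph.mem_maximalAtlas_of_contMDiffOn _ ?_ ?_
  · intro p hp
    refine ContMDiffAt.contMDiffWithinAt ?_
    exact (contMDiffAt_of_mem_maximalAtlas (IsManifold.chart_mem_maximalAtlas b) hp.2).comp p
      (contMDiffAt_orbitLift hG hp.1)
  · intro u hu
    refine ContMDiffAt.contMDiffWithinAt ?_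
    rw [OpenPartialHomeomorph.coe_trans_symm, orbitLift_symm]
    exact (contMDiff_orbitQuotient_mk hG).contMDiffAt.comp u
      (contMDiffAt_symm_of_mem_maximalAtlas (IsManifold.chart_mem_maximalAtlas b) hu.1)

end OrbitCovering

/-! ### Flat connections of different charts -/

section ChangeOfChart
open Bundle TopologicalSpace

variable {E : Type*} [NormedAddCommGroup E] [NormedSpace ℂ E]
  {H : Type*} [TopologicalSpace H] {I : ModelWithCorners ℂ E H}
  {M : Type*} [TopologicalSpace M] [ChartedSpace H M] [IsManifold I ω M]
  {F F' : Type*} [NormedAddCommGroup F] [NormedSpace ℂ F] [NormedAddCommGroup F'] [NormedSpace ℂ F']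

theorem mvfderiv_comp_of_hasFDerivAt {k : M → F} {G : F → F'} {x : M} {G' : F →L[ℂ] F'}
    (hG : HasFDerivAt G G' (k x)) (hk : MDifferentiableAt I 𝓘(ℂ, F) k x) (v : TangentSpace I x) :
    mvfderiv I (fun y => G (k y)) x v = G' (mvfderiv I k x v) := by
  have h := (hG.hasMFDerivAt.comp x hk.hasMFDerivAt).mfderiv
  exact congrArg (fun L => L v) h

theorem mvfderiv_prodMk_apply {k : M → F} {l : M → F'} {x : M}
    (hk : MDifferentiableAt I 𝓘(ℂ, F) k x) (hl : MDifferentiableAt I 𝓘(ℂ, F') l x)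
    (v : TangentSpace I x) :
    mvfderiv I (fun y => (k y, l y)) x v = (mvfderiv I k x v, mvfderiv I l x v) := by
  have h := hk.prodMk_space hl
  exact Prod.ext
    (mvfderiv_comp_of_hasFDerivAt (k := fun y => (k y, l y)) (hasFDerivAt_fst (𝕜 := ℂ)) h v).symm
    (mvfderiv_comp_of_hasFDerivAt (k := fun y => (k y, l y)) (hasFDerivAt_snd (𝕜 := ℂ)) h v).symm

variable [FiniteDimensional ℂ E]

/-- This is the transformation law of Christoffel symbols: differentiating `F'(e) · Y` gives `F''(v,
Y) + F'(∂_v Y)`. Writing `F''` as `F' ∘ B` keeps the inverse of `F'` out of the formula. -/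
theorem flatConnection_diff [I.Boundaryless] {e e' : OpenPartialHomeomorph M H}
    (he : e ∈ IsManifold.maximalAtlas I ω M) (he' : e' ∈ IsManifold.maximalAtlas I ω M) {x : M}
    (hx : x ∈ e.source) (hx' : x ∈ e'.source) {F : E → E} (hF : ContDiffAt ℂ ω F (e.extend I x))
    (h : ∀ᶠ y in 𝓝 x, e'.extend I y = F (e.extend I y)) {B : E → E → E}
    (hB : ∀ v w, fderiv ℂ (fderiv ℂ F) (e.extend I x) v w = fderiv ℂ F (e.extend I x) (B v w))
    (v w : TangentSpace I x) :
    (flatConnection e' he').diff (flatConnection e he) x w v =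
      coordInv I e x (B (coordDeriv I e x v) (coordDeriv I e x w)) := by
  have hφ : ∀ y ∈ e.source, MDifferentiableAt I 𝓘(ℂ, E) (e.extend I) y := fun y hy =>
    (e.contMDiffAt_extend he hy).mdifferentiableAt (by simp)
  have hd : ∀ᶠ y in 𝓝 x, ∀ u : TangentSpace I y, coordDeriv I e' y u =
      fderiv ℂ F (e.extend I y) (coordDeriv I e y u) := by
    have hF' : ∀ᶠ u in 𝓝 (e.extend I x), ContDiffAt ℂ ω F u := hF.eventually (by simp)
    have hc : ContinuousAt (e.extend I) x := e.continuousAt_extend hx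
    filter_upwards [h.eventually_nhds, hc.eventually hF', e.open_source.mem_nhds hx]
      with y hy hFy hye u
    have h1 : mfderiv I 𝓘(ℂ, E) (e'.extend I) y = mfderiv I 𝓘(ℂ, E) (fun z => F (e.extend I z)) y :=
      Filter.EventuallyEq.mfderiv_eq hy
    have h2 := mvfderiv_comp_of_hasFDerivAt (hFy.differentiableAt (by simp)).hasFDerivAt (hφ y hye) u
    exact (congrArg (fun L => L u) h1).trans h2
  have key : ∀ Y : Π x : M, TangentSpace I x, MDifferentiableAt I I.tangent (T% Y) x →
      coordDeriv I e' x ((flatConnection e' he').cov Y x v) = coordDeriv I e' x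
        ((flatConnection e he).cov Y x v +
          coordInv I e x (B (coordDeriv I e x v) (coordDeriv I e x (Y x)))) := by
    intro Y hY
    have hk := mdifferentiableAt_coordDeriv he hx hY
    have h1 : coordDeriv I e' x ((flatConnection e' he').cov Y x v) =
        mvfderiv I (fun y => coordDeriv I e' y (Y y)) x v := coordDeriv_coordInv he' hx' _
    have h2 : coordDeriv I e x ((flatConnection e he).cov Y x v) =
        mvfderiv I (fun y => coordDeriv I e y (Y y)) x v := coordDeriv_coordInv he hx _
    have h3 : mvfderiv I (fun y => coordDeriv I e' y (Y y)) x =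
        mvfderiv I (fun y => fderiv ℂ F (e.extend I y) (coordDeriv I e y (Y y))) x := by
      rw [mvfderiv, mvfderiv]
      have h3 : (fun y => coordDeriv I e' y (Y y)) =ᶠ[𝓝 x]
          (fun y => fderiv ℂ F (e.extend I y) (coordDeriv I e y (Y y))) := by
        filter_upwards [hd] with y hy
        exact hy _
      rw [h3.mfderiv_eq]
      rfl
    have hFd : HasFDerivAt (fderiv ℂ F) (fderiv ℂ (fderiv ℂ F) (e.extend I x)) (e.extend I x) :=
      ((hF.fderiv_right (m := ω) (by simp)).differentiableAt (by simp)).hasFDerivAt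
    -- The product rule for the pairing of `F'` with a vector produces the two terms.
    have h4 : HasFDerivAt (fun p : E × E => fderiv ℂ F p.1 p.2) _
        (e.extend I x, coordDeriv I e x (Y x)) :=
      HasFDerivAt.clm_apply (HasFDerivAt.comp (e.extend I x, coordDeriv I e x (Y x)) hFd hasFDerivAt_fst)
        hasFDerivAt_snd
    have h5 := mvfderiv_comp_of_hasFDerivAt (k := fun y => (e.extend I y, coordDeriv I e y (Y y))) h4
      ((hφ x hx).prodMk_space hk) v
    rw [h1, h3, h5, mvfderiv_prodMk_apply (hφ x hx) hk, hd.self_of_nhds, map_add, h2,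
      coordDeriv_coordInv he hx, map_add, ← hB]
    rfl
  have hY := FiberBundle.mdifferentiableAt_extend I E w
  have h1 := LocalAffineConnection.diff_apply (r := flatConnection e' he') (s := flatConnection e he)
    hx' hx hY
  have h2 := congrArg (coordInv I e' x) (key _ hY)
  rw [coordInv_coordDeriv he' hx', coordInv_coordDeriv he' hx'] at h2
  rw [FiberBundle.extend_apply_self] at h1 h2
  rw [h1, sub_apply, h2]
  abel

end ChangeOfChart

/-! ### Fractional linear maps and the standard projective structure -/

section ProjectiveMap
variable {E F : Type*} [NormedAddCommGroup E] [NormedSpace ℂ E] [NormedAddCommGroup F] [NormedSpace ℂ F]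
  (L : E →L[ℂ] F) (L₀ : F) (j : E →L[ℂ] ℂ) (j₀ : ℂ)

/-- The fractional linear map `u ↦ (L u + L₀) / (j u + j₀)`. -/
noncomputable def projMap (u : E) : F := (j u + j₀)⁻¹ • (L u + L₀)

variable {L L₀ j j₀} {u : E}

theorem contDiffAt_projMap (h : j u + j₀ ≠ 0) : ContDiffAt ℂ ω (projMap L L₀ j j₀) u := by
  have h1 : ContDiffAt ℂ ω (fun u => j u + j₀) u := by fun_prop
  have h2 : ContDiffAt ℂ ω (fun u => L u + L₀) u := by fun_prop
  exact (h1.inv h).smul h2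

theorem hasFDerivAt_inv_affine (h : j u + j₀ ≠ 0) :
    HasFDerivAt (fun u => (j u + j₀)⁻¹) (-((j u + j₀)⁻¹) ^ 2 • j) u := by
  have h1 : HasFDerivAt (fun u => j u + j₀) j u := j.hasFDerivAt.add_const j₀
  have h2 := (hasDerivAt_inv h).comp_hasFDerivAt u h1
  rwa [← inv_pow] at h2

theorem fderiv_projMap (h : j u + j₀ ≠ 0) (v : E) : fderiv ℂ (projMap L L₀ j j₀) u v =
    (j u + j₀)⁻¹ • L v - ((j u + j₀)⁻¹ ^ 2 * j v) • (L u + L₀) := by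
  have h2 : HasFDerivAt (fun u => L u + L₀) L u := L.hasFDerivAt.add_const L₀
  have h3 := ((hasFDerivAt_inv_affine h).smul h2).fderiv
  refine (congrArg (fun L => L v) h3).trans ?_
  simp only [add_apply, smul_apply, ContinuousLinearMap.smulRight_apply, smul_eq_mul]
  module

/-- The second derivative is `F'` applied to a pure tensor, with one-form minus the logarithmic
derivative of the denominator. By `flatConnection_diff`, fractional linear changes of coordinates
therefore preserve the projective class of the standard connection. -/
theorem fderiv_fderiv_projMap (h : j u + j₀ ≠ 0) (v w : E) :
    fderiv ℂ (fderiv ℂ (projMap L L₀ j j₀)) u v w =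
      fderiv ℂ (projMap L L₀ j j₀) u
        (-((j u + j₀)⁻¹ * j v) • w + -((j u + j₀)⁻¹ * j w) • v) := by
  have hd : DifferentiableAt ℂ (fderiv ℂ (projMap L L₀ j j₀)) u :=
    ((contDiffAt_projMap h).fderiv_right (m := ω) (by simp)).differentiableAt (by simp)
  have h1 : fderiv ℂ (fderiv ℂ (projMap L L₀ j j₀)) u v w =
      fderiv ℂ (fun u => fderiv ℂ (projMap L L₀ j j₀) u w) u v := by
    rw [fderiv_clm_apply hd (differentiableAt_const w)]
    simp
  have hev : (fun u => fderiv ℂ (projMap L L₀ j j₀) u w) =ᶠ[𝓝 u] fun u =>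
      (j u + j₀)⁻¹ • L w - ((((j u + j₀)⁻¹) ^ 2) * j w) • (L u + L₀) := by
    have hc : ContinuousAt (fun u => j u + j₀) u := by fun_prop
    filter_upwards [hc.eventually_ne h] with y hy
    rw [fderiv_projMap hy]
  have h2 : HasFDerivAt (fun u => L u + L₀) L u := L.hasFDerivAt.add_const L₀
  have h3 := hasFDerivAt_inv_affine h
  have h4 := (h3.smul_const (L w)).sub (((h3.pow 2).mul_const (j w)).smul h2)
  rw [h1, hev.fderiv_eq]
  refine (congrArg (fun L => L v) h4.fderiv).trans ?_
  rw [map_add, map_smul, map_smul, fderiv_projMap h, fderiv_projMap h]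
  simp only [sub_apply, add_apply, smul_apply, ContinuousLinearMap.smulRight_apply, smul_eq_mul]
  module

end ProjectiveMap

/-! ### Quasi-periodic functions on the fibres -/

namespace QuaternionicLattice
variable (D : QuaternionicLattice)

/-- The period `X · (τ, 1)ᵗ` of a matrix `X`. -/
noncomputable def periodVec (τ : ℍ) : Matrix (Fin 2) (Fin 2) ℝ →ₗ[ℝ] ℂ × ℂ where
  toFun X := ((X 0 0 : ℂ) * τ + (X 0 1 : ℂ), (X 1 0 : ℂ) * τ + (X 1 1 : ℂ))
  map_add' X Y := by ext1 <;> simp <;> ring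
  map_smul' c X := by ext1 <;> simp <;> ring

/-- Since `τ` is not real, `τ` and `1` span `ℂ` over `ℝ`. -/
theorem periodVec_surjective (τ : ℍ) : Function.Surjective (periodVec τ) := by
  have key : ∀ z : ℂ, ∃ m n : ℝ, (m : ℂ) * τ + n = z := fun z => by
    refine ⟨z.im / τ.im, z.re - z.im / τ.im * τ.re, ?_⟩
    have := τ.im_ne_zero
    apply Complex.ext <;> simp [this]
  rintro ⟨z, w⟩
  obtain ⟨m, n, h⟩ := key z
  obtain ⟨k, l, h'⟩ := key w
  exact ⟨!![m, n; k, l], Prod.ext (by simpa [periodVec] using h) (by simpa [periodVec] using h')⟩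

variable {W : Type*} [NormedAddCommGroup W] [NormedSpace ℂ W]

/-- The periods form a lattice of full rank in `ℂ²`, so `f` takes all its values on a compact set
and Liouville's theorem applies. -/
theorem eq_of_periodic {τ : ℍ} {f : ℂ × ℂ → W} (hf : Differentiable ℂ f)
    (h : ∀ X ∈ D.periodLattice, ∀ z, f (z + periodVec τ X) = f z) (z z' : ℂ × ℂ) : f z = f z' := by
  refine hf.apply_eq_apply_of_bounded ?_ z z'
  obtain ⟨b, hb⟩ := D.exists_basis
  let : NormedAddCommGroup (Matrix (Fin 2) (Fin 2) ℝ) := Matrix.normedAddCommGroup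
  let : NormedSpace ℝ (Matrix (Fin 2) (Fin 2) ℝ) := Matrix.normedSpace
  have : ProperSpace (Matrix (Fin 2) (Fin 2) ℝ) := pi_properSpace
  have hc : IsCompact (closure (ZSpan.fundamentalDomain b)) :=
    (ZSpan.fundamentalDomain_isBounded b).isCompact_closure
  have hcont : Continuous (fun X => f (periodVec τ X)) :=
    hf.continuous.comp (LinearMap.continuous_of_finiteDimensional (periodVec τ))
  refine (hc.image hcont).isBounded.subset ?_
  rintro _ ⟨z, rfl⟩
  obtain ⟨X, rfl⟩ := periodVec_surjective τ z
  refine ⟨ZSpan.fract b X, subset_closure (ZSpan.fract_mem_fundamentalDomain b X), ?_⟩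
  have hX : (ZSpan.floor b X : Matrix (Fin 2) (Fin 2) ℝ) ∈ D.periodLattice := by
    rw [← SetLike.mem_coe, hb]
    exact (ZSpan.floor b X).2
  have h1 := h _ hX (periodVec τ (ZSpan.fract b X))
  rw [← map_add, ZSpan.fract_apply, sub_add_cancel] at h1
  simp only [ZSpan.fract_apply]
  exact h1.symm

/-- A holomorphic function of `z` that is periodic up to a linear function of the first column of the
period matrix is constant. -/
theorem eq_zero_of_quasiPeriodic {τ : ℍ} {f : ℂ × ℂ → W} (hf : ContDiff ℂ ω f)
    {φ : ℂ × ℂ →ₗ[ℂ] W} (h : ∀ X ∈ D.periodLattice, ∀ z,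
      f (z + periodVec τ X) = f z + φ ((X 0 0 : ℂ), (X 1 0 : ℂ))) :
    φ = 0 ∧ ∀ z z', f z = f z' := by
  have hd : Differentiable ℂ f := hf.differentiable (by simp)
  have hd' : Differentiable ℂ (fderiv ℂ f) :=
    (hf.fderiv_right (m := ω) (by simp)).differentiable (by simp)
  -- The additive term does not depend on `z`, so the derivative is periodic, hence constant, and
  -- `f` is affine.
  have hper : ∀ X ∈ D.periodLattice, ∀ z, fderiv ℂ f (z + periodVec τ X) = fderiv ℂ f z := by
    intro X hX z
    rw [← fderiv_comp_add_right]
    simp_rw [h X hX]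
    rw [fderiv_add_const]
  let ℓ := fderiv ℂ f 0
  have hℓ : ∀ z, fderiv ℂ f z = ℓ := fun z => D.eq_of_periodic hd' hper z 0
  have haff : ∀ z, f z = f 0 + ℓ z := by
    have h1 : ∀ z, fderiv ℂ (fun z => f z - ℓ z) z = 0 := fun z => by
      rw [fderiv_fun_sub (hd z) ℓ.differentiableAt, hℓ, ContinuousLinearMap.fderiv, sub_self]
    intro z
    have h2 := is_const_of_fderiv_eq_zero (𝕜 := ℂ) (hd.sub ℓ.differentiable) h1 z 0
    simp only [Pi.sub_apply, map_zero, sub_zero] at h2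
    rw [← h2, sub_add_cancel]
  obtain ⟨b, hb⟩ := D.exists_basis
  let col : Matrix (Fin 2) (Fin 2) ℝ →ₗ[ℝ] ℂ × ℂ :=
    { toFun := fun X => ((X 0 0 : ℂ), (X 1 0 : ℂ))
      map_add' := fun X Y => by simp
      map_smul' := fun c X => by simp }
  -- The identity between linear part and quasi-periods holds on a real basis contained in the
  -- lattice, hence for all real matrices.
  have hlin : (ℓ : ℂ × ℂ →ₗ[ℂ] W).restrictScalars ℝ ∘ₗ periodVec τ = φ.restrictScalars ℝ ∘ₗ col := by
    refine b.ext fun i => ?_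
    have hbi : b i ∈ D.periodLattice := by
      rw [← SetLike.mem_coe, hb]; exact Submodule.subset_span ⟨i, rfl⟩
    have h1 := h _ hbi 0
    rw [haff, map_add, map_zero, zero_add, add_right_inj] at h1
    exact h1
  have hlin' : ∀ X, ℓ (periodVec τ X) = φ (col X) := fun X => LinearMap.congr_fun hlin X
  have hℓ0 : ℓ = 0 := by
    -- Matrices with zero first column have the standard basis of `ℂ²` among their periods, while
    -- `φ` contributes nothing. This forces `ℓ = 0`, and the matrices with zero second column then
    -- give `φ = 0`.
    have h1 := hlin' !![0, 1; 0, 0]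
    have h2 := hlin' !![0, 0; 0, 1]
    have h0 : φ (0, 0) = 0 := map_zero φ
    simp [periodVec, col, h0] at h1 h2
    ext <;> simp [h1, h2]
  refine ⟨?_, fun z z' => by rw [haff z, haff z', hℓ0]; simp⟩
  have h1 := hlin' !![1, 0; 0, 0]
  have h2 := hlin' !![0, 0; 1, 0]
  simp [col, hℓ0] at h1 h2
  ext <;> simp [← h1, ← h2]

/-- An invariant trace-free tensor on a fibre of `ℍ × ℂ² → ℍ` is a multiple of `dτ ⊗ dτ` with values in
the tangent space of the fibre. -/
theorem tensor_eq_of_invariant {τ : ℍ}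
    {T : ℂ × ℂ → (ℂ × ℂ × ℂ) →ₗ[ℂ] (ℂ × ℂ × ℂ) →ₗ[ℂ] (ℂ × ℂ × ℂ)}
    (hT : ∀ v w, ContDiff ℂ ω (fun z => T z v w)) (hs : ∀ z v w, T z v w = T z w v)
    (htr : ∀ z v, LinearMap.trace ℂ (ℂ × ℂ × ℂ) (T z v) = 0)
    (hinv : ∀ X ∈ D.periodLattice, ∀ z v w, T (z + periodVec τ X)
      (v + (0, v.1 • ((X 0 0 : ℂ), (X 1 0 : ℂ)))) (w + (0, w.1 • ((X 0 0 : ℂ), (X 1 0 : ℂ)))) =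
      T z v w + (0, (T z v w).1 • ((X 0 0 : ℂ), (X 1 0 : ℂ))))
    (z : ℂ × ℂ) (v w : ℂ × ℂ × ℂ) : T z v w = (0, (v.1 * w.1) • (T 0 (1, 0) (1, 0)).2) := by
  -- `e` is the direction `∂/∂τ` and `ι` embeds the vertical directions. The shear of a lattice
  -- element fixes vertical vectors and moves `e` by the first column of the matrix.
  let e : ℂ × ℂ × ℂ := (1, 0)
  let ι : ℂ × ℂ →ₗ[ℂ] ℂ × ℂ × ℂ := LinearMap.inr ℂ ℂ (ℂ × ℂ)
  let p₁ : ℂ × ℂ × ℂ →ₗ[ℂ] ℂ := LinearMap.fst ℂ ℂ (ℂ × ℂ)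
  let p₂ : ℂ × ℂ × ℂ →ₗ[ℂ] ℂ × ℂ := LinearMap.snd ℂ ℂ (ℂ × ℂ)
  have hT1 : ∀ v w, ContDiff ℂ ω (fun z => (T z v w).1) := fun v w => (hT v w).fst
  have hT2 : ∀ v w, ContDiff ℂ ω (fun z => (T z v w).2) := fun v w => (hT v w).snd
  have hff : ∀ X ∈ D.periodLattice, ∀ z s t, T (z + periodVec τ X) (ι s) (ι t) =
      T z (ι s) (ι t) + (0, (T z (ι s) (ι t)).1 • ((X 0 0 : ℂ), (X 1 0 : ℂ))) := by
    intro X hX z s t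
    have h := hinv X hX z (ι s) (ι t)
    simpa [ι] using h
  have hef : ∀ X ∈ D.periodLattice, ∀ z s, T (z + periodVec τ X) e (ι s) =
      T z e (ι s) + (0, (T z e (ι s)).1 • ((X 0 0 : ℂ), (X 1 0 : ℂ))) -
        T (z + periodVec τ X) (ι ((X 0 0 : ℂ), (X 1 0 : ℂ))) (ι s) := by
    intro X hX z s
    have h := hinv X hX z e (ι s)
    have he : ((0 : ℂ), e.1 • ((X 0 0 : ℂ), (X 1 0 : ℂ))) = ι ((X 0 0 : ℂ), (X 1 0 : ℂ)) := by
      simp [e, ι]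
    have h0 : ((0 : ℂ), (ι s).1 • ((X 0 0 : ℂ), (X 1 0 : ℂ))) = 0 := by
      simp [ι]
    rw [← h, he, h0, add_zero, (T _).map_add, LinearMap.add_apply, add_sub_cancel_right]
  have hee : ∀ X ∈ D.periodLattice, ∀ z, T (z + periodVec τ X) e e =
      T z e e + (0, (T z e e).1 • ((X 0 0 : ℂ), (X 1 0 : ℂ))) -
        (2 : ℂ) • T (z + periodVec τ X) e (ι ((X 0 0 : ℂ), (X 1 0 : ℂ))) -
        T (z + periodVec τ X) (ι ((X 0 0 : ℂ), (X 1 0 : ℂ))) (ι ((X 0 0 : ℂ), (X 1 0 : ℂ))) := by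
    intro X hX z
    have h := hinv X hX z e e
    have he : ((0 : ℂ), e.1 • ((X 0 0 : ℂ), (X 1 0 : ℂ))) = ι ((X 0 0 : ℂ), (X 1 0 : ℂ)) := by
      simp [e, ι]
    rw [← h, he, (T _).map_add, LinearMap.add_apply, map_add, map_add,
      hs _ (ι ((X 0 0 : ℂ), (X 1 0 : ℂ))) e, two_smul]
    abel
  -- the `τ`-component of `T` on two vertical vectors
  have hff1 : ∀ s t z, (T z (ι s) (ι t)).1 = (T 0 (ι s) (ι t)).1 := fun s t z =>
    D.eq_of_periodic ((hT1 _ _).differentiable (by simp)) (τ := τ)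
      (fun X hX z => by rw [hff X hX]; simp) z 0
  -- A component with one more argument `e` is quasi-periodic, and its increment is given by the
  -- constant components with one argument `e` less. So the increment vanishes, which kills those
  -- components, and the new component becomes constant.
  have hef1 := fun t => D.eq_zero_of_quasiPeriodic (hT1 e (ι t)) (τ := τ)
    (φ := -(p₁ ∘ₗ (T 0).flip (ι t) ∘ₗ ι))
    (fun X hX z => by rw [hef X hX, Prod.fst_sub, hff1]; simp [p₁, sub_eq_add_neg])
  have hff1' : ∀ s t z, (T z (ι s) (ι t)).1 = 0 := fun s t z => by
    have h := LinearMap.congr_fun (hef1 t).1 s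
    rw [hff1]
    simpa [p₁] using h
  have hee1 := D.eq_zero_of_quasiPeriodic (hT1 e e) (τ := τ)
    (φ := -((2 : ℂ) • (p₁ ∘ₗ T 0 e ∘ₗ ι)))
    (fun X hX z => by
      rw [hee X hX, Prod.fst_sub, Prod.fst_sub, hff1', Prod.smul_fst, (hef1 _).2 _ 0]
      simp [p₁, sub_eq_add_neg])
  have hef1' : ∀ t z, (T z e (ι t)).1 = 0 := fun t z => by
    have h := LinearMap.congr_fun hee1.1 t
    rw [(hef1 t).2 z 0]
    simpa [p₁] using h
  -- the vertical component
  have hff2 : ∀ s t z, (T z (ι s) (ι t)).2 = (T 0 (ι s) (ι t)).2 := fun s t z =>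
    D.eq_of_periodic ((hT2 _ _).differentiable (by simp)) (τ := τ)
      (fun X hX z => by rw [hff X hX, hff1']; simp) z 0
  have hef2 := fun t => D.eq_zero_of_quasiPeriodic (hT2 e (ι t)) (τ := τ)
    (φ := -(p₂ ∘ₗ (T 0).flip (ι t) ∘ₗ ι))
    (fun X hX z => by rw [hef X hX, Prod.snd_sub, hff2, hef1']; simp [p₂, sub_eq_add_neg])
  have hff2' : ∀ s t z, (T z (ι s) (ι t)).2 = 0 := fun s t z => by
    have h := LinearMap.congr_fun (hef2 t).1 s
    rw [hff2]
    simpa [p₂] using h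
  have hff0 : ∀ s t z, T z (ι s) (ι t) = 0 := fun s t z => Prod.ext (hff1' s t z) (hff2' s t z)
  -- Here the increment also contains the `τ`-component of `T(e, e)`, from the action of the shear
  -- on values. Its vanishing only relates this component to the vertical part of `T(e, ι t)`.
  have hee2 := D.eq_zero_of_quasiPeriodic (hT2 e e) (τ := τ)
    (φ := (T 0 e e).1 • LinearMap.id - ((2 : ℂ) • (p₂ ∘ₗ T 0 e ∘ₗ ι)))
    (fun X hX z => by
      rw [hee X hX, Prod.snd_sub, Prod.snd_sub, hff2', Prod.smul_snd, (hef2 _).2 _ 0, hee1.2 z 0]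
      simp [p₂]
      ring_nf)
  have hc : ∀ t, (T 0 e (ι t)).2 = ((T 0 e e).1 / 2) • t := fun t => by
    have h := LinearMap.congr_fun hee2.1 t
    simp only [LinearMap.sub_apply, LinearMap.smul_apply, LinearMap.comp_apply, LinearMap.id_apply,
      LinearMap.zero_apply, sub_eq_zero] at h
    rw [div_eq_inv_mul, mul_smul, h, smul_smul]
    simp [p₂]
  -- With `s` the `τ`-component of `T(e, e)`, the endomorphism `T(e, ·)` has diagonal entries `s,
  -- s/2, s/2`. Its trace `2s` vanishes.
  have htr0 : (T 0 e e).1 = 0 := by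
    have h1 : T 0 e = ((T 0 e e).1 / 2) • LinearMap.id +
        p₁.smulRight ((T 0 e e).1 / 2, (T 0 e e).2) := by
      have h2 : ∀ v : ℂ × ℂ × ℂ, v = v.1 • e + ι v.2 := fun v => by
        ext1 <;> simp [e, ι]
      refine LinearMap.ext fun v => ?_
      conv_lhs => rw [h2 v, map_add, map_smul]
      refine Prod.ext ?_ ?_
      · rw [Prod.fst_add, hef1']
        simp [p₁]
        ring
      · rw [Prod.snd_add, hc]
        simp [p₁]
        abel
    have h3 := htr 0 e
    rw [h1, map_add, map_smul, LinearMap.trace_id, LinearMap.trace_smulRight] at h3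
    simp [p₁] at h3
    linear_combination h3 / 2
  have hef0 : ∀ t z, T z e (ι t) = 0 := fun t z => Prod.ext (hef1' t z) (by
    rw [(hef2 t).2 z 0, hc, htr0]; simp)
  have h2 : ∀ v : ℂ × ℂ × ℂ, v = v.1 • e + ι v.2 := fun v => by
    ext1 <;> simp [e, ι]
  have hee0 : T z e e = (0, (T 0 e e).2) := Prod.ext ((hee1.2 z 0).trans htr0) (hee2.2 z 0)
  conv_lhs => rw [h2 v, h2 w]
  simp only [map_add, map_smul, LinearMap.add_apply, LinearMap.smul_apply, hff0, hef0,
    hs z (ι _) e, hee0]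
  simp [smul_smul, e, mul_comm]

end QuaternionicLattice

/-! ### Coordinates on the threefold -/

namespace KugaShimuraDatum
open Bundle TopologicalSpace

/-- The coordinates `(τ, z₁, z₂)` of a point of `ℍ × ℂ²`. -/
noncomputable def coords (x : Cover) : ℂ × ℂ × ℂ := (x.1, x.2)

theorem extChartAt_cover (b : Cover) : (extChartAt model b : Cover → ℂ × ℂ × ℂ) = coords := rfl

theorem chartAt_cover_source (b : Cover) :
    (chartAt (ModelProd ℂ (ℂ × ℂ)) b).source = Set.univ := by
  rw [prodChartedSpace_chartAt, OpenPartialHomeomorph.prod_source, ← Set.univ_prod_univ,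
    chartAt_self_eq]
  rfl

theorem mfderiv_coords (x : Cover) (v : TangentSpace model x) :
    (mfderiv model 𝓘(ℂ, ℂ × ℂ × ℂ) coords x v : ℂ × ℂ × ℂ) = v := by
  rw [← extChartAt_cover x, mfderiv_extChartAt_self]
  rfl

theorem contMDiff_coords : ContMDiff model 𝓘(ℂ, ℂ × ℂ × ℂ) ω coords := fun x => by
  rw [← extChartAt_cover x]
  exact contMDiffAt_extChartAt

/-- A map to `ℍ × ℂ²` has the differential that it has in coordinates. -/
theorem mfderiv_coords_comp {E H M : Type*} [NormedAddCommGroup E] [NormedSpace ℂ E]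
    [TopologicalSpace H] {I : ModelWithCorners ℂ E H} [TopologicalSpace M] [ChartedSpace H M]
    {f : M → Cover} {x : M} (hf : MDifferentiableAt I model f x) (v : TangentSpace I x) :
    (mfderiv I 𝓘(ℂ, ℂ × ℂ × ℂ) (fun y => coords (f y)) x v : ℂ × ℂ × ℂ) = mfderiv I model f x v := by
  have h := mfderiv_comp x (contMDiff_coords.contMDiffAt.mdifferentiableAt (by simp)) hf
  have h1 := congrArg (fun L => L v) h
  exact h1.trans (mfderiv_coords _ _)

variable (D : KugaShimuraDatum)

variable {D} in
/-- The linear part of the numerators of the action of `g` in coordinates. -/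
noncomputable def actNum (g : D.Grp) : ℂ × ℂ × ℂ →L[ℂ] ℂ × ℂ × ℂ :=
  LinearMap.toContinuousLinearMap
    { toFun := fun v => ((g.γ.1.1 0 0 : ℂ) * v.1, v.2.1 + (g.lam.1 0 0 : ℂ) * v.1,
        v.2.2 + (g.lam.1 1 0 : ℂ) * v.1)
      map_add' := fun v w => by ext <;> simp <;> ring
      map_smul' := fun c v => by ext <;> simp <;> ring }

variable {D} in
/-- The linear part of the denominator of the action of `g` in coordinates. -/
noncomputable def actDenom (g : D.Grp) : ℂ × ℂ × ℂ →L[ℂ] ℂ :=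
  (g.γ.1.1 1 0 : ℂ) • ContinuousLinearMap.fst ℂ ℂ (ℂ × ℂ)

variable {D} in
/-- The action of `g` in coordinates. -/
noncomputable def actMap (g : D.Grp) : ℂ × ℂ × ℂ → ℂ × ℂ × ℂ :=
  projMap (actNum g) ((g.γ.1.1 0 1 : ℂ), (g.lam.1 0 1 : ℂ), (g.lam.1 1 1 : ℂ)) (actDenom g)
    (g.γ.1.1 1 1 : ℂ)

variable {D}

theorem actDenom_coords (g : D.Grp) (x : Cover) :
    actDenom g (coords x) + (g.γ.1.1 1 1 : ℂ) = autFactor g.γ.1 x.1 := by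
  simp [actDenom, coords, autFactor]

theorem actDenom_coords_ne_zero (g : D.Grp) (x : Cover) :
    actDenom g (coords x) + (g.γ.1.1 1 1 : ℂ) ≠ 0 := by
  rw [actDenom_coords]
  exact autFactor_ne_zero _ _

theorem coords_smul (g : D.Grp) (x : Cover) : coords (g • x) = actMap g (coords x) := by
  have h : ((g.γ • x.1 : ℍ) : ℂ) =
        ((g.γ.1.1 0 0 : ℂ) * x.1 + (g.γ.1.1 0 1 : ℂ)) / autFactor g.γ.1 x.1 :=
    UpperHalfPlane.coe_specialLinearGroup_apply g.γ.1 x.1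
  rw [actMap, projMap, actDenom_coords, smul_def]
  simp only [coords, h]
  ext <;> simp [actNum] <;> ring

/-- The differential of the action in coordinates. -/
noncomputable def actDeriv (g : D.Grp) (x : Cover) : ℂ × ℂ × ℂ →L[ℂ] ℂ × ℂ × ℂ :=
  fderiv ℂ (actMap g) (coords x)

theorem contDiffAt_actMap (g : D.Grp) (x : Cover) : ContDiffAt ℂ ω (actMap g) (coords x) :=
  contDiffAt_projMap (actDenom_coords_ne_zero g x)

theorem actDeriv_apply (g : D.Grp) (x : Cover) (v : ℂ × ℂ × ℂ) : actDeriv g x v =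
    (v.1 / autFactor g.γ.1 x.1 ^ 2,
      (v.2.1 + (g.lam.1 0 0 : ℂ) * v.1) / autFactor g.γ.1 x.1 - (g.γ.1.1 1 0 : ℂ) * v.1 /
        autFactor g.γ.1 x.1 ^ 2 * (x.2.1 + ((g.lam.1 0 0 : ℂ) * x.1 + (g.lam.1 0 1 : ℂ))),
      (v.2.2 + (g.lam.1 1 0 : ℂ) * v.1) / autFactor g.γ.1 x.1 - (g.γ.1.1 1 0 : ℂ) * v.1 /
        autFactor g.γ.1 x.1 ^ 2 * (x.2.2 + ((g.lam.1 1 0 : ℂ) * x.1 + (g.lam.1 1 1 : ℂ)))) := by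
  have h0 := autFactor_ne_zero g.γ.1 x.1
  -- The determinant reduces the derivative of `(aτ + b) / (cτ + d)` to `(cτ + d)⁻²`.
  have hdet : (g.γ.1.1 0 0 : ℂ) * g.γ.1.1 1 1 - (g.γ.1.1 0 1 : ℂ) * g.γ.1.1 1 0 = 1 := by
    have := g.γ.1.2
    rw [Matrix.det_fin_two] at this
    exact_mod_cast this
  rw [actDeriv, actMap, fderiv_projMap (actDenom_coords_ne_zero g x), actDenom_coords]
  refine Prod.ext ?_ (Prod.ext ?_ ?_)
  · simp [actNum, actDenom, coords]
    field_simp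
    rw [autFactor]
    linear_combination v.1 * hdet
  · simp [actNum, actDenom, coords]
    field_simp
    ring
  · simp [actNum, actDenom, coords]
    field_simp
    ring

theorem actDeriv_eq_mfderiv (g : D.Grp) (x : Cover) (v : TangentSpace model x) :
    (mfderiv model model (fun y : Cover => g • y) x v : ℂ × ℂ × ℂ) = actDeriv g x v := by
  refine (mfderiv_coords_comp ((D.contMDiff_smul g).contMDiffAt.mdifferentiableAt
    (by simp)) v).symm.trans ?_
  rw [funext (coords_smul g)]
  have h := mvfderiv_comp_of_hasFDerivAt
    ((contDiffAt_actMap g x).differentiableAt (by simp)).hasFDerivAt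
    (contMDiff_coords.contMDiffAt.mdifferentiableAt (by simp)) v
  refine h.trans ?_
  exact congrArg (actDeriv g x) (mfderiv_coords x v)

theorem actDeriv_one (x : Cover) (v : ℂ × ℂ × ℂ) : actDeriv (1 : D.Grp) x v = v := by
  refine (actDeriv_eq_mfderiv 1 x v).symm.trans ?_
  rw [funext (one_smul D.Grp)]
  exact congrArg (fun L => L v) (mfderiv_id (I := model) (x := x))

variable (D)

theorem contMDiff_proj : ContMDiff model model ω D.proj :=
  contMDiff_orbitQuotient_mk D.contMDiff_smul

variable {D} in
theorem mdifferentiableAt_proj (x : Cover) : MDifferentiableAt model model D.proj x :=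
  D.contMDiff_proj.contMDiffAt.mdifferentiableAt (by simp)

theorem proj_smul (g : D.Grp) (x : Cover) : D.proj (g • x) = D.proj x :=
  Quotient.sound ⟨g, rfl⟩

theorem proj_surjective : Function.Surjective D.proj := Quotient.mk_surjective

/-- The chart of the threefold given by the local inverse at `b` of the universal covering. -/
noncomputable def sheet (b : Cover) : OpenPartialHomeomorph D.Threefold (ModelProd ℂ (ℂ × ℂ)) :=
  (orbitLift D.Grp b).trans (chartAt _ b)

theorem sheet_mem (b : Cover) : D.sheet b ∈ IsManifold.maximalAtlas model ω D.Threefold :=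
  orbitLift_trans_chartAt_mem_maximalAtlas D.contMDiff_smul b

theorem sheet_source (b : Cover) : (D.sheet b).source = (orbitLift D.Grp b).source := by
  rw [sheet, OpenPartialHomeomorph.trans_source, chartAt_cover_source, Set.preimage_univ,
    Set.inter_univ]

theorem proj_mem_sheet_source (b : Cover) : D.proj b ∈ (D.sheet b).source := by
  rw [sheet_source]
  exact mk_mem_orbitLift_source b

theorem sheet_extend (b : Cover) (p : D.Threefold) :
    (D.sheet b).extend model p = coords (orbitLift D.Grp b p) := rfl

variable {D}

theorem proj_orbitLift {b : Cover} {p : D.Threefold} (hp : p ∈ (D.sheet b).source) :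
    D.proj (orbitLift D.Grp b p) = p :=
  mk_orbitLift (by rwa [← sheet_source])

/-- A point above `p` is taken to the lift of `p` to a given sheet by an element of the group. -/
theorem exists_smul_eq_lift {b x : Cover} {p : D.Threefold} (hp : p ∈ (D.sheet b).source)
    (hx : D.proj x = p) : ∃ g : D.Grp, g • x = orbitLift D.Grp b p := by
  subst hx
  exact exists_smul_eq_orbitLift (by rwa [← sheet_source])

theorem eventually_lift_proj {b x : Cover} {g : D.Grp} (hx : D.proj x ∈ (D.sheet b).source)
    (hg : g • x = orbitLift D.Grp b (D.proj x)) :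
    ∀ᶠ z in 𝓝 x, orbitLift D.Grp b (D.proj z) = g • z :=
  eventually_orbitLift_mk (by rwa [← sheet_source]) hg

variable (D) in
/-- The differential of the covering at `x`, in the coordinates of `ℍ × ℂ²`. -/
noncomputable def projDeriv (x : Cover) : ℂ × ℂ × ℂ →L[ℂ] TangentSpace model (D.proj x) :=
  mfderiv model model D.proj x

/-- The differential of the covering in the chart of a sheet. -/
theorem coordDeriv_sheet_projDeriv {b x : Cover} {g : D.Grp} (hx : D.proj x ∈ (D.sheet b).source)
    (hg : g • x = orbitLift D.Grp b (D.proj x)) (v : ℂ × ℂ × ℂ) :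
    coordDeriv model (D.sheet b) (D.proj x) (D.projDeriv x v) = actDeriv g x v := by
  have h := mfderiv_comp x ((D.sheet b).contMDiffAt_extend (D.sheet_mem b) hx |>.mdifferentiableAt
    (by simp)) (mdifferentiableAt_proj x)
  refine (congrArg (fun L => L v) h).symm.trans ?_
  -- In the sheet at `b` the covering map is the action of `g`.
  have h1 : ((D.sheet b).extend model) ∘ D.proj =ᶠ[𝓝 x] fun z => coords (g • z) := by
    filter_upwards [eventually_lift_proj hx hg] with z hz
    rw [Function.comp_apply, sheet_extend, hz]
  rw [h1.mfderiv_eq]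
  exact (mfderiv_coords_comp ((D.contMDiff_smul g).contMDiffAt.mdifferentiableAt (by simp)) v).trans
    (actDeriv_eq_mfderiv g x v)

theorem coordInv_sheet_actDeriv {b x : Cover} {g : D.Grp} (hx : D.proj x ∈ (D.sheet b).source)
    (hg : g • x = orbitLift D.Grp b (D.proj x)) (v : ℂ × ℂ × ℂ) :
    coordInv model (D.sheet b) (D.proj x) (actDeriv g x v) = D.projDeriv x v := by
  rw [← coordDeriv_sheet_projDeriv hx hg, coordInv_coordDeriv (D.sheet_mem b) hx]

theorem coordInv_sheet_self (x : Cover) (v : ℂ × ℂ × ℂ) :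
    coordInv model (D.sheet x) (D.proj x) v = D.projDeriv x v := by
  rw [← coordInv_sheet_actDeriv (D.proj_mem_sheet_source x) (g := 1)
    (by rw [one_smul]; exact (orbitLift_mk_self x).symm), actDeriv_one]

/-- The change of coordinates between two sheets. -/
theorem eventually_sheet_extend {a b : Cover} {p : D.Threefold} {g : D.Grp}
    (ha : p ∈ (D.sheet a).source) (hb : p ∈ (D.sheet b).source)
    (hg : g • orbitLift D.Grp a p = orbitLift D.Grp b p) :
    ∀ᶠ q in 𝓝 p, (D.sheet b).extend model q = actMap g ((D.sheet a).extend model q) := by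
  obtain ⟨x, hx, rfl⟩ : ∃ x, x = orbitLift D.Grp a p ∧ D.proj x = p := ⟨_, rfl, proj_orbitLift ha⟩
  rw [← hx] at hg
  have h1 := eventually_lift_proj ha (g := 1) (by rw [one_smul, ← hx])
  have h2 := eventually_lift_proj hb hg
  refine eventually_mk_of_eventually ?_
  filter_upwards [h1, h2] with z hz hz'
  change (D.sheet b).extend model (D.proj z) = actMap g ((D.sheet a).extend model (D.proj z))
  rw [sheet_extend, sheet_extend, hz, hz', one_smul, coords_smul]

theorem coordDeriv_sheet {a b : Cover} {p : D.Threefold} {g : D.Grp}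
    (ha : p ∈ (D.sheet a).source) (hb : p ∈ (D.sheet b).source)
    (hg : g • orbitLift D.Grp a p = orbitLift D.Grp b p) (v : TangentSpace model p) :
    coordDeriv model (D.sheet b) p v =
      actDeriv g (orbitLift D.Grp a p) (coordDeriv model (D.sheet a) p v) := by
  have h1 := Filter.EventuallyEq.mfderiv_eq (I := model) (I' := 𝓘(ℂ, ℂ × ℂ × ℂ))
    (eventually_sheet_extend ha hb hg)
  refine (congrArg (fun L => L v) h1).trans ?_
  exact mvfderiv_comp_of_hasFDerivAt (k := (D.sheet a).extend model)
    ((contDiffAt_actMap g (orbitLift D.Grp a p)).differentiableAt (by simp)).hasFDerivAt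
    (((D.sheet a).contMDiffAt_extend (D.sheet_mem a) ha).mdifferentiableAt (by simp)) v

variable (D)

/-- The flat connection of a sheet. -/
noncomputable def sheetConnection (b : Cover) : LocalAffineConnection model D.Threefold :=
  flatConnection (D.sheet b) (D.sheet_mem b)

/-- The projective connection on the threefold that is induced by the standard connection of `ℂ³`. -/
noncomputable def standardConnection : HolProjConnection model D.Threefold where
  reps := Set.range D.sheetConnection
  cover p := by
    obtain ⟨x, rfl⟩ := D.proj_surjective p
    exact ⟨_, ⟨x, rfl⟩, D.proj_mem_sheet_source x⟩
  compatible := by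
    rintro _ ⟨b, rfl⟩ _ ⟨a, rfl⟩
    rw [LocalAffineConnection.projEquiv_iff]
    rintro p ⟨hb, ha⟩
    change p ∈ (D.sheet b).source at hb
    change p ∈ (D.sheet a).source at ha
    obtain ⟨g, hg⟩ := exists_smul_eq_lift hb (proj_orbitLift ha)
    let x := orbitLift D.Grp a p
    -- The one-form `-c dτ / (cτ + d)` of the fractional linear change of sheets.
    let θ : ℂ × ℂ × ℂ →L[ℂ] ℂ := -((actDenom g (coords x) + (g.γ.1.1 1 1 : ℂ))⁻¹ • actDenom g)
    have h := flatConnection_diff (D.sheet_mem a) (D.sheet_mem b) ha hb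
      (contDiffAt_actMap g x) (eventually_sheet_extend ha hb hg)
      (B := fun v w => θ v • w + θ w • v) (fun v w => by
        refine (fderiv_fderiv_projMap (actDenom_coords_ne_zero g x) v w).trans ?_
        simp [θ]; rfl)
    refine ⟨θ.comp (coordDeriv model (D.sheet a) p), fun v w => ?_⟩
    refine (h w v).trans ?_
    rw [map_add, map_smul, map_smul, coordInv_coordDeriv (D.sheet_mem a) ha,
      coordInv_coordDeriv (D.sheet_mem a) ha, add_comm]
    rfl

end KugaShimuraDatum

/-! ### The tensors of sections of `K_Σ^{3/2}` -/

namespace KugaShimuraDatum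
open Bundle TopologicalSpace
variable {D : KugaShimuraDatum}

theorem sectionLift_smul {k : ℕ} (s : Π p, D.halfCanonicalFiber k p) (γ : D.Γ) (τ : ℍ) :
    sectionLift s (γ • τ) = autFactor γ.1 τ ^ k * sectionLift s τ := by
  have hp : D.curveProj (γ • τ) = D.curveProj τ := Quotient.sound ⟨γ, rfl⟩
  have h := (s (D.curveProj τ)).2 γ ⟨τ, rfl⟩ ⟨γ • τ, hp⟩ rfl
  refine Eq.trans ?_ h
  -- The points `τ` and `γ • τ` have equal images, but the section takes values in fibres indexed by
  -- these images, so the value has to be transported.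
  have key : ∀ (p q : D.Curve) (hpq : p = q) (σ : ℍ) (hσ : D.curveProj σ = p),
      (s p).1 ⟨σ, hσ⟩ = (s q).1 ⟨σ, hσ.trans hpq⟩ := by
    rintro p _ rfl σ hσ; rfl
  exact key _ _ hp _ _

/-- The value at `τ` of a pair of sections. -/
noncomputable def pairLift (c : D.SectionPairs) (τ : ℍ) : ℂ × ℂ :=
  (sectionLift c.1.1 τ, sectionLift c.2.1 τ)

theorem pairLift_smul (c : D.SectionPairs) (γ : D.Γ) (τ : ℍ) :
    pairLift c (γ • τ) = autFactor γ.1 τ ^ 3 • pairLift c τ :=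
  Prod.ext (sectionLift_smul _ γ τ) (sectionLift_smul _ γ τ)

theorem contMDiff_pairLift (c : D.SectionPairs) : ContMDiff 𝓘(ℂ) 𝓘(ℂ, ℂ × ℂ) ω (pairLift c) :=
  ContMDiff.prodMk_space c.1.2 c.2.2

theorem pairLift_add (c d : D.SectionPairs) (τ : ℍ) :
    pairLift (c + d) τ = pairLift c τ + pairLift d τ := rfl

theorem pairLift_neg (c : D.SectionPairs) (τ : ℍ) : pairLift (-c) τ = -pairLift c τ := rfl

theorem pairLift_zero (τ : ℍ) : pairLift (0 : D.SectionPairs) τ = 0 := rfl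

theorem pairLift_injective {c d : D.SectionPairs} (h : ∀ τ, pairLift c τ = pairLift d τ) : c = d := by
  have key : ∀ s t : D.H0 3, (∀ τ, sectionLift s.1 τ = sectionLift t.1 τ) → s = t := by
    intro s t hst
    refine Subtype.ext (funext fun p => Subtype.ext (funext ?_))
    rintro ⟨τ, rfl⟩
    exact hst τ
  exact Prod.ext (key _ _ fun τ => congrArg Prod.fst (h τ)) (key _ _ fun τ => congrArg Prod.snd (h τ))

/-- A function with the transformation rule of a pair of sections is a pair of sections. -/
theorem exists_pairLift_eq {f : ℍ → ℂ × ℂ} (hf : ContMDiff 𝓘(ℂ) 𝓘(ℂ, ℂ × ℂ) ω f)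
    (h : ∀ (γ : D.Γ) τ, f (γ • τ) = autFactor γ.1 τ ^ 3 • f τ) :
    ∃ c : D.SectionPairs, ∀ τ, pairLift c τ = f τ := by
  have key : ∀ f : ℍ → ℂ, ContMDiff 𝓘(ℂ) 𝓘(ℂ) ω f →
      (∀ (γ : D.Γ) τ, f (γ • τ) = autFactor γ.1 τ ^ 3 * f τ) →
      ∃ s : D.H0 3, ∀ τ, sectionLift s.1 τ = f τ := by
    intro f hf h
    exact ⟨⟨fun p => ⟨fun τ => f τ.1, fun γ τ τ' e => (congrArg f e).trans (h γ τ)⟩, hf⟩, fun τ => rfl⟩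
  obtain ⟨s, hs⟩ := key (fun τ => (f τ).1)
    ((contDiff_fst (𝕜 := ℂ) (E := ℂ) (F := ℂ)).contMDiff.comp hf)
    (fun γ τ => by simp only [h]; simp)
  obtain ⟨t, ht⟩ := key (fun τ => (f τ).2)
    ((contDiff_snd (𝕜 := ℂ) (E := ℂ) (F := ℂ)).contMDiff.comp hf)
    (fun γ τ => by simp only [h]; simp)
  exact ⟨(s, t), fun τ => Prod.ext (hs τ) (ht τ)⟩

/-- The bilinear map `(v, w) ↦ dτ(v) dτ(w) u` for a vector `u` of the fibre direction. -/
noncomputable def squareTensor (u : ℂ × ℂ) : ℂ × ℂ × ℂ →L[ℂ] ℂ × ℂ × ℂ →L[ℂ] ℂ × ℂ × ℂ :=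
  (ContinuousLinearMap.fst ℂ ℂ (ℂ × ℂ)).smulRight
    ((ContinuousLinearMap.fst ℂ ℂ (ℂ × ℂ)).smulRight ((0, u) : ℂ × ℂ × ℂ))

theorem squareTensor_apply (u : ℂ × ℂ) (v w : ℂ × ℂ × ℂ) :
    squareTensor u v w = (0, (v.1 * w.1) • u) := by
  simp [squareTensor, smul_smul]

/-- Weights balance: the two factors `dτ` contribute `(cτ + d)⁻⁴`, the pair of sections `(cτ + d)³`,
and a vertical vector is scaled by `(cτ + d)⁻¹`. -/
theorem actDeriv_squareTensor (c : D.SectionPairs) (g : D.Grp) (x : Cover) (v w : ℂ × ℂ × ℂ) :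
    squareTensor (pairLift c (g • x).1) (actDeriv g x v) (actDeriv g x w) =
      actDeriv g x (squareTensor (pairLift c x.1) v w) := by
  have h0 := autFactor_ne_zero g.γ.1 x.1
  have h1 : pairLift c (g • x).1 = autFactor g.γ.1 x.1 ^ 3 • pairLift c x.1 := pairLift_smul c g.γ x.1
  rw [h1, squareTensor_apply, squareTensor_apply, actDeriv_apply g x (_, _)]
  simp only [actDeriv_apply]
  refine Prod.ext (by simp) (Prod.ext ?_ ?_) <;> simp <;> field_simp

/-- The tensor on the threefold that is induced by a pair of sections. -/
noncomputable def sectionTensor (c : D.SectionPairs) (p : D.Threefold) :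
    TangentSpace model p →L[ℂ] TangentSpace model p →L[ℂ] TangentSpace model p :=
  let b := (D.proj_surjective p).choose
  let ℓ := (ContinuousLinearMap.fst ℂ ℂ (ℂ × ℂ)).comp (coordDeriv model (D.sheet b) p)
  ℓ.smulRight (ℓ.smulRight (coordInv model (D.sheet b) p (0, pairLift c b.1)))

theorem coordInv_sheet {a b : Cover} {p : D.Threefold} {g : D.Grp}
    (ha : p ∈ (D.sheet a).source) (hb : p ∈ (D.sheet b).source)
    (hg : g • orbitLift D.Grp a p = orbitLift D.Grp b p) (v : ℂ × ℂ × ℂ) :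
    coordInv model (D.sheet b) p (actDeriv g (orbitLift D.Grp a p) v) =
      coordInv model (D.sheet a) p v := by
  have h := coordDeriv_sheet ha hb hg (coordInv model (D.sheet a) p v)
  rw [coordDeriv_coordInv (D.sheet_mem a) ha] at h
  rw [← h, coordInv_coordDeriv (D.sheet_mem b) hb]

/-- Invariance under the group makes the chosen point above `p` in `sectionTensor` irrelevant, so
any sheet around `p` computes the tensor. -/
theorem sectionTensor_eq (c : D.SectionPairs) {b : Cover} {p : D.Threefold}
    (hp : p ∈ (D.sheet b).source) (v w : TangentSpace model p) :
    sectionTensor c p v w = coordInv model (D.sheet b) p (squareTensor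
      (pairLift c (orbitLift D.Grp b p).1) (coordDeriv model (D.sheet b) p v)
      (coordDeriv model (D.sheet b) p w)) := by
  have hs := (D.proj_surjective p).choose_spec
  let a := (D.proj_surjective p).choose
  have ha : p ∈ (D.sheet a).source := by
    have := D.proj_mem_sheet_source a
    rwa [hs] at this
  have hl : orbitLift D.Grp a p = a := by
    have := orbitLift_mk_self (G := D.Grp) a
    change orbitLift D.Grp a (D.proj a) = a at this
    rwa [hs] at this
  have h1 : sectionTensor c p v w = coordInv model (D.sheet a) p (squareTensor
      (pairLift c (orbitLift D.Grp a p).1) (coordDeriv model (D.sheet a) p v)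
      (coordDeriv model (D.sheet a) p w)) := by
    rw [hl]
    simp only [sectionTensor, squareTensor, ContinuousLinearMap.smulRight_apply, map_smul,
      smul_apply]
    rfl
  obtain ⟨g, hg⟩ := exists_smul_eq_lift hp (proj_orbitLift ha)
  rw [h1, coordDeriv_sheet ha hp hg, coordDeriv_sheet ha hp hg, ← hg, actDeriv_squareTensor,
    coordInv_sheet ha hp hg]

theorem sectionTensor_symm (c : D.SectionPairs) (p : D.Threefold) (v w : TangentSpace model p) :
    sectionTensor c p v w = sectionTensor c p w v := by
  simp only [sectionTensor, ContinuousLinearMap.smulRight_apply, smul_apply]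
  rw [smul_comm]

/-- This links the tensor on `M` with the formula on `ℍ × ℂ²` in `IsTranslate`. -/
theorem sectionTensor_projDeriv (c : D.SectionPairs) (x : Cover) (v w : ℂ × ℂ × ℂ) :
    sectionTensor c (D.proj x) (D.projDeriv x v) (D.projDeriv x w) =
      D.projDeriv x (squareTensor (pairLift c x.1) v w) := by
  have hx := D.proj_mem_sheet_source x
  have hl : orbitLift D.Grp x (D.proj x) = x := orbitLift_mk_self x
  rw [sectionTensor_eq c hx, ← coordInv_sheet_self, ← coordInv_sheet_self, ← coordInv_sheet_self,
    coordDeriv_coordInv (D.sheet_mem x) hx, coordDeriv_coordInv (D.sheet_mem x) hx, hl]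

theorem sectionTensor_add (c d : D.SectionPairs) (p : D.Threefold) (v w : TangentSpace model p) :
    sectionTensor (c + d) p v w = sectionTensor c p v w + sectionTensor d p v w := by
  obtain ⟨x, rfl⟩ := D.proj_surjective p
  have hx := D.proj_mem_sheet_source x
  simp only [sectionTensor_eq _ hx, ← map_add, squareTensor_apply, pairLift_add]
  simp

theorem sectionTensor_neg (c : D.SectionPairs) (p : D.Threefold) (v w : TangentSpace model p) :
    sectionTensor (-c) p v w = -sectionTensor c p v w := by
  obtain ⟨x, rfl⟩ := D.proj_surjective p
  have hx := D.proj_mem_sheet_source x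
  simp only [sectionTensor_eq _ hx, ← map_neg, squareTensor_apply, pairLift_neg]
  simp

theorem sectionTensor_zero (p : D.Threefold) (v w : TangentSpace model p) :
    sectionTensor (0 : D.SectionPairs) p v w = 0 := by
  obtain ⟨x, rfl⟩ := D.proj_surjective p
  have hx := D.proj_mem_sheet_source x
  simp only [sectionTensor_eq _ hx, squareTensor_apply, pairLift_zero, smul_zero]
  exact map_zero _

theorem contMDiffAt_lift {b : Cover} {p : D.Threefold} (hp : p ∈ (D.sheet b).source) :
    ContMDiffAt model model ω (orbitLift D.Grp b) p :=
  contMDiffAt_orbitLift D.contMDiff_smul (by rwa [← sheet_source])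

theorem isHolomorphicTensorAt_sectionTensor (c : D.SectionPairs) (p : D.Threefold) :
    IsHolomorphicTensorAt (fun q v w => sectionTensor c q v w) p := by
  intro V W hV hW
  obtain ⟨x, rfl⟩ := D.proj_surjective p
  have hx := D.proj_mem_sheet_source x
  have h1 := contMDiffAt_coordDeriv (D.sheet_mem x) hx hV
  have h2 := contMDiffAt_coordDeriv (D.sheet_mem x) hx hW
  have hf : ContMDiff 𝓘(ℂ, ℂ × ℂ × ℂ) 𝓘(ℂ) ω (Prod.fst : ℂ × ℂ × ℂ → ℂ) :=
    (contDiff_fst (𝕜 := ℂ) (E := ℂ) (F := ℂ × ℂ)).contMDiff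
  have h3 : ContMDiffAt model 𝓘(ℂ, ℂ × ℂ) ω
      (fun q => pairLift c (orbitLift D.Grp x q).1) (D.proj x) :=
    (contMDiff_pairLift c).contMDiffAt.comp (D.proj x)
      (contMDiffAt_fst.comp (D.proj x) (contMDiffAt_lift hx))
  have h4 := (contMDiffAt_const (c := (0 : ℂ))).prodMk_space
    ((((hf.contMDiffAt.comp _ h1).mul (hf.contMDiffAt.comp _ h2))).smul h3)
  refine (contMDiffAt_coordInv (D.sheet_mem x) hx h4).congr_of_eventuallyEq ?_
  filter_upwards [(D.sheet x).open_source.mem_nhds hx] with q hq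
  rw [sectionTensor_eq c hq, squareTensor_apply]
  rfl

/-- A translation in terms of the difference tensors of local representatives. -/
theorem isTranslate_iff {c : D.SectionPairs} {φ ψ : HolProjConnection model D.Threefold} :
    IsTranslate c φ ψ ↔ ∀ r ∈ φ.reps, ∀ s ∈ ψ.reps, ∀ p ∈ r.domain ⊓ s.domain,
      IsPureTensor (fun v w => s.diff r p v w - sectionTensor c p v w) := by
  refine forall₂_congr fun r _ => forall₂_congr fun s _ => ?_
  rw [inf_comm, ← LocalAffineConnection.exists_oneForm_iff
    (isHolomorphicTensorAt_sectionTensor c)]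
  refine exists_congr fun θ => and_congr Iff.rfl ?_
  constructor
  · intro h p hp Y hY v
    obtain ⟨x, rfl⟩ := D.proj_surjective p
    have hx := D.proj_mem_sheet_source x
    -- Every tangent vector at `D.proj x` is the image of its coordinates in the sheet at `x`, so
    -- tangent vectors of the cover may be used as arguments.
    have hv : D.projDeriv x (coordDeriv model (D.sheet x) (D.proj x) v) = v := by
      rw [← coordInv_sheet_self, coordInv_coordDeriv (D.sheet_mem x) hx]
    have hw : D.projDeriv x (coordDeriv model (D.sheet x) (D.proj x) (Y (D.proj x))) =
        Y (D.proj x) := by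
      rw [← coordInv_sheet_self, coordInv_coordDeriv (D.sheet_mem x) hx]
    have h1 := h x hp Y hY (coordDeriv model (D.sheet x) (D.proj x) v)
      (coordDeriv model (D.sheet x) (D.proj x) (Y (D.proj x))) hw
    change s.cov Y (D.proj x) (D.projDeriv x _) = r.cov Y (D.proj x) (D.projDeriv x _) +
      D.projDeriv x _ + (θ (D.proj x) (D.projDeriv x _) • Y (D.proj x) +
        θ (D.proj x) (Y (D.proj x)) • D.projDeriv x _) at h1
    have h2 := sectionTensor_projDeriv c x (coordDeriv model (D.sheet x) (D.proj x) v)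
      (coordDeriv model (D.sheet x) (D.proj x) (Y (D.proj x)))
    rw [hv] at h1
    rw [hv, hw, sectionTensor_symm, squareTensor_apply] at h2
    rw [h1, h2]
    rfl
  · intro h x hp Y hY v w hw
    have h1 := h (D.proj x) hp Y hY (D.projDeriv x v)
    have h2 := (sectionTensor_projDeriv c x v w).trans
      (congrArg (D.projDeriv x) (squareTensor_apply (pairLift c x.1) v w))
    change D.projDeriv x w = _ at hw
    rw [hw, sectionTensor_symm] at h2
    rw [h2] at h1
    exact h1

end KugaShimuraDatum

/-! ### The difference of a projective connection and the standard one -/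

section TraceFreeMap
variable {V : Type*} [AddCommGroup V] [Module ℂ V]

/-- The trace-free part of a symmetric bilinear map, as a bilinear map. -/
noncomputable def traceFreeMap (B : V →ₗ[ℂ] V →ₗ[ℂ] V) : V →ₗ[ℂ] V →ₗ[ℂ] V :=
  LinearMap.mk₂ ℂ (traceFree B)
    (fun v v' w => by simp only [traceFree, map_add, LinearMap.add_apply]; module)
    (fun c v w => by simp only [traceFree, map_smul, LinearMap.smul_apply, smul_eq_mul]; module)
    (fun v w w' => by simp only [traceFree, map_add]; module)
    (fun c v w => by simp only [traceFree, map_smul, smul_eq_mul]; module)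

theorem traceFreeMap_apply (B : V →ₗ[ℂ] V →ₗ[ℂ] V) (v w : V) :
    traceFreeMap B v w = traceFree B v w := rfl

theorem traceFree_symm {B : V →ₗ[ℂ] V →ₗ[ℂ] V} (h : ∀ v w, B v w = B w v) (v w : V) :
    traceFree B v w = traceFree B w v := by
  rw [traceFree, traceFree, h v w]
  abel

theorem isPureTensor_sub_traceFree [FiniteDimensional ℂ V] [TopologicalSpace V] [T2Space V]
    [IsTopologicalAddGroup V] [ContinuousSMul ℂ V] (B : V →ₗ[ℂ] V →ₗ[ℂ] V) :
    IsPureTensor (fun v w => B v w - traceFree B v w) :=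
  ⟨LinearMap.toContinuousLinearMap
    ((Module.finrank ℂ V + 1 : ℂ)⁻¹ • (LinearMap.trace ℂ V ∘ₗ B)), fun v w => by
      simp [traceFree]
      abel⟩

end TraceFreeMap

/-! ### Differences of connections in a chart -/

section ChartTensor
open Bundle TopologicalSpace
variable {E : Type*} [NormedAddCommGroup E] [NormedSpace ℂ E] [FiniteDimensional ℂ E]
  {H : Type*} [TopologicalSpace H] {I : ModelWithCorners ℂ E H}
  {M : Type*} [TopologicalSpace M] [ChartedSpace H M] [IsManifold I ω M]

/-- The difference of two connections in the coordinates of a chart. -/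
noncomputable def chartTensor (r s : LocalAffineConnection I M) (e : OpenPartialHomeomorph M H) (p : M) :
    E →ₗ[ℂ] E →ₗ[ℂ] E :=
  LinearMap.mk₂ ℂ (fun v w => coordDeriv I e p (r.diff s p (coordInv I e p v) (coordInv I e p w)))
    (fun v v' w => by simp only [map_add, add_apply])
    (fun c v w => by simp only [map_smul, smul_apply])
    (fun v w w' => by simp only [map_add])
    (fun c v w => by simp only [map_smul])

theorem chartTensor_apply (r s : LocalAffineConnection I M) (e : OpenPartialHomeomorph M H) (p : M)
    (v w : E) : chartTensor r s e p v w =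
      coordDeriv I e p (r.diff s p (coordInv I e p v) (coordInv I e p w)) := rfl

variable {r s r' s' : LocalAffineConnection I M} {e : OpenPartialHomeomorph M H} {p : M}

theorem contMDiffAt_chartTensor (he : e ∈ IsManifold.maximalAtlas I ω M) (hp : p ∈ e.source)
    (hr : p ∈ r.domain) (hs : p ∈ s.domain) (v w : E) :
    ContMDiffAt I 𝓘(ℂ, E) ω (fun q => chartTensor r s e q v w) p := by
  have := FiniteDimensional.complete ℂ E
  exact contMDiffAt_coordDeriv he hp (LocalAffineConnection.isHolomorphicTensorAt_diff hr hs _ _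
    (contMDiffAt_coordInv_const he hp v) (contMDiffAt_coordInv_const he hp w))

theorem contMDiffAt_traceFree_chartTensor (he : e ∈ IsManifold.maximalAtlas I ω M) (hp : p ∈ e.source)
    (hr : p ∈ r.domain) (hs : p ∈ s.domain) (v w : E) :
    ContMDiffAt I 𝓘(ℂ, E) ω (fun q => traceFree (chartTensor r s e q) v w) p := by
  have h := fun v w => contMDiffAt_chartTensor he hp hr hs v w
  have ht : ∀ v, ContMDiffAt I 𝓘(ℂ) ω
      (fun q => LinearMap.trace ℂ E (chartTensor r s e q v)) p := by
    intro v
    let b := Module.finBasis ℂ E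
    simp only [LinearMap.trace_eq_matrix_trace ℂ b, Matrix.trace, Matrix.diag, LinearMap.toMatrix_apply]
    refine contMDiffAt_finsetSum fun i _ => ?_
    exact (ContinuousLinearMap.contMDiff (LinearMap.toContinuousLinearMap (b.coord i))).contMDiffAt.comp
      p (h v (b i))
  exact ((h v w).sub ((contMDiffAt_const.mul (ht v)).smul contMDiffAt_const)).sub
    ((contMDiffAt_const.mul (ht w)).smul contMDiffAt_const)

/-- The trace-free part depends only on the projective equivalence classes of the connections. -/
theorem traceFree_chartTensor_congr (he : e ∈ IsManifold.maximalAtlas I ω M) (hp : p ∈ e.source)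
    (hr : p ∈ r.domain) (hs : p ∈ s.domain) (hr' : p ∈ r'.domain) (hs' : p ∈ s'.domain)
    (hrr : r.ProjEquiv r') (hss : s.ProjEquiv s') (v w : E) :
    traceFree (chartTensor r s e p) v w = traceFree (chartTensor r' s' e p) v w := by
  rw [LocalAffineConnection.projEquiv_iff] at hrr hss
  -- By the cocycle rule `(r - s) - (r' - s') = (r - r') - (s - s')`, and both terms on the right
  -- are pure.
  have h1 := ((hrr p ⟨hr, hr'⟩).add (hss p ⟨hs, hs'⟩).neg).conj (L := coordDeriv I e p)
    (K := coordInv I e p) (coordDeriv_coordInv he hp)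
  obtain ⟨θ, hθ⟩ := h1
  rw [← sub_eq_zero, ← traceFree_sub]
  refine traceFree_of_pure (θ := (θ : E →ₗ[ℂ] ℂ)) (fun v w => ?_) v w
  refine Eq.trans ?_ (hθ v w)
  rw [LinearMap.sub_apply, LinearMap.sub_apply, chartTensor_apply, chartTensor_apply, ← map_sub,
    LocalAffineConnection.diff_add hr hr' hs, LocalAffineConnection.diff_add hr' hs' hs,
    LocalAffineConnection.diff_swap hs hs']
  congr 1
  abel

end ChartTensor

/-! ### The trace-free difference tensor on the universal cover -/

namespace KugaShimuraDatum
open Bundle TopologicalSpace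
variable {D : KugaShimuraDatum}

theorem actDeriv_injective (g : D.Grp) (x : Cover) : Function.Injective (actDeriv g x) := by
  rw [injective_iff_map_eq_zero]
  intro v hv
  have h0 := autFactor_ne_zero g.γ.1 x.1
  rw [actDeriv_apply] at hv
  have h1 : v.1 = 0 := by simpa [h0] using congrArg Prod.fst hv
  have h2 : v.2.1 = 0 := by simpa [h0, h1] using congrArg (fun u => u.2.1) hv
  have h3 : v.2.2 = 0 := by simpa [h0, h1] using congrArg (fun u => u.2.2) hv
  exact Prod.ext h1 (Prod.ext h2 h3)

variable (φ : HolProjConnection model D.Threefold)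

/-- The trace-free part of the difference of `φ` and the standard projective connection, on the
covering space. -/
noncomputable def coverTensor (x : Cover) :
    ℂ × ℂ × ℂ →ₗ[ℂ] ℂ × ℂ × ℂ →ₗ[ℂ] ℂ × ℂ × ℂ :=
  traceFreeMap (chartTensor (φ.cover (D.proj x)).choose (D.sheetConnection x) (D.sheet x) (D.proj x))

variable {φ}

/-- A change of sheet conjugates the difference tensor by `actDeriv g`, and the trace-free part is
equivariant. The choice of local representatives is absorbed by `traceFree_chartTensor_congr`. -/
theorem traceFree_chartTensor_sheet {r : LocalAffineConnection model D.Threefold} (hr : r ∈ φ.reps)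
    {a b x : Cover} {g : D.Grp} (hx : D.proj x ∈ r.domain) (ha : D.proj x ∈ (D.sheet a).source)
    (hb : D.proj x ∈ (D.sheet b).source) (hg : g • x = orbitLift D.Grp b (D.proj x))
    (v w : ℂ × ℂ × ℂ) :
    traceFree (chartTensor r (D.sheetConnection a) (D.sheet b) (D.proj x))
      (actDeriv g x v) (actDeriv g x w) = actDeriv g x (coverTensor φ x v w) := by
  have hs := D.proj_mem_sheet_source x
  have hl : orbitLift D.Grp x (D.proj x) = x := orbitLift_mk_self x
  let L : (ℂ × ℂ × ℂ) ≃ₗ[ℂ] ℂ × ℂ × ℂ :=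
    LinearEquiv.ofInjectiveEndo (actDeriv g x : ℂ × ℂ × ℂ →ₗ[ℂ] ℂ × ℂ × ℂ) (actDeriv_injective g x)
  have h1 := traceFree_equivariant L
    (B := chartTensor r (D.sheetConnection a) (D.sheet x) (D.proj x))
    (C := chartTensor r (D.sheetConnection a) (D.sheet b) (D.proj x)) (fun v w => by
      change coordDeriv _ _ _ (r.diff _ _ (coordInv _ _ _ (actDeriv g x v))
        (coordInv _ _ _ (actDeriv g x w))) = actDeriv g x _
      rw [coordInv_sheet_actDeriv hb hg, coordInv_sheet_actDeriv hb hg,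
        coordDeriv_sheet hs hb (g := g) (by rw [hl, hg]), chartTensor_apply, coordInv_sheet_self,
        coordInv_sheet_self, hl])
  refine (h1 v w).trans ?_
  change actDeriv g x _ = _
  congr 1
  have hc := (φ.cover (D.proj x)).choose_spec
  exact traceFree_chartTensor_congr (D.sheet_mem x) hs hx ha hc.2 hs
    (φ.compatible _ hr _ hc.1) (D.standardConnection.compatible _ ⟨a, rfl⟩ _ ⟨x, rfl⟩) v w

theorem coverTensor_smul (g : D.Grp) (x : Cover) (v w : ℂ × ℂ × ℂ) :
    coverTensor φ (g • x) (actDeriv g x v) (actDeriv g x w) = actDeriv g x (coverTensor φ x v w) := by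
  have hc := (φ.cover (D.proj (g • x))).choose_spec
  have hs := D.proj_mem_sheet_source (g • x)
  have hl : orbitLift D.Grp (g • x) (D.proj (g • x)) = g • x := orbitLift_mk_self (g • x)
  rw [proj_smul] at hs hl
  rw [coverTensor, traceFreeMap_apply]
  -- The chosen representative depends on the point above which it is taken. With an arbitrary one
  -- in its place, `D.proj (g • x)` can be rewritten to `D.proj x`.
  generalize (φ.cover (D.proj (g • x))).choose = r at hc ⊢
  rw [proj_smul] at hc ⊢
  exact traceFree_chartTensor_sheet hc.1 hc.2 hs hs hl.symm v w

theorem traceFree_chartTensor_eq {r : LocalAffineConnection model D.Threefold} (hr : r ∈ φ.reps)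
    {a b x : Cover} (hx : D.proj x ∈ r.domain) (ha : D.proj x ∈ (D.sheet a).source)
    (hb : D.proj x ∈ (D.sheet b).source) (hg : x = orbitLift D.Grp b (D.proj x))
    (v w : ℂ × ℂ × ℂ) :
    traceFree (chartTensor r (D.sheetConnection a) (D.sheet b) (D.proj x)) v w =
      coverTensor φ x v w := by
  have h := traceFree_chartTensor_sheet hr hx ha hb (g := 1) (by rwa [one_smul]) v w
  simpa only [actDeriv_one] using h

/-- The representative and the sheet chosen at `x` serve for all nearby points, since the trace-free
part does not depend on them. -/
theorem contMDiff_coverTensor (v w : ℂ × ℂ × ℂ) :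
    ContMDiff model 𝓘(ℂ, ℂ × ℂ × ℂ) ω (fun x => coverTensor φ x v w) := by
  intro x
  have hc := (φ.cover (D.proj x)).choose_spec
  have hs := D.proj_mem_sheet_source x
  have hl : orbitLift D.Grp x (D.proj x) = x := orbitLift_mk_self x
  have hcont : ContinuousAt D.proj x := D.contMDiff_proj.continuous.continuousAt
  have h1 := (contMDiffAt_traceFree_chartTensor (s := D.sheetConnection x) (D.sheet_mem x) hs hc.2 hs
    v w).comp x D.contMDiff_proj.contMDiffAt
  refine h1.congr_of_eventuallyEq ?_
  filter_upwards [eventually_lift_proj hs (g := 1) (by rw [one_smul, hl]),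
    hcont.eventually ((φ.cover (D.proj x)).choose.domain.isOpen.mem_nhds hc.2),
    hcont.eventually ((D.sheet x).open_source.mem_nhds hs)] with y hy hyr hys
  exact (traceFree_chartTensor_eq hc.1 hyr hys hys (by rw [hy, one_smul]) v w).symm

theorem coverTensor_symm (x : Cover) (v w : ℂ × ℂ × ℂ) :
    coverTensor φ x v w = coverTensor φ x w v := by
  refine traceFree_symm (fun v w => ?_) v w
  rw [chartTensor_apply, LocalAffineConnection.diff_symm (φ.cover (D.proj x)).choose_spec.2
    (D.proj_mem_sheet_source x)]
  rfl

/-- A lattice element translates the fibre over `τ` by its period and has the shear of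
`tensor_eq_of_invariant` as its differential. -/
theorem coverTensor_eq (x : Cover) (v w : ℂ × ℂ × ℂ) :
    coverTensor φ x v w = squareTensor (coverTensor φ (x.1, 0) (1, 0) (1, 0)).2 v w := by
  rw [squareTensor_apply]
  refine D.tensor_eq_of_invariant (τ := x.1) (T := fun z => coverTensor φ (x.1, z)) (fun v w => ?_)
    (fun z v w => coverTensor_symm _ v w) (fun z v => trace_traceFree fun w => rfl)
    (fun X hX z v w => ?_) x.2 v w
  · rw [← contMDiff_iff_contDiff]
    exact (contMDiff_coverTensor v w).comp (contMDiff_const.prodMk contMDiff_id)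
  · have h := coverTensor_smul (φ := φ) ⟨1, ⟨X, hX⟩⟩ (x.1, z) v w
    have h1 : autFactor ((1 : D.Γ) : SL(2, ℝ)) x.1 = 1 := by simp [autFactor]
    have h2 : ∀ u : ℂ × ℂ × ℂ, actDeriv (⟨1, ⟨X, hX⟩⟩ : D.Grp) (x.1, z) u =
        u + (0, u.1 • ((X 0 0 : ℂ), (X 1 0 : ℂ))) := by
      intro u
      rw [actDeriv_apply, h1]
      ext <;> simp [mul_comm]
    have h3 : (⟨1, ⟨X, hX⟩⟩ : D.Grp) • ((x.1, z) : Cover) =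
        (x.1, z + QuaternionicLattice.periodVec x.1 X) := by
      rw [smul_def, h1]
      simp [QuaternionicLattice.periodVec]
      rfl
    rw [h2, h2, h2, h3] at h
    exact h

/-- Every holomorphic projective connection is a translate of the standard one. -/
theorem exists_isTranslate_standardConnection (φ : HolProjConnection model D.Threefold) :
    ∃ c, IsTranslate c D.standardConnection φ := by
  obtain ⟨c, hc⟩ := exists_pairLift_eq (D := D)
    (f := fun τ => (coverTensor φ (τ, 0) (1, 0) (1, 0)).2) (by
      have h1 := (contMDiff_coverTensor (φ := φ) (1, 0) (1, 0)).comp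
        ((contMDiff_id (I := 𝓘(ℂ)) (M := ℍ)).prodMk
          (contMDiff_const (c := (0 : ℂ × ℂ)) (I' := 𝓘(ℂ, ℂ × ℂ))))
      exact (contDiff_snd (𝕜 := ℂ) (E := ℂ) (F := ℂ × ℂ)).contMDiff.comp h1) (by
      intro γ τ
      have h0 := autFactor_ne_zero γ.1 τ
      -- The zero section is preserved by `Γ`, and comparing the factors `cτ + d` on both sides
      -- gives weight three.
      have h := coverTensor_smul (φ := φ) ⟨γ, 0⟩ (τ, 0) (1, 0) (1, 0)
      have h3 : (⟨γ, 0⟩ : D.Grp) • ((τ, 0) : Cover) = (γ • τ, 0) := by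
        rw [smul_def]
        simp
      rw [coverTensor_eq, coverTensor_eq (τ, 0) (1, 0) (1, 0), h3, squareTensor_apply,
        squareTensor_apply, actDeriv_apply, actDeriv_apply] at h
      have h4 := congrArg Prod.snd h
      refine Prod.ext ?_ ?_
      · have h5 := congrArg Prod.fst h4
        simp at h5 ⊢
        field_simp at h5
        rw [h5]
      · have h5 := congrArg Prod.snd h4
        simp at h5 ⊢
        field_simp at h5
        rw [h5])
  refine ⟨c, isTranslate_iff.2 ?_⟩
  rintro _ ⟨a, rfl⟩ r hr p ⟨ha, hp⟩
  obtain ⟨x, rfl⟩ := D.proj_surjective p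
  have hs := D.proj_mem_sheet_source x
  have hl : orbitLift D.Grp x (D.proj x) = x := orbitLift_mk_self x
  have h := isPureTensor_sub_traceFree
    (chartTensor r (D.sheetConnection a) (D.sheet x) (D.proj x))
  -- The difference tensor minus its trace-free part is pure, and the trace-free part is the tensor
  -- of `c`.
  have h1 := h.conj (coordInv_coordDeriv (D.sheet_mem x) hs)
  refine h1.congr fun v w => ?_
  rw [map_sub, chartTensor_apply, coordInv_coordDeriv (D.sheet_mem x) hs,
    coordInv_coordDeriv (D.sheet_mem x) hs, coordInv_coordDeriv (D.sheet_mem x) hs,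
    traceFree_chartTensor_eq hr hp ha hs hl.symm, coverTensor_eq, ← hc, sectionTensor_eq c hs, hl]

end KugaShimuraDatum

/-! ### The torsor of projective classes -/

namespace LocalAffineConnection
open Bundle TopologicalSpace
variable {E : Type*} [NormedAddCommGroup E] [NormedSpace ℂ E] [FiniteDimensional ℂ E]
  {H : Type*} [TopologicalSpace H] {I : ModelWithCorners ℂ E H}
  {M : Type*} [TopologicalSpace M] [ChartedSpace H M] [IsManifold I ω M]

theorem addTensor_diff {r : LocalAffineConnection I M}
    {Θ : Π x : M, TangentSpace I x →L[ℂ] TangentSpace I x →L[ℂ] TangentSpace I x}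
    (hs : ∀ x ∈ r.domain, ∀ v w, Θ x v w = Θ x w v)
    (hh : ∀ x ∈ r.domain, IsHolomorphicTensorAt (fun y v w => Θ y v w) x) {x : M} (hx : x ∈ r.domain)
    (v w : TangentSpace I x) : (r.addTensor Θ hs hh).diff r x v w = Θ x v w := by
  have hv := FiberBundle.mdifferentiableAt_extend I E v
  have h1 := diff_apply (r := r.addTensor Θ hs hh) (s := r) hx hx hv
  rw [FiberBundle.extend_apply_self] at h1
  rw [h1]
  simp [addTensor]

theorem diff_self {r : LocalAffineConnection I M} {x : M} (hx : x ∈ r.domain)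
    (v w : TangentSpace I x) : r.diff r x v w = 0 := by
  have h := diff_apply hx hx (FiberBundle.mdifferentiableAt_extend I E v)
  rw [FiberBundle.extend_apply_self, sub_self] at h
  rw [h, zero_apply]

end LocalAffineConnection

namespace KugaShimuraDatum
open Bundle TopologicalSpace LocalAffineConnection
variable {D : KugaShimuraDatum} {c d : D.SectionPairs} {φ ψ χ : HolProjConnection model D.Threefold}

theorem isTranslate_zero_iff : IsTranslate (0 : D.SectionPairs) φ ψ ↔ ψ.Equivalent φ := by
  rw [isTranslate_iff, HolProjConnection.equivalent_iff]
  simp only [sectionTensor_zero, sub_zero, projEquiv_iff]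
  exact ⟨fun h s hs r hr p hp => h r hr s hs p hp.symm, fun h r hr s hs p hp => h s hs r hr p hp.symm⟩

theorem IsTranslate.symm (h : IsTranslate c φ ψ) : IsTranslate (-c) ψ φ := by
  rw [isTranslate_iff] at *
  intro s hs r hr p hp
  refine (h r hr s hs p hp.symm).neg.congr fun v w => ?_
  rw [sectionTensor_neg, diff_swap hp.1 hp.2]
  abel

theorem IsTranslate.trans (h : IsTranslate c φ ψ) (h' : IsTranslate d ψ χ) :
    IsTranslate (c + d) φ χ := by
  rw [isTranslate_iff] at *
  intro r hr t ht p hp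
  obtain ⟨s, hs, hps⟩ := ψ.cover p
  refine ((h r hr s hs p ⟨hp.1, hps⟩).add (h' s hs t ht p ⟨hps, hp.2⟩)).congr fun v w => ?_
  rw [sectionTensor_add, diff_add hp.2 hps hp.1]
  abel

/-- On the pair `(∂/∂τ, ∂/∂τ)` the tensor has a vertical value, whereas a pure tensor has a multiple
of `∂/∂τ`. -/
theorem eq_zero_of_isPureTensor (h : ∀ p : D.Threefold,
    IsPureTensor (fun v w => sectionTensor c p v w)) : c = 0 := by
  refine pairLift_injective fun τ => ?_
  let x : Cover := (τ, 0)
  have hs := D.proj_mem_sheet_source x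
  have hl : orbitLift D.Grp x (D.proj x) = x := orbitLift_mk_self x
  obtain ⟨θ, hθ⟩ := (h (D.proj x)).conj (coordDeriv_coordInv (D.sheet_mem x) hs)
  have h1 : ∀ v w, squareTensor (pairLift c τ) v w = θ v • w + θ w • v := by
    intro v w
    refine Eq.trans ?_ (hθ v w)
    simp only [sectionTensor_eq c hs]
    rw [coordDeriv_coordInv (D.sheet_mem x) hs,
      coordDeriv_coordInv (D.sheet_mem x) hs, coordDeriv_coordInv (D.sheet_mem x) hs, hl]
  have h2 := h1 (0, 1, 0) (0, 1, 0)
  have h3 := h1 (1, 0, 0) (0, 1, 0)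
  have h4 := h1 (1, 0, 0) (1, 0, 0)
  rw [squareTensor_apply] at h2 h3 h4
  simp at h2 h3 h4
  rw [pairLift_zero]
  exact h4.2

/-- Composing the two translations moves `φ` by `c - d` to itself, so the tensor of `c - d` is pure.
-/
theorem IsTranslate.unique (h : IsTranslate c φ ψ) (h' : IsTranslate d φ ψ) : c = d := by
  have h1 := isTranslate_iff.1 (h.trans h'.symm)
  rw [← sub_eq_zero, sub_eq_add_neg]
  refine eq_zero_of_isPureTensor fun p => ?_
  obtain ⟨r, hr, hp⟩ := φ.cover p
  refine (h1 r hr r hr p ⟨hp, hp⟩).neg.congr fun v w => ?_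
  rw [diff_self hp]
  abel

variable (c φ) in
-- Adding the same tensor to all local representatives does not change their differences, so they
-- stay compatible.
theorem exists_isTranslate : ∃ ψ, IsTranslate c φ ψ := by
  let T : LocalAffineConnection model D.Threefold → LocalAffineConnection model D.Threefold :=
    fun r => r.addTensor (sectionTensor c) (fun p _ v w => sectionTensor_symm c p v w)
      (fun p _ => isHolomorphicTensorAt_sectionTensor c p)
  have hT : ∀ r p, p ∈ r.domain → ∀ v w, (T r).diff r p v w = sectionTensor c p v w :=
    fun r p hp v w => addTensor_diff _ _ hp v w
  refine ⟨⟨T '' φ.reps, fun p => ?_, ?_⟩, isTranslate_iff.2 ?_⟩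
  · obtain ⟨r, hr, hp⟩ := φ.cover p
    exact ⟨T r, ⟨r, hr, rfl⟩, hp⟩
  · rintro _ ⟨r, hr, rfl⟩ _ ⟨s, hs, rfl⟩
    rw [projEquiv_iff]
    intro p hp
    have h1 : p ∈ r.domain := hp.1
    have h2 : p ∈ s.domain := hp.2
    refine (projEquiv_iff.1 (φ.compatible r hr s hs) p ⟨h1, h2⟩).congr fun v w => ?_
    rw [diff_add hp.1 h1 hp.2, diff_add h1 h2 hp.2, hT r p h1, diff_swap hp.2 h2, hT s p h2]
    abel
  · rintro r hr _ ⟨s, hs, rfl⟩ p hp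
    have h2 : p ∈ s.domain := hp.2
    refine (projEquiv_iff.1 (φ.compatible s hs r hr) p ⟨h2, hp.1⟩).congr fun v w => ?_
    rw [diff_add hp.2 h2 hp.1, hT s p h2]
    abel

theorem toClass_eq_iff : φ.toClass = ψ.toClass ↔ IsTranslate (0 : D.SectionPairs) φ ψ := by
  rw [isTranslate_zero_iff]
  exact ⟨fun h => Setoid.symm (Quotient.exact h), fun h => Quotient.sound (Setoid.symm h)⟩

variable (D) in
-- Translations exist and are unique, and any two classes differ by one because both are translates
-- of the standard class.
theorem exists_addTorsor :
    ∃ _ : AddTorsor D.SectionPairs (ProjClass model D.Threefold),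
      ∀ (c : D.SectionPairs) (φ ψ : HolProjConnection model D.Threefold),
        c +ᵥ φ.toClass = ψ.toClass ↔ IsTranslate c φ ψ := by
  choose t ht using fun (c : D.SectionPairs) φ => exists_isTranslate c φ
  let act : D.SectionPairs → ProjClass model D.Threefold → ProjClass model D.Threefold :=
    fun c q => (t c q.out).toClass
  have hout : ∀ q : ProjClass model D.Threefold, q.out.toClass = q := fun q => Quotient.out_eq q
  -- The action is defined by chosen representatives of classes. This description is free of the
  -- choice and reduces the torsor axioms to composition and uniqueness of translations.
  have hact : ∀ (c : D.SectionPairs) φ ψ, act c φ.toClass = ψ.toClass ↔ IsTranslate c φ ψ := by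
    intro c φ ψ
    have h1 : IsTranslate c φ (t c φ.toClass.out) := by
      have := (toClass_eq_iff.1 (hout φ.toClass).symm).trans (ht c φ.toClass.out)
      rwa [zero_add] at this
    rw [toClass_eq_iff]
    constructor
    · intro h
      have := h1.trans h
      rwa [add_zero] at this
    · intro h
      have := h1.symm.trans h
      rwa [neg_add_cancel] at this
  have hdiff : ∀ φ ψ : HolProjConnection model D.Threefold, ∃ c, IsTranslate c φ ψ := by
    intro φ ψ
    obtain ⟨c, hc⟩ := exists_isTranslate_standardConnection φ
    obtain ⟨d, hd⟩ := exists_isTranslate_standardConnection ψ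
    exact ⟨_, hc.symm.trans hd⟩
  choose δ hδ using hdiff
  refine ⟨{ vadd := act, vsub := fun q q' => δ q'.out q.out, nonempty := ⟨D.standardConnection.toClass⟩,
            zero_vadd := ?_, add_vadd := ?_, vsub_vadd' := ?_, vadd_vsub' := ?_ }, hact⟩
  · intro c d q
    change act (c + d) q = act c (act d q)
    rw [← hout q, ← hout (act c (act d q.out.toClass)), hact, add_comm]
    refine IsTranslate.trans (ψ := (act d q.out.toClass).out) ?_ ?_
    · rw [← hact, hout, hout]
    · rw [← hact, hout, hout, hout]
  · intro q
    change act 0 q = q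
    conv_lhs => rw [← hout q]
    conv_rhs => rw [← hout q]
    exact (hact _ _ _).2 (toClass_eq_iff.1 rfl)
  · intro q q'
    change act (δ q'.out q.out) q' = q
    have h := (hact _ _ _).2 (hδ q'.out q.out)
    rwa [hout, hout] at h
  · intro c q
    change δ q.out (act c q).out = c
    refine (hδ _ _).unique ?_
    rw [← hact, hout, hout]

end KugaShimuraDatum

/-! ### Flatness -/

section Shear
variable {a a₁ a₂ : ℂ → ℂ × ℂ} {S : Set ℂ}

/-- The map `(τ, z) ↦ (τ, z + a(τ))`. -/
def shearMap (a : ℂ → ℂ × ℂ) (u : ℂ × ℂ × ℂ) : ℂ × ℂ × ℂ := (u.1, u.2 + a u.1)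

theorem contDiffAt_shearMap {u : ℂ × ℂ × ℂ} (ha : ContDiffAt ℂ ω a u.1) :
    ContDiffAt ℂ ω (shearMap a) u := by
  have h : ContDiffAt ℂ ω (fun u : ℂ × ℂ × ℂ => a u.1) u := ha.comp u contDiffAt_fst
  exact contDiffAt_fst.prodMk (contDiffAt_snd.add h)

theorem hasFDerivAt_comp_fst {f : ℂ → ℂ × ℂ} {f' : ℂ × ℂ} {u : ℂ × ℂ × ℂ} (h : HasDerivAt f f' u.1) :
    HasFDerivAt (fun u : ℂ × ℂ × ℂ => f u.1)
      ((ContinuousLinearMap.fst ℂ ℂ (ℂ × ℂ)).smulRight f') u := by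
  have h1 := h.hasFDerivAt.comp u (hasFDerivAt_fst (𝕜 := ℂ) (p := u))
  refine h1.congr_fderiv ?_
  ext <;> simp

theorem fderiv_shearMap {u : ℂ × ℂ × ℂ} (h : HasDerivAt a (a₁ u.1) u.1) (v : ℂ × ℂ × ℂ) :
    fderiv ℂ (shearMap a) u v = (v.1, v.2 + v.1 • a₁ u.1) := by
  have h1 : HasFDerivAt (shearMap a) _ u :=
    (hasFDerivAt_fst (𝕜 := ℂ)).prodMk ((hasFDerivAt_snd (𝕜 := ℂ)).add (hasFDerivAt_comp_fst h))
  rw [h1.fderiv]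
  rfl

/-- The second derivative is vertical, and the first derivative fixes vertical vectors. This is the
form required by `flatConnection_diff`. -/
theorem fderiv_fderiv_shearMap (hS : IsOpen S) (ha : ContDiffOn ℂ ω a S)
    (h : ∀ t ∈ S, HasDerivAt a (a₁ t) t)
    (h' : ∀ t ∈ S, HasDerivAt a₁ (a₂ t) t) {u : ℂ × ℂ × ℂ} (hu : u.1 ∈ S) (v w : ℂ × ℂ × ℂ) :
    fderiv ℂ (fderiv ℂ (shearMap a)) u v w =
      fderiv ℂ (shearMap a) u (0, (v.1 * w.1) • a₂ u.1) := by
  have hd : DifferentiableAt ℂ (fderiv ℂ (shearMap a)) u :=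
    ((contDiffAt_shearMap (ha.contDiffAt (hS.mem_nhds hu))).fderiv_right (m := ω)
      (by simp)).differentiableAt (by simp)
  have h1 : fderiv ℂ (fderiv ℂ (shearMap a)) u v w =
      fderiv ℂ (fun u => fderiv ℂ (shearMap a) u w) u v := by
    rw [fderiv_clm_apply hd (differentiableAt_const w)]
    simp
  have hev : (fun u => fderiv ℂ (shearMap a) u w) =ᶠ[𝓝 u]
      fun u => (w.1, w.2 + w.1 • a₁ u.1) := by
    filter_upwards [continuous_fst.continuousAt.eventually (hS.mem_nhds hu)] with y hy
    exact fderiv_shearMap (h _ hy) w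
  have h2 : HasFDerivAt (fun u : ℂ × ℂ × ℂ => (w.1, w.2 + w.1 • a₁ u.1)) _ u :=
    (hasFDerivAt_const w.1 u).prodMk
      ((hasFDerivAt_const w.2 u).add ((hasFDerivAt_comp_fst (h' _ hu)).const_smul w.1))
  rw [h1, hev.fderiv_eq, h2.fderiv, fderiv_shearMap (h _ hu)]
  simp [smul_smul, mul_comm]

/-- The map `(τ, z) ↦ (τ, z + a(τ))` over an open set of values of `τ`. -/
noncomputable def shear (hS : IsOpen S) (ha : ContDiffOn ℂ ω a S) :
    OpenPartialHomeomorph (ModelProd ℂ (ℂ × ℂ)) (ModelProd ℂ (ℂ × ℂ)) where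
  toFun := shearMap a
  invFun := shearMap (-a)
  source := {u | u.1 ∈ S}
  target := {u | u.1 ∈ S}
  map_source' _ h := h
  map_target' _ h := h
  left_inv' u _ := by simp [shearMap]
  right_inv' u _ := by simp [shearMap]
  open_source := hS.preimage continuous_fst
  open_target := hS.preimage continuous_fst
  continuousOn_toFun u hu :=
    (contDiffAt_shearMap (ha.contDiffAt (hS.mem_nhds hu))).continuousAt.continuousWithinAt
  continuousOn_invFun u hu :=
    (contDiffAt_shearMap (ha.contDiffAt (hS.mem_nhds hu)).neg).continuousAt.continuousWithinAt

end Shear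

namespace KugaShimuraDatum
open Bundle TopologicalSpace LocalAffineConnection
variable {D : KugaShimuraDatum}

theorem contMDiffAt_model_of_contDiffAt {F : ℂ × ℂ × ℂ → ℂ × ℂ × ℂ} {u : ℂ × ℂ × ℂ}
    (hF : ContDiffAt ℂ ω F u) :
    ContMDiffAt (M := ModelProd ℂ (ℂ × ℂ)) (M' := ModelProd ℂ (ℂ × ℂ)) model model ω F u :=
  contMDiffAt_iff.2 ⟨hF.continuousAt, hF.contDiffWithinAt⟩

theorem sheet_trans_shear_mem (b : Cover) {a : ℂ → ℂ × ℂ} {S : Set ℂ} (hS : IsOpen S)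
    (ha : ContDiffOn ℂ ω a S) :
    (D.sheet b).trans (shear hS ha) ∈ IsManifold.maximalAtlas model ω D.Threefold := by
  refine OpenPartialHomeomorph.mem_maximalAtlas_of_contMDiffOn _ ?_ ?_
  · intro p hp
    refine ContMDiffAt.contMDiffWithinAt ?_
    have h1 := contMDiffAt_of_mem_maximalAtlas (D.sheet_mem b) hp.1
    have h2 := contMDiffAt_model_of_contDiffAt (contDiffAt_shearMap
      (u := D.sheet b p) (ha.contDiffAt (hS.mem_nhds hp.2)))
    exact h2.comp p h1
  · intro u hu
    refine ContMDiffAt.contMDiffWithinAt ?_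
    have h2 := contMDiffAt_model_of_contDiffAt (contDiffAt_shearMap
      (u := u) (ha.contDiffAt (hS.mem_nhds hu.1)).neg)
    have h1 := contMDiffAt_symm_of_mem_maximalAtlas (D.sheet_mem b) hu.2
    exact h1.comp u h2

/-- A function on the upper half plane has a second primitive near every point. -/
theorem exists_second_primitive {f : ℍ → ℂ × ℂ} (hf : ContMDiff 𝓘(ℂ) 𝓘(ℂ, ℂ × ℂ) ω f) (τ : ℍ) :
    ∃ (S : Set ℂ) (a a₁ : ℂ → ℂ × ℂ), IsOpen S ∧ (τ : ℂ) ∈ S ∧ ContDiffOn ℂ ω a S ∧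
      (∀ t ∈ S, HasDerivAt a (a₁ t) t) ∧
      ∀ t ∈ S, HasDerivAt a₁ (f (UpperHalfPlane.ofComplex t)) t := by
  -- Holomorphic functions on a disc have primitives, so a disc around `τ` inside the half plane
  -- allows integrating twice.
  obtain ⟨R, hR, hball⟩ := Metric.isOpen_iff.1 UpperHalfPlane.isOpen_upperHalfPlaneSet (τ : ℂ) τ.im_pos
  have hd : DifferentiableOn ℂ (fun t => f (UpperHalfPlane.ofComplex t)) (Metric.ball (τ : ℂ) R) := by
    intro t ht
    have h := hf.contMDiffAt.comp t (UpperHalfPlane.contMDiffAt_ofComplex (n := ω) (hball ht))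
    exact (h.contDiffAt.differentiableAt (by simp)).differentiableWithinAt
  obtain ⟨a₁, h₁⟩ := hd.isExactOn_ball
  have hd₁ : DifferentiableOn ℂ a₁ (Metric.ball (τ : ℂ) R) :=
    fun t ht => (h₁ t ht).differentiableAt.differentiableWithinAt
  obtain ⟨a, h⟩ := hd₁.isExactOn_ball
  have hda : DifferentiableOn ℂ a (Metric.ball (τ : ℂ) R) :=
    fun t ht => (h t ht).differentiableAt.differentiableWithinAt
  exact ⟨_, a, a₁, Metric.isOpen_ball, Metric.mem_ball_self hR, hda.contDiffOn Metric.isOpen_ball,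
    h, h₁⟩

/-- Near every point there is a flat connection that differs from the standard one by the tensor of a
given pair of sections. -/
theorem exists_isFlat_diff_eq (c : D.SectionPairs) (x : Cover) :
    ∃ r : LocalAffineConnection model D.Threefold, r.IsFlat ∧ D.proj x ∈ r.domain ∧
      r.domain ≤ (D.sheetConnection x).domain ∧ ∀ p ∈ r.domain, ∀ v w,
        r.diff (D.sheetConnection x) p v w = sectionTensor c p v w := by
  obtain ⟨S, a, a₁, hS, hx, ha, h, h'⟩ := exists_second_primitive (contMDiff_pairLift c) x.1
  have he := sheet_trans_shear_mem (D := D) x hS ha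
  refine ⟨flatConnection _ he, flatConnection_isFlat _ he, ⟨D.proj_mem_sheet_source x, ?_⟩,
    fun p hp => hp.1, fun p hp v w => ?_⟩
  · change ((orbitLift D.Grp x (D.proj x)).1 : ℂ) ∈ S
    have hl : orbitLift D.Grp x (D.proj x) = x := orbitLift_mk_self x
    rwa [hl]
  · have hp2 : ((D.sheet x).extend model p).1 ∈ S := hp.2
    -- Since `a'' = (A, B)`, the correction term of the sheared chart is the tensor of `c`.
    have h1 := flatConnection_diff (D.sheet_mem x) he hp.1 hp
      (contDiffAt_shearMap (ha.contDiffAt (hS.mem_nhds hp2))) (Filter.Eventually.of_forall fun q => rfl)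
      (fderiv_fderiv_shearMap hS ha h h' hp2) w v
    refine h1.trans ?_
    rw [sectionTensor_symm, sectionTensor_eq c hp.1, squareTensor_apply, sheet_extend]
    simp only [coords, UpperHalfPlane.ofComplex_apply]

theorem isFlat (φ : HolProjConnection model D.Threefold) : φ.IsFlat := by
  obtain ⟨c, hc⟩ := exists_isTranslate_standardConnection φ
  rw [isTranslate_iff] at hc
  -- Take all flat local connections in the class of `φ`. They cover `M` by `exists_isFlat_diff_eq`
  -- and are compatible through representatives of `φ`.
  refine ⟨⟨{r | r.IsFlat ∧ ∀ s ∈ φ.reps, s.ProjEquiv r}, fun p => ?_, ?_⟩,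
    HolProjConnection.equivalent_iff.2 fun s hs r hr => hr.2 s hs, fun r hr => hr.1⟩
  · obtain ⟨x, rfl⟩ := D.proj_surjective p
    obtain ⟨r, hr, hx, hdom, hdiff⟩ := exists_isFlat_diff_eq c x
    refine ⟨r, ⟨hr, fun s hs => projEquiv_iff.2 fun p hp => ?_⟩, hx⟩
    have hp' := hdom hp.2
    refine (hc _ ⟨x, rfl⟩ s hs p ⟨hp', hp.1⟩).congr fun v w => ?_
    rw [diff_add hp.1 hp' hp.2, diff_swap hp.2 hp', hdiff p hp.2]
    abel
  · rintro r ⟨-, hr⟩ t ⟨-, ht⟩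
    rw [projEquiv_iff]
    intro p hp
    obtain ⟨s, hs, hps⟩ := φ.cover p
    refine ((projEquiv_iff.1 (hr s hs).symm p ⟨hp.1, hps⟩).add
      (projEquiv_iff.1 (ht s hs) p ⟨hps, hp.2⟩)).congr fun v w => ?_
    rw [diff_add hp.1 hps hp.2]

/-! ### The fibres -/

/-- A local section of the covering is a left inverse near `τ`. -/
theorem mfderiv_curveProj_injective (τ : ℍ) :
    Function.Injective (mfderiv 𝓘(ℂ) 𝓘(ℂ) D.curveProj τ) := by
  have hl : orbitLift D.Γ τ (D.curveProj τ) = τ := orbitLift_mk_self τ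
  have h1 : MDifferentiableAt 𝓘(ℂ) 𝓘(ℂ) D.curveProj τ :=
    (contMDiff_orbitQuotient_mk D.contMDiff_moebius).contMDiffAt.mdifferentiableAt (n := ω) (by simp)
  have h2 : MDifferentiableAt 𝓘(ℂ) 𝓘(ℂ) (orbitLift D.Γ τ) (D.curveProj τ) :=
    (contMDiffAt_orbitLift D.contMDiff_moebius (mk_mem_orbitLift_source τ)).mdifferentiableAt (by simp)
  have h3 : orbitLift D.Γ τ ∘ D.curveProj =ᶠ[𝓝 τ] id := by
    filter_upwards [eventually_orbitLift_mk (g := (1 : D.Γ)) (mk_mem_orbitLift_source τ)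
      (by rw [one_smul]; exact hl.symm)] with σ hσ
    rw [one_smul] at hσ
    exact hσ
  have h4 := (mfderiv_comp τ h2 h1).symm.trans (h3.mfderiv_eq.trans mfderiv_id)
  intro v w hvw
  have h5 := congrArg (mfderiv 𝓘(ℂ) 𝓘(ℂ) (orbitLift D.Γ τ) (D.curveProj τ)) hvw
  have h6 : ∀ v, mfderiv 𝓘(ℂ) 𝓘(ℂ) (orbitLift D.Γ τ) (D.curveProj τ)
      (mfderiv 𝓘(ℂ) 𝓘(ℂ) D.curveProj τ v) = v := fun v => congrArg (fun L => L v) h4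
  exact (h6 v).symm.trans (h5.trans (h6 w))

/-- In a sheet the fibration is `τ` followed by the covering of the curve, whose differential is
injective. -/
theorem mfderiv_fibration_eq_zero_iff {b : Cover} {q : D.Threefold} (hq : q ∈ (D.sheet b).source)
    (u : TangentSpace model q) :
    mfderiv model 𝓘(ℂ) D.fibration q u = 0 ↔ (coordDeriv model (D.sheet b) q u).1 = 0 := by
  have h1 : D.fibration =ᶠ[𝓝 q] D.curveProj ∘ Prod.fst ∘ orbitLift D.Grp b := by
    filter_upwards [(D.sheet b).open_source.mem_nhds hq] with y hy
    conv_lhs => rw [← proj_orbitLift hy]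
    rfl
  have hl : MDifferentiableAt model model (orbitLift D.Grp b) q :=
    (contMDiffAt_lift hq).mdifferentiableAt (by simp)
  have hc : MDifferentiableAt 𝓘(ℂ) 𝓘(ℂ) D.curveProj (orbitLift D.Grp b q).1 :=
    (contMDiff_orbitQuotient_mk D.contMDiff_moebius).contMDiffAt.mdifferentiableAt (n := ω) (by simp)
  have hf : MDifferentiableAt model 𝓘(ℂ) (Prod.fst : Cover → ℍ) (orbitLift D.Grp b q) :=
    mdifferentiableAt_fst
  have h2 : mfderiv model 𝓘(ℂ) D.fibration q u =
      mfderiv 𝓘(ℂ) 𝓘(ℂ) D.curveProj (orbitLift D.Grp b q).1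
        (coordDeriv model (D.sheet b) q u).1 := by
    have h3 := mfderiv_comp q hc (hf.comp q hl)
    have h4 := mfderiv_comp q hf hl
    rw [mfderiv_fst] at h4
    have h5 : (mfderiv model model (orbitLift D.Grp b) q u : ℂ × ℂ × ℂ) =
      coordDeriv model (D.sheet b) q u := (mfderiv_coords_comp hl u).symm
    have h6 := congrArg (fun L => L u) (h1.mfderiv_eq.trans h3)
    refine h6.trans (congrArg (mfderiv 𝓘(ℂ) 𝓘(ℂ) D.curveProj (orbitLift D.Grp b q).1) ?_)
    exact (congrArg (fun L => L u) h4).trans (congrArg Prod.fst h5)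
  rw [h2]
  exact map_eq_zero_iff (mfderiv 𝓘(ℂ) 𝓘(ℂ) D.curveProj (orbitLift D.Grp b q).1)
    (mfderiv_curveProj_injective _)

/-- A function that vanishes on a fibre has zero derivative along the fibre. -/
theorem mvfderiv_eq_zero_of_vertical {x : Cover} {k : D.Threefold → ℂ}
    (hk : MDifferentiableAt model 𝓘(ℂ) k (D.proj x))
    (h0 : ∀ᶠ q in 𝓝 (D.proj x), D.fibration q = D.fibration (D.proj x) → k q = 0)
    {v : TangentSpace model (D.proj x)} (hv : mfderiv model 𝓘(ℂ) D.fibration (D.proj x) v = 0) :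
    mvfderiv model k (D.proj x) v = 0 := by
  have hs := D.proj_mem_sheet_source x
  rw [mfderiv_fibration_eq_zero_iff hs] at hv
  let s := (coordDeriv model (D.sheet x) (D.proj x) v).2
  have hvs : v = D.projDeriv x (0, s) := by
    have h1 := coordInv_coordDeriv (D.sheet_mem x) hs v
    rw [coordInv_sheet_self] at h1
    rw [← h1]
    congr 1
    exact Prod.ext hv rfl
  -- Along this parametrized fibre `k` vanishes near `x.2`, and `v` is the image of a vector tangent
  -- to it.
  let j : ℂ × ℂ → Cover := fun z => (x.1, z)
  have hj : MDifferentiableAt 𝓘(ℂ, ℂ × ℂ) model j x.2 :=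
    mdifferentiableAt_const.prodMk mdifferentiableAt_id
  have hpj : MDifferentiableAt 𝓘(ℂ, ℂ × ℂ) model (D.proj ∘ j) x.2 :=
    (mdifferentiableAt_proj x).comp x.2 hj
  have hev : k ∘ (D.proj ∘ j) =ᶠ[𝓝 x.2] fun _ => (0 : ℂ) := by
    filter_upwards [hpj.continuousAt.eventually h0] with z hz
    exact hz rfl
  have h1 := mfderiv_comp x.2 (show MDifferentiableAt model 𝓘(ℂ) k ((D.proj ∘ j) x.2) from hk) hpj
  rw [hev.mfderiv_eq, mfderiv_const, mfderiv_comp x.2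
    (show MDifferentiableAt model model D.proj (j x.2) from mdifferentiableAt_proj x) hj,
    mfderiv_prod_right] at h1
  have h2 := congrArg (fun L => L s) h1
  rw [hvs]
  exact h2.symm

theorem fibersTotallyGeodesic (φ : HolProjConnection model D.Threefold) :
    φ.FibersTotallyGeodesic 𝓘(ℂ) D.fibration := by
  obtain ⟨c, hc⟩ := exists_isTranslate_standardConnection φ
  rw [isTranslate_iff] at hc
  intro r hr p hp Y hY hYt v hv
  obtain ⟨x, rfl⟩ := D.proj_surjective p
  have hs := D.proj_mem_sheet_source x
  obtain ⟨θ, hθ⟩ := hc _ ⟨x, rfl⟩ r hr (D.proj x) ⟨hs, hp⟩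
  have h1 : r.diff (D.sheetConnection x) (D.proj x) (Y (D.proj x)) v -
      sectionTensor c (D.proj x) (Y (D.proj x)) v = _ := hθ (Y (D.proj x)) v
  rw [diff_apply hp (s := D.sheetConnection x) hs hY, sub_apply, sub_eq_iff_eq_add, sub_eq_iff_eq_add] at h1
  have hkd := mdifferentiableAt_coordDeriv (D.sheet_mem x) hs hY
  -- For the standard connection the `τ`-component of `∇_v Y` is the derivative along the fibre of
  -- the `τ`-component of `Y`, which vanishes on the fibre.
  have hflat : (coordDeriv model (D.sheet x) (D.proj x)
      ((D.sheetConnection x).cov Y (D.proj x) v)).1 = 0 := by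
    have h2 : coordDeriv model (D.sheet x) (D.proj x) ((D.sheetConnection x).cov Y (D.proj x) v) =
        mvfderiv model (fun y => coordDeriv model (D.sheet x) y (Y y)) (D.proj x) v :=
      coordDeriv_coordInv (D.sheet_mem x) hs _
    have h3 := mvfderiv_comp_of_hasFDerivAt (hasFDerivAt_fst (𝕜 := ℂ)) hkd v
    rw [h2]
    refine h3.symm.trans (mvfderiv_eq_zero_of_vertical ?_ ?_ hv)
    · exact ((contDiff_fst (𝕜 := ℂ) (E := ℂ) (F := ℂ × ℂ)).contMDiff.contMDiffAt
        (n := ω)).mdifferentiableAt (by simp) |>.comp _ hkd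
    · filter_upwards [hYt, (D.sheet x).open_source.mem_nhds hs] with q hq hqs hfq
      exact (mfderiv_fibration_eq_zero_iff hqs _).1 (hq hfq)
  have hY0 := (mfderiv_fibration_eq_zero_iff hs _).1 (hYt.self_of_nhds rfl)
  rw [mfderiv_fibration_eq_zero_iff hs] at hv ⊢
  rw [h1, map_add, map_add, map_add, map_smul, map_smul, sectionTensor_eq c hs,
    coordDeriv_coordInv (D.sheet_mem x) hs, squareTensor_apply]
  simp [hflat, hY0, hv]

end KugaShimuraDatum

theorem mainTheorem2 (D : KugaShimuraDatum) :
    (∃ _ : AddTorsor D.SectionPairs (ProjClass KugaShimuraDatum.model D.Threefold),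
      ∀ (c : D.SectionPairs) (φ ψ : HolProjConnection KugaShimuraDatum.model D.Threefold),
        c +ᵥ φ.toClass = ψ.toClass ↔ KugaShimuraDatum.IsTranslate c φ ψ) ∧
    (∀ φ : HolProjConnection KugaShimuraDatum.model D.Threefold, φ.IsFlat) ∧
    (∀ φ : HolProjConnection KugaShimuraDatum.model D.Threefold,
      φ.FibersTotallyGeodesic 𝓘(ℂ) D.fibration) := by
  exact ⟨D.exists_addTorsor, KugaShimuraDatum.isFlat, KugaShimuraDatum.fibersTotallyGeodesic⟩
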